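/- Let $R$ be a commutative ring with identity, $C(R)$ the category of unbounded cochain complexes of $R$-modules and $K(R)$ its homotopy category. For $M,N\in C(R)$ let $M\otimes_R N$ be the total tensor product complex, and let $\mathrm{Hom}^\bullet_R(M,N)$ be the complex with $\mathrm{Hom}^i_R(M,N)=\prod_{j}\mathrm{Hom}_R(M^j,N^{i+j})$ and $d^i(f)=d_N\circ f-(-1)^i f\circ d_M$. A complex $M$ is pure acyclic if $N\otimes_R M$ is acyclic for every $R$-module $N$; a morphism in $C(R)$ is a pure quasi-isomorphism if its mapping cone is pure acyclic. Let $K_{pac}(R)\subseteq K(R)$ be the full subcategory of pure acyclic complexes, $D_{pur}(R)=K(R)/K_{pac}(R)$ the Verdier quotient, and $Q:C(R)\to D_{pur}(R)$ the canonical functor. A module $P$ (resp. $I$) is pure projective (resp. pure injective) if $\mathrm{Hom}^\bullet_R(P,-)$ (resp. $\mathrm{Hom}^\bullet_R(-,I)$) preserves pure acyclic complexes. A pure projective resolution of $M$ is a pure quasi-isomorphism $P_M\to M$, where $P_M$ is a complex of pure projective modules such that $\mathrm{Hom}^\bullet_R(P_M,-)$ preserves pure acyclic complexes; a pure injective resolution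 of $N$ is a pure quasi-isomorphism $N\to I_N$, where $I_N$ is a complex of pure injective modules such that $\mathrm{Hom}^\bullet_R(-,I_N)$ preserves pure acyclic complexes. Every complex in $C(R)$ has a pure projective resolution and a pure injective resolution. The tensor product of complexes descends to $D_{pur}(R)$: there is a symmetric monoidal structure on $D_{pur}(R)$ for which $Q$ is a strong symmetric monoidal functor, where $C(R)$ carries the total tensor product and the symmetry $a\otimes b\mapsto(-1)^{ij}\,b\otimes a$ on $A^i\otimes_R B^j$. Moreover, for every choice of pure projective resolutions $P_M\to M$ and pure injective resolutions $N\to I_N$ of all complexes, the assignment $$PHom^\bullet_R(M,N):=\mathrm{Hom}^\bullet_R(P_M,I_N)$$ defines a functor $D_{pur}(R)^{op}\times D_{pur}(R)\to D_{pur}(R)$, whose action on morphisms $f:M'\to M$ and $g:N\to N'$ of $D_{pur}(R)$ is $\mathrm{Hom}^\bullet_R(f',g')$ for any morphisms of complexes $f':P_{M'}\to P_M$ and $g':I_N\to I_{N'}$ representing $f$ and $g$; and there are isomorphisms, natural in $A,B,C\in D_{pur}(R)$, $$PHom^\bullet_R(A\otimes_R B,C)\cong PHom^\bullet_R(A,PHom^\bullet_R(B,C))\quad\text{in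 } D_{pur}(R),$$ $$\mathrm{Hom}_{D_{pur}(R)}(A\otimes_R B,C)\cong \mathrm{Hom}_{D_{pur}(R)}(A,PHom^\bullet_R(B,C))\quad\text{of } R\text{-modules}.$$ The first isomorphism is the one induced by the second: for all $X$, composition with it corresponds to the chain $\mathrm{Hom}(X\otimes(A\otimes B),C)\cong \mathrm{Hom}((X\otimes A)\otimes B,C)\cong \mathrm{Hom}(X\otimes A,PHom^\bullet_R(B,C))\cong \mathrm{Hom}(X,PHom^\bullet_R(A,PHom^\bullet_R(B,C)))$. Consequently $D_{pur}(R)$ is a closed symmetric monoidal category with internal Hom functor $PHom^\bullet_R$, the second isomorphism being its tensor-Hom adjunction. -/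

import Mathlib

open CategoryTheory MonoidalCategory Limits Opposite

universe u

noncomputable section

namespace PureDerived

variable (R : Type u) [CommRing R]

/-- The category of unbounded cochain complexes of `R`-modules. -/
abbrev Cpx : Type (u + 1) := CochainComplex (ModuleCat.{u} R) ℤ

variable {R}

/-- The internal Hom complex: in degree `n` it is the module `∏ j, Hom (M^j, N^(j+n))`, with
differential `f ↦ d_N ∘ f - (-1)^n f ∘ d_M`. -/
def homCpx (M N : Cpx R) : Cpx R where
  X n := ModuleCat.of R (CochainComplex.HomComplex.Cochain M N n)
  d i j := ModuleCat.ofHom (CochainComplex.HomComplex.δ_hom R M N i j)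
  shape i j hij := by
    ext z : 2
    exact CochainComplex.HomComplex.δ_shape i j hij z
  d_comp_d' i j k _ _ := by
    ext z : 2
    exact CochainComplex.HomComplex.δ_δ i j k z

/-- The linear map `z ↦ g ∘ z ∘ f` on homogeneous elements of degree `n` of Hom complexes. -/
def cochainMap {M M' N N' : Cpx R} (f : M' ⟶ M) (g : N ⟶ N') (n : ℤ) :
    CochainComplex.HomComplex.Cochain M N n →ₗ[R] CochainComplex.HomComplex.Cochain M' N' n where
  toFun z := CochainComplex.HomComplex.Cochain.mk (fun p q hpq => f.f p ≫ z.v p q hpq ≫ g.f q)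
  map_add' z w := by ext; simp
  map_smul' r z := by ext; simp

lemma δ_cochainMap {M M' N N' : Cpx R} (f : M' ⟶ M) (g : N ⟶ N') (i j : ℤ) (hij : i + 1 = j)
    (z : CochainComplex.HomComplex.Cochain M N i) :
    CochainComplex.HomComplex.δ i j (cochainMap f g i z) =
      cochainMap f g j (CochainComplex.HomComplex.δ i j z) := by
  refine CochainComplex.HomComplex.Cochain.ext _ _ fun p q hpq => ?_
  simp [cochainMap, CochainComplex.HomComplex.δ_v i j hij _ p q hpq _ _ rfl rfl]

/-- The map `z ↦ g ∘ z ∘ f` of internal Hom complexes. -/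
def homCpxMap {M M' N N' : Cpx R} (f : M' ⟶ M) (g : N ⟶ N') : homCpx M N ⟶ homCpx M' N' where
  f n := ModuleCat.ofHom (cochainMap f g n)
  comm' i j hij := by
    ext z : 2
    exact δ_cochainMap f g i j hij z

/-- The differential of the tensor product of complexes, on the summand `A^i ⊗ B^j`. -/
lemma ιTensorObj_d (A B : Cpx R) (i j n m : ℤ) (h : i + j = n) (hnm : n + 1 = m) :
    HomologicalComplex.ιTensorObj A B i j n h ≫ (A ⊗ B).d n m =
      A.d i (i + 1) ▷ B.X j ≫ HomologicalComplex.ιTensorObj A B (i + 1) j m (by lia) +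
      i.negOnePow • (A.X i ◁ B.d j (j + 1) ≫
        HomologicalComplex.ιTensorObj A B i (j + 1) m (by lia)) := by
  change _ ≫ (HomologicalComplex.tensorObj A B).d n m = _
  rw [HomologicalComplex.mapBifunctor.d_eq, Preadditive.comp_add,
    HomologicalComplex.mapBifunctor.ι_D₁, HomologicalComplex.mapBifunctor.ι_D₂,
    HomologicalComplex.mapBifunctor.d₁_eq A B _ _ (i₁' := i + 1) rfl j m (by dsimp; lia),
    HomologicalComplex.mapBifunctor.d₂_eq A B _ _ i (i₂' := j + 1) rfl m (by dsimp; lia)]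
  simp [ComplexShape.ε₁, ComplexShape.ε₂, TotalComplexShape.ε₁, TotalComplexShape.ε₂]

/-- The morphism `A ⊗ B ⟶ B ⊗ A` which is `a ⊗ b ↦ (-1)^(ij) b ⊗ a` on `A^i ⊗ B^j`. -/
def koszulBraiding (A B : Cpx R) : A ⊗ B ⟶ B ⊗ A where
  f n := HomologicalComplex.mapBifunctorDesc (fun i j h =>
    (i * j).negOnePow • ((β_ (A.X i) (B.X j)).hom ≫
      HomologicalComplex.ιTensorObj B A j i n ((add_comm j i).trans h)))
  comm' n m hnm := by
    refine HomologicalComplex.mapBifunctor.hom_ext fun i j h => ?_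
    replace h : i + j = n := h
    replace hnm : n + 1 = m := hnm
    rw [HomologicalComplex.ι_mapBifunctorDesc_assoc, Linear.units_smul_comp, Category.assoc,
      ιTensorObj_d B A j i n m ((add_comm j i).trans h) hnm, ← Category.assoc]
    refine Eq.trans ?_ (congrArg (· ≫ HomologicalComplex.mapBifunctorDesc _)
      (ιTensorObj_d A B i j n m h hnm)).symm
    simp only [Preadditive.add_comp, Linear.units_smul_comp, Category.assoc,
      HomologicalComplex.ι_mapBifunctorDesc, Linear.comp_units_smul, Preadditive.comp_add]
    rw [BraidedCategory.braiding_naturality_left_assoc,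
      BraidedCategory.braiding_naturality_right_assoc, add_comm, smul_add, smul_smul, smul_smul]
    congr 2
    · rw [← Int.negOnePow_add]
      exact congrArg _ (by ring)
    · rw [← Int.negOnePow_add, Int.negOnePow_eq_iff]
      exact ⟨-i, by ring⟩

/-- A complex `M` is pure acyclic if `N ⊗ M` is acyclic for every module `N`. -/
def IsPureAcyclic (M : Cpx R) : Prop :=
  ∀ N : ModuleCat.{u} R,
    (((tensorLeft N).mapHomologicalComplex (ComplexShape.up ℤ)).obj M).Acyclic

/-- A morphism is a pure quasi-isomorphism if its mapping cone is pure acyclic. -/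
def IsPureQuasiIso {M N : Cpx R} (f : M ⟶ N) : Prop :=
  IsPureAcyclic (CochainComplex.mappingCone f)

/-- `Hom(P, -)` preserves pure acyclic complexes. -/
def IsKPureProjective (P : Cpx R) : Prop :=
  ∀ M : Cpx R, IsPureAcyclic M → IsPureAcyclic (homCpx P M)

/-- `Hom(-, I)` preserves pure acyclic complexes. -/
def IsKPureInjective (I : Cpx R) : Prop :=
  ∀ M : Cpx R, IsPureAcyclic M → IsPureAcyclic (homCpx M I)

/-- A module `P` is pure projective if `Hom(P, -)` preserves pure acyclic complexes, where `P` is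
seen as a complex concentrated in degree `0`. -/
def IsPureProjective (P : ModuleCat.{u} R) : Prop :=
  IsKPureProjective ((CochainComplex.singleFunctor (ModuleCat.{u} R) 0).obj P)

/-- A module `I` is pure injective if `Hom(-, I)` preserves pure acyclic complexes, where `I` is
seen as a complex concentrated in degree `0`. -/
def IsPureInjective (I : ModuleCat.{u} R) : Prop :=
  IsKPureInjective ((CochainComplex.singleFunctor (ModuleCat.{u} R) 0).obj I)

/-- A pure projective resolution `P_M ⟶ M` of a complex. -/
structure PureProjectiveResolution (M : Cpx R) where
  /-- the resolving complex -/
  cpx : Cpx R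
  /-- the augmentation -/
  π : cpx ⟶ M
  isPureProjective : ∀ i : ℤ, IsPureProjective (cpx.X i)
  isPureQuasiIso : IsPureQuasiIso π
  isKPureProjective : IsKPureProjective cpx

/-- A pure injective resolution `N ⟶ I_N` of a complex. -/
structure PureInjectiveResolution (N : Cpx R) where
  /-- the resolving complex -/
  cpx : Cpx R
  /-- the coaugmentation -/
  ι : N ⟶ cpx
  isPureInjective : ∀ i : ℤ, IsPureInjective (cpx.X i)
  isPureQuasiIso : IsPureQuasiIso ι
  isKPureInjective : IsKPureInjective cpx

variable (R)

/-- The homotopy category `K(R)`. -/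
abbrev K : Type (u + 1) := HomotopyCategory (ModuleCat.{u} R) (ComplexShape.up ℤ)

/-- The full subcategory `K_pac(R)` of pure acyclic complexes in `K(R)`. -/
def Kpac : ObjectProperty (K R) := fun X => IsPureAcyclic X.as

lemma Kpac_iff (X : K R) :
    Kpac R X ↔ ∀ N : ModuleCat.{u} R, (HomotopyCategory.subcategoryAcyclic _).inverseImage
      ((tensorLeft N).mapHomotopyCategory (ComplexShape.up ℤ)) X :=
  forall_congr' fun _ =>
    (HomotopyCategory.quotient_obj_mem_subcategoryAcyclic_iff_acyclic _).symm

instance : (Kpac R).IsClosedUnderIsomorphisms where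
  of_iso e h := (Kpac_iff R _).2 fun N =>
    ObjectProperty.prop_of_iso _ e ((Kpac_iff R _).1 h N)

instance : (Kpac R).IsTriangulated where
  exists_zero := ⟨_, isZero_zero (K R), (Kpac_iff R _).2 fun _ => ObjectProperty.prop_zero _⟩
  isStableUnderShiftBy n :=
    { le_shift := fun _ h => (Kpac_iff R _).2 fun N =>
        ObjectProperty.le_shift _ n _ ((Kpac_iff R _).1 h N) }
  toIsTriangulatedClosed₂ := .mk' fun T hT h₁ h₃ => (Kpac_iff R _).2 fun N =>
    ObjectProperty.ext_of_isTriangulatedClosed₂ _ T hT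
      ((Kpac_iff R _).1 h₁ N) ((Kpac_iff R _).1 h₃ N)

/-- The pure derived category, the Verdier quotient `K(R) / K_pac(R)`: the localization of `K(R)`
at the morphisms whose cone lies in `K_pac(R)`. -/
def Dpur : Type (u + 1) := (Kpac R).trW.Localization

instance : Category (Dpur R) := inferInstanceAs (Category (Kpac R).trW.Localization)

/-- The localization functor `K(R) ⥤ D_pur(R)`. -/
def Qh : K R ⥤ Dpur R := (Kpac R).trW.Q

instance : (Qh R).IsLocalization (Kpac R).trW :=
  inferInstanceAs ((Kpac R).trW.Q.IsLocalization (Kpac R).trW)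

instance : Preadditive (Dpur R) := Localization.preadditive (Qh R) (Kpac R).trW

instance : (Qh R).Additive := Localization.functor_additive (Qh R) (Kpac R).trW

instance : Linear R (Dpur R) := Localization.linear R (Qh R) (Kpac R).trW

/-- The canonical functor `C(R) ⥤ K(R) ⥤ D_pur(R)`. -/
def Q : Cpx R ⥤ Dpur R := HomotopyCategory.quotient _ _ ⋙ Qh R

variable {R}

/-- The pure derived Hom functor `PHom : D_pur(R)ᵒᵖ × D_pur(R) ⥤ D_pur(R)` attached to a choice of
pure projective resolutions `P_M ⟶ M` and pure injective resolutions `N ⟶ I_N`. Its value at `(M, N)`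
is `Hom(P_M, I_N)`, and it sends a pair of morphisms `f : M' ⟶ M` and `g : N ⟶ N'` of `D_pur(R)` to
the map `Hom(f', g')` for every choice of morphisms of complexes `f' : P_M' ⟶ P_M` and
`g' : I_N ⟶ I_N'` which represent `f` and `g`. -/
structure PureDerivedHom (P : ∀ M : Cpx R, PureProjectiveResolution M)
    (I : ∀ N : Cpx R, PureInjectiveResolution N) where
  /-- the underlying bifunctor -/
  functor : (Dpur R)ᵒᵖ ⥤ Dpur R ⥤ Dpur R
  /-- the identification of its values -/
  iso (M N : Cpx R) : (functor.obj (op ((Q R).obj M))).obj ((Q R).obj N) ≅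
    (Q R).obj (homCpx (P M).cpx (I N).cpx)
  iso_naturality {M M' N N' : Cpx R} (f : (Q R).obj M' ⟶ (Q R).obj M)
    (g : (Q R).obj N ⟶ (Q R).obj N') (f' : (P M').cpx ⟶ (P M).cpx) (g' : (I N).cpx ⟶ (I N').cpx)
    (hf : (Q R).map f' ≫ (Q R).map (P M).π = (Q R).map (P M').π ≫ f)
    (hg : (Q R).map (I N).ι ≫ (Q R).map g' = g ≫ (Q R).map (I N').ι) :
    ((functor.map f.op).app ((Q R).obj N) ≫ (functor.obj (op ((Q R).obj M'))).map g) ≫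
      (iso M' N').hom = (iso M N).hom ≫ (Q R).map (homCpxMap f' g')

/-- `PHom(B, C)` for objects of `D_pur(R)`. -/
abbrev PureDerivedHom.obj {P : ∀ M : Cpx R, PureProjectiveResolution M}
    {I : ∀ N : Cpx R, PureInjectiveResolution N} (H : PureDerivedHom P I) (B C : Dpur R) : Dpur R :=
  (H.functor.obj (op B)).obj C

/-- `PHom(b, c)` for morphisms of `D_pur(R)`. -/
abbrev PureDerivedHom.map {P : ∀ M : Cpx R, PureProjectiveResolution M}
    {I : ∀ N : Cpx R, PureInjectiveResolution N} (H : PureDerivedHom P I) {B B' C C' : Dpur R}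
    (b : B' ⟶ B) (c : C ⟶ C') : H.obj B C ⟶ H.obj B' C' :=
  (H.functor.map b.op).app C ≫ (H.functor.obj (op B')).map c

end PureDerived

end

/-! Everything rests on the adjunction Hom(A ⊗ B, C) ≅ Hom(A, Hom(B, C)). It holds for complexes and
commutes with the differentials of cochains (`δ_cochainCurry`), so it identifies homotopy classes
and passes to K(R). Pure acyclicity is then detected in two ways.

On one side, let E = Hom_ℤ(R, ℚ/ℤ), an injective cogenerator. A complex X is pure acyclic iff every
morphism A ⊗ X → E vanishes in K(R), for all complexes A (`isPureAcyclic_iff_forall_tensor`). Hence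
K_pac is a tensor ideal, Hom(A, -) preserves its right orthogonal, and K_pac is the left orthogonal
of its right orthogonal. A morphism therefore has pure acyclic cone iff it is inverted by Hom(-, I)
for all I right orthogonal to K_pac. By adjunction this property survives tensoring, and the
symmetric tensor product localizes.

On the other side, X is pure acyclic iff every morphism F[m] → X with F a finitely presented module
vanishes in K(R) (`isPureAcyclic_iff_forall_single`). Since the unit is finitely presented and
tensor products of finitely presented modules are so again, "Hom(P, -) (resp. Hom(-, I)) preserves
pure acyclic complexes" means that P (resp. I) is left (resp. right) orthogonal to K_pac.

Pure projective resolutions are homotopy colimits of cell attachments with cells F[m], which are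
compact in K(R). Pure injective resolutions are homotopy limits of a dual construction, whose cells
are the shifted character complexes of the F[m]. Compactness has no dual here; its substitute is
that a composite of three morphisms invisible to these cells is zero on every F[m]
(`homKills_fpMod_of_tensorKills`). Killing three times at each stage makes the tower behave as a
Mittag-Leffler system on test objects.

Finally, if I is right orthogonal to K_pac, then so is Hom(B, I), and morphisms into either agree in
K(R) and in D_pur(R). The evaluation Hom(B, I) ⊗ B → I thus stays universal in D_pur(R)
(`isEvaluation_derivedEval`). Transport along P_M ≅ M and N ≅ I_N makes Hom(P_M, I_N) the internal
Hom; the remaining assertions are formal in a closed symmetric monoidal category. -/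

noncomputable section

namespace PureDerived

variable {R : Type u} [CommRing R]

/-! ### The tensor product of complexes on summands, and its Koszul symmetry -/

section

open HomologicalComplex

/-- The inclusion of the summand `A^i ⊗ B^j` in degree `n` of the tensor product of complexes. -/
def tensorι (A B : Cpx R) (i j n : ℤ) (h : i + j = n) : A.X i ⊗ B.X j ⟶ (A ⊗ B).X n :=
  ιTensorObj A B i j n h

/-- The morphism out of a degree of the tensor product of complexes which is given on each
summand. -/
def tensorDesc {A B : Cpx R} {n : ℤ} {Y : ModuleCat.{u} R}
    (f : ∀ i j : ℤ, i + j = n → (A.X i ⊗ B.X j ⟶ Y)) : (A ⊗ B).X n ⟶ Y :=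
  mapBifunctorDesc (K₁ := A) (K₂ := B) (F := curriedTensor (ModuleCat.{u} R))
    (c := ComplexShape.up ℤ) f

@[simp]
lemma tensorι_desc {A B : Cpx R} {n : ℤ} {Y : ModuleCat.{u} R}
    (f : ∀ i j : ℤ, i + j = n → (A.X i ⊗ B.X j ⟶ Y)) (i j : ℤ) (h : i + j = n) :
    tensorι A B i j n h ≫ tensorDesc f = f i j h :=
  ι_mapBifunctorDesc (K₁ := A) (K₂ := B) (F := curriedTensor (ModuleCat.{u} R))
    (c := ComplexShape.up ℤ) f i j h

lemma tensor_hom_ext {A B : Cpx R} {n : ℤ} {Y : ModuleCat.{u} R} {f g : (A ⊗ B).X n ⟶ Y}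
    (h : ∀ (i j : ℤ) (hij : i + j = n), tensorι A B i j n hij ≫ f = tensorι A B i j n hij ≫ g) :
    f = g :=
  mapBifunctor.hom_ext h

lemma tensorι_d (A B : Cpx R) (i j n m : ℤ) (h : i + j = n) (hnm : n + 1 = m) :
    tensorι A B i j n h ≫ (A ⊗ B).d n m =
      A.d i (i + 1) ▷ B.X j ≫ tensorι A B (i + 1) j m (by lia) +
      i.negOnePow • (A.X i ◁ B.d j (j + 1) ≫ tensorι A B i (j + 1) m (by lia)) :=
  ιTensorObj_d A B i j n m h hnm

lemma tensorι_whiskerLeft (A : Cpx R) {B B' : Cpx R} (g : B ⟶ B') (i j n : ℤ) (h : i + j = n) :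
    tensorι A B i j n h ≫ (A ◁ g).f n = A.X i ◁ g.f j ≫ tensorι A B' i j n h := by
  refine (ι_mapBifunctorMap (𝟙 A) g (curriedTensor (ModuleCat.{u} R)) _ i j n h).trans ?_
  simp [tensorι]

lemma tensorι_whiskerRight {A A' : Cpx R} (f : A ⟶ A') (B : Cpx R) (i j n : ℤ) (h : i + j = n) :
    tensorι A B i j n h ≫ (f ▷ B).f n = f.f i ▷ B.X j ≫ tensorι A' B i j n h := by
  refine (ι_mapBifunctorMap f (𝟙 B) (curriedTensor (ModuleCat.{u} R)) _ i j n h).trans ?_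
  simp [tensorι]

lemma tensorι_koszulBraiding (A B : Cpx R) (i j n : ℤ) (h : i + j = n) :
    tensorι A B i j n h ≫ (koszulBraiding A B).f n =
      (i * j).negOnePow • ((β_ (A.X i) (B.X j)).hom ≫
        tensorι B A j i n ((add_comm j i).trans h)) :=
  tensorι_desc (fun i j h => (i * j).negOnePow • ((β_ (A.X i) (B.X j)).hom ≫
    tensorι B A j i n ((add_comm j i).trans h))) i j h

lemma tensorι_associator (A B C : Cpx R) (i j k n p m : ℤ) (h : i + j = n) (h' : n + k = m)
    (hp : j + k = p) (hm : i + p = m) :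
    tensorι A B i j n h ▷ C.X k ≫ tensorι (A ⊗ B) C n k m h' ≫ (α_ A B C).hom.f m =
      (α_ _ _ _).hom ≫ A.X i ◁ tensorι B C j k p hp ≫ tensorι A (B ⊗ C) i p m hm := by
  have h₁ := mapBifunctor₁₂.ι_eq (curriedTensor (ModuleCat.{u} R))
    (curriedTensor (ModuleCat.{u} R)) A B C (ComplexShape.up ℤ) (ComplexShape.up ℤ) i j k n m h h'
  have h₂ := mapBifunctor₂₃.ι_eq (curriedTensor (ModuleCat.{u} R))
    (curriedTensor (ModuleCat.{u} R)) A B C (ComplexShape.up ℤ) (ComplexShape.up ℤ)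
    (ComplexShape.up ℤ) i j k p m hp hm
  have h₃ := ι_mapBifunctorAssociatorX_hom (curriedAssociatorNatIso (ModuleCat.{u} R)) A B C
     (ComplexShape.up ℤ) (ComplexShape.up ℤ) (ComplexShape.up ℤ) i j k m
     (by change i + j + k = m; lia)
  refine (Category.assoc _ _ _).symm.trans
    ((congrArg (· ≫ (α_ A B C).hom.f m) h₁.symm).trans (h₃.trans ?_))
  exact congrArg ((α_ (A.X i) (B.X j) (C.X k)).hom ≫ ·) h₂

lemma tensor₁₂_hom_ext {A B C : Cpx R} {m : ℤ} {Y : ModuleCat.{u} R}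
    {f g : ((A ⊗ B) ⊗ C).X m ⟶ Y}
    (h : ∀ (i j k n : ℤ) (hij : i + j = n) (hnk : n + k = m),
      tensorι A B i j n hij ▷ C.X k ≫ tensorι (A ⊗ B) C n k m hnk ≫ f =
      tensorι A B i j n hij ▷ C.X k ≫ tensorι (A ⊗ B) C n k m hnk ≫ g) : f = g := by
  refine mapBifunctor₁₂.hom_ext (F₁₂ := curriedTensor (ModuleCat.{u} R)) 
    (G := curriedTensor (ModuleCat.{u} R)) fun i j k hm => ?_
  rw [mapBifunctor₁₂.ι_eq _ _ _ _ _ _ _ _ _ _ (i + j) _ rfl hm]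
  rw [Category.assoc, Category.assoc]
  exact h i j k _ rfl hm

lemma koszulBraiding_naturality_right (A : Cpx R) {B B' : Cpx R} (g : B ⟶ B') :
    A ◁ g ≫ koszulBraiding A B' = koszulBraiding A B ≫ g ▷ A := by
  ext n : 1
  refine tensor_hom_ext fun i j h => ?_
  rw [comp_f, comp_f, reassoc_of% tensorι_whiskerLeft, tensorι_koszulBraiding,
    reassoc_of% tensorι_koszulBraiding, Linear.units_smul_comp, Linear.comp_units_smul,
    Category.assoc, tensorι_whiskerRight, BraidedCategory.braiding_naturality_right_assoc]

lemma koszulBraiding_naturality_left {A A' : Cpx R} (f : A ⟶ A') (B : Cpx R) :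
    f ▷ B ≫ koszulBraiding A' B = koszulBraiding A B ≫ B ◁ f := by
  ext n : 1
  refine tensor_hom_ext fun i j h => ?_
  rw [comp_f, comp_f, reassoc_of% tensorι_whiskerRight, tensorι_koszulBraiding,
    reassoc_of% tensorι_koszulBraiding, Linear.units_smul_comp, Linear.comp_units_smul,
    Category.assoc, tensorι_whiskerLeft, BraidedCategory.braiding_naturality_left_assoc]

@[simp]
lemma koszulBraiding_koszulBraiding (A B : Cpx R) :
    koszulBraiding A B ≫ koszulBraiding B A = 𝟙 _ := by
  ext n : 1
  refine tensor_hom_ext fun i j h => ?_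
  rw [comp_f, reassoc_of% tensorι_koszulBraiding, Linear.units_smul_comp, Category.assoc,
    tensorι_koszulBraiding, Linear.comp_units_smul, SymmetricCategory.symmetry_assoc, smul_smul,
    ← Int.negOnePow_add, id_f, show i * j + j * i = 2 * (i * j) by ring, Int.negOnePow_two_mul,
    one_smul, Category.comp_id]

lemma units_smul_whiskerRight {A B : ModuleCat.{u} R} (f : A ⟶ B) (C : ModuleCat.{u} R) (r : ℤˣ) :
    (r • f) ▷ C = r • (f ▷ C) := by
  obtain rfl | rfl := Int.units_eq_one_or r
  · simp
  · rw [Units.neg_smul, Units.neg_smul, one_smul, one_smul]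
    exact (tensorRight C).map_neg (f := f)

lemma whiskerLeft_units_smul (C : ModuleCat.{u} R) {A B : ModuleCat.{u} R} (f : A ⟶ B) (r : ℤˣ) :
    C ◁ (r • f) = r • (C ◁ f) := by
  obtain rfl | rfl := Int.units_eq_one_or r
  · simp
  · rw [Units.neg_smul, Units.neg_smul, one_smul, one_smul]
    exact (tensorLeft C).map_neg (f := f)

/-- On A^i ⊗ B^j ⊗ C^k both sides are the module hexagon, up to the signs of i(j + k) and ij + ik.
-/
lemma koszulBraiding_hexagon_forward (A B C : Cpx R) :
    (α_ A B C).hom ≫ koszulBraiding A (B ⊗ C) ≫ (α_ B C A).hom =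
      koszulBraiding A B ▷ C ≫ (α_ B A C).hom ≫ B ◁ koszulBraiding A C := by
  ext m : 1
  refine tensor₁₂_hom_ext fun i j k n h h' => ?_
  rw [comp_f, comp_f, comp_f, comp_f,
    reassoc_of% (tensorι_associator _ _ _ i j k n (j + k) m h h' rfl (by lia)),
    reassoc_of% tensorι_koszulBraiding, reassoc_of% tensorι_whiskerRight,
    ← comp_whiskerRight_assoc, tensorι_koszulBraiding, units_smul_whiskerRight,
    comp_whiskerRight, Linear.units_smul_comp, Category.assoc, Linear.units_smul_comp,
    Linear.comp_units_smul, Linear.comp_units_smul, Category.assoc,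
    reassoc_of% (tensorι_associator B A C j i k n (i + k) m (by lia) h' rfl (by lia)),
    tensorι_whiskerLeft, ← whiskerLeft_comp_assoc, tensorι_koszulBraiding,
    BraidedCategory.braiding_naturality_right_assoc, 
    tensorι_associator _ _ _ j k i (j + k) (i + k) m rfl (by lia) (by lia) (by lia)]
  simp only [whiskerLeft_units_smul, Linear.units_smul_comp, Linear.comp_units_smul, smul_smul,
    whiskerLeft_comp, Category.assoc]
  rw [BraidedCategory.hexagon_forward_assoc, ← Int.negOnePow_add, mul_add]

/-- The symmetry of the tensor product of complexes. -/
def koszulBraidingIso (A B : Cpx R) : A ⊗ B ≅ B ⊗ A where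
  hom := koszulBraiding A B
  inv := koszulBraiding B A

instance : SymmetricCategory (Cpx R) where
  braiding := koszulBraidingIso
  braiding_naturality_right A _ _ g := koszulBraiding_naturality_right A g
  braiding_naturality_left f B := koszulBraiding_naturality_left f B
  hexagon_forward A B C := koszulBraiding_hexagon_forward A B C
  hexagon_reverse A B C := by
    -- The reverse hexagon is the inverse of the forward one for (C, A, B), because the symmetry is
    -- its own inverse.
    have : α_ C A B ≪≫ koszulBraidingIso C (A ⊗ B) ≪≫ α_ A B C =
        whiskerRightIso (koszulBraidingIso C A) B ≪≫ α_ A C B ≪≫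
          whiskerLeftIso A (koszulBraidingIso C B) :=
      Iso.ext (koszulBraiding_hexagon_forward C A B)
    simpa [koszulBraidingIso] using congrArg Iso.inv this
  symmetry A B := koszulBraiding_koszulBraiding A B

end

/-! ### The tensor-Hom adjunction for complexes, up to homotopy -/

section

open HomologicalComplex CochainComplex.HomComplex

/-- The component `B^j ⟶ C^k` of a cochain, as a linear map. -/
def cochainEval (B C : Cpx R) (q j k : ℤ) (h : j + q = k) :
    Cochain B C q →ₗ[R] B.X j →ₗ[R] C.X k where
  toFun z := (z.v j k h).hom
  map_add' _ _ := by rw [Cochain.add_v, ModuleCat.hom_add]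
  map_smul' _ _ := by rw [Cochain.smul_v, ModuleCat.hom_smul, RingHom.id_apply]

/-- The evaluation `Hom^q(B, C) ⊗ B^j ⟶ C^k`. -/
def homEval (B C : Cpx R) (q j k : ℤ) (h : j + q = k) : (homCpx B C).X q ⊗ B.X j ⟶ C.X k :=
  ModuleCat.ofHom (TensorProduct.lift (cochainEval B C q j k h))

/-- The morphism `X ⟶ Hom^q(B, C)` given by a family of morphisms `X ⊗ B^j ⟶ C^(j+q)`. -/
def homLift {B C : Cpx R} {q : ℤ} {X : ModuleCat.{u} R}
    (f : ∀ j k : ℤ, j + q = k → (X ⊗ B.X j ⟶ C.X k)) : X ⟶ (homCpx B C).X q :=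
  ModuleCat.ofHom (Y := Cochain B C q)
    { toFun := fun x => Cochain.mk fun j k h =>
        ModuleCat.ofHom (TensorProduct.curry (f j k h).hom x)
      map_add' := fun _ _ => by ext; simp
      map_smul' := fun _ _ => by ext; simp }

@[simp]
lemma homLift_homEval {B C : Cpx R} {q : ℤ} {X : ModuleCat.{u} R}
    (f : ∀ j k : ℤ, j + q = k → (X ⊗ B.X j ⟶ C.X k)) (j k : ℤ) (h : j + q = k) :
    homLift f ▷ B.X j ≫ homEval B C q j k h = f j k h := by
  refine ModuleCat.MonoidalCategory.tensor_ext fun x b => ?_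
  rfl

/-- Reduces identities in a Hom complex to identities after evaluation, where they become diagrams
of modules. -/
lemma hom_hom_ext {B C : Cpx R} {q : ℤ} {X : ModuleCat.{u} R} {f g : X ⟶ (homCpx B C).X q}
    (h : ∀ (j k : ℤ) (h : j + q = k),
      f ▷ B.X j ≫ homEval B C q j k h = g ▷ B.X j ≫ homEval B C q j k h) : f = g := by
  ext x : 2
  refine Cochain.ext _ _ fun j k hjk => ?_
  ext b : 2
  exact congr($(h j k hjk) (x ⊗ₜ b))

lemma homCpx_d_homEval (B C : Cpx R) (q q' : ℤ) (hq : q + 1 = q') (j j' k k' : ℤ)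
    (hj : j + 1 = j') (hk : k + 1 = k') (h : j + q = k) :
    (homCpx B C).d q q' ▷ B.X j ≫ homEval B C q' j k' (by lia) =
      homEval B C q j k h ≫ C.d k k' +
        q'.negOnePow • ((homCpx B C).X q ◁ B.d j j' ≫ homEval B C q j' k' (by lia)) := by
  refine ModuleCat.MonoidalCategory.tensor_ext fun z b => ?_
  refine (congr($(δ_v q q' hq (z : Cochain B C q) j k' (by lia) k j' (by lia) (by lia)) b)).trans ?_
  obtain h | h := Int.units_eq_one_or q'.negOnePow <;> rw [h] <;> simp <;> rfl

lemma homCpxMap_homEval {B B' C C' : Cpx R} (f : B' ⟶ B) (g : C ⟶ C') (q j k : ℤ)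
    (h : j + q = k) :
    (homCpxMap f g).f q ▷ B'.X j ≫ homEval B' C' q j k h =
      (homCpx B C).X q ◁ f.f j ≫ homEval B C q j k h ≫ g.f k := by
  refine ModuleCat.MonoidalCategory.tensor_ext fun z b => ?_
  rfl

/-- Currying of cochains. -/
def cochainCurry {A B C : Cpx R} {n : ℤ} (z : Cochain (A ⊗ B) C n) : Cochain A (homCpx B C) n :=
  Cochain.mk fun p q hpq => homLift fun j k h =>
    tensorι A B p j (p + j) rfl ≫ z.v (p + j) k (by lia)

/-- Uncurrying of cochains. -/
def cochainUncurry {A B C : Cpx R} {n : ℤ} (w : Cochain A (homCpx B C) n) : Cochain (A ⊗ B) C n :=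
  Cochain.mk fun m k hmk => tensorDesc fun i j h =>
    w.v i (i + n) rfl ▷ B.X j ≫ homEval B C (i + n) j k (by lia)

lemma cochainCurry_v_homEval {A B C : Cpx R} {n : ℤ} (z : Cochain (A ⊗ B) C n) (p q j k m : ℤ)
    (hpq : p + n = q) (h : j + q = k) (hm : p + j = m) :
    (cochainCurry z).v p q hpq ▷ B.X j ≫ homEval B C q j k h =
      tensorι A B p j m hm ≫ z.v m k (by lia) := by
  subst hm
  exact homLift_homEval _ _ _ _

lemma tensorι_cochainUncurry_v {A B C : Cpx R} {n : ℤ} (w : Cochain A (homCpx B C) n)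
    (i j m k q : ℤ) (h : i + j = m) (hmk : m + n = k) (hq : i + n = q) :
    tensorι A B i j m h ≫ (cochainUncurry w).v m k hmk =
      w.v i q hq ▷ B.X j ≫ homEval B C q j k (by lia) := by
  subst hq
  exact tensorι_desc _ _ _ _

/-- The adjunction between tensor product and internal Hom, on cochains. -/
def cochainCurryEquiv (A B C : Cpx R) (n : ℤ) :
    Cochain (A ⊗ B) C n ≃+ Cochain A (homCpx B C) n where
  toFun := cochainCurry
  invFun := cochainUncurry
  left_inv z := Cochain.ext _ _ fun m k hmk => tensor_hom_ext fun i j h => by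
    rw [tensorι_cochainUncurry_v _ i j m k _ h hmk rfl, cochainCurry_v_homEval _ _ _ _ _ _ _ _ h]
  right_inv w := Cochain.ext _ _ fun p q hpq => hom_hom_ext fun j k h => by
    rw [cochainCurry_v_homEval _ _ _ _ _ _ _ _ rfl, tensorι_cochainUncurry_v]
  map_add' z w := Cochain.ext _ _ fun p q hpq => hom_hom_ext fun j k h => by
    rw [Cochain.add_v, MonoidalPreadditive.add_whiskerRight, Preadditive.add_comp,
      cochainCurry_v_homEval _ _ _ _ _ _ _ _ rfl, cochainCurry_v_homEval _ _ _ _ _ _ _ _ rfl,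
      cochainCurry_v_homEval _ _ _ _ _ _ _ _ rfl, Cochain.add_v, Preadditive.comp_add]

/-- Both sides consist of a d_C, a d_A and a d_B term. The only sign to compare is that of d_B: it
is (-1)^(n' + p) from the tensor differential and (-1)^q from the Hom differential, and q = p + n'.
-/
lemma δ_cochainCurry {A B C : Cpx R} {n n' : ℤ} (z : Cochain (A ⊗ B) C n) (hn : n + 1 = n') :
    δ n n' (cochainCurry z) = cochainCurry (δ n n' z) := by
  refine Cochain.ext _ _ fun p q hpq => hom_hom_ext fun j k h => ?_
  rw [cochainCurry_v_homEval _ _ _ _ _ _ _ _ rfl,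
    δ_v n n' hn z (p + j) k (by lia) (k - 1) (p + j + 1) (by lia) (by lia),
    δ_v n n' hn (cochainCurry z) p q hpq (q - 1) (p + 1) (by lia) (by lia),
    MonoidalPreadditive.add_whiskerRight, Preadditive.add_comp, units_smul_whiskerRight,
    comp_whiskerRight, comp_whiskerRight, Category.assoc, Preadditive.comp_add,
    Linear.units_smul_comp, Linear.comp_units_smul, Category.assoc,
    homCpx_d_homEval B C (q - 1) q (by lia) j (j + 1) (k - 1) k rfl (by lia) (by lia),
    Preadditive.comp_add, Linear.comp_units_smul,
    cochainCurry_v_homEval _ _ _ _ _ (p + j + 1) _ _ (by lia),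
    reassoc_of% (cochainCurry_v_homEval z p (q - 1) j (k - 1) (p + j) (by lia) (by lia) rfl),
    ← whisker_exchange_assoc, cochainCurry_v_homEval _ _ _ _ _ (p + j + 1) _ _ (by lia),
    reassoc_of% (tensorι_d A B p j (p + j) (p + j + 1) rfl rfl), Preadditive.add_comp,
    Linear.units_smul_comp,
    Category.assoc, Category.assoc, smul_add, smul_smul, add_assoc, ← Int.negOnePow_add,
    add_comm (n'.negOnePow • _), add_comm n' p, hpq]

/-- Null-homotopies in the form of cochains of degree -1, to which `cochainCurryEquiv` applies. -/
lemma quotient_map_eq_zero_iff_exists_δ {A B : Cpx R} (f : A ⟶ B) :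
    (HomotopyCategory.quotient _ _).map f = 0 ↔
      ∃ z : Cochain A B (-1), δ (-1) 0 z = Cochain.ofHom f := by
  rw [HomotopyCategory.quotient_map_eq_zero_iff]
  constructor
  · rintro ⟨h⟩
    obtain ⟨z, hz⟩ := Cochain.equivHomotopy _ _ h
    exact ⟨z, by simpa using hz.symm⟩
  · rintro ⟨z, hz⟩
    exact ⟨(Cochain.equivHomotopy _ _).symm ⟨z, by simpa using hz.symm⟩⟩

lemma δ_cochainUncurry {A B C : Cpx R} {n n' : ℤ} (w : Cochain A (homCpx B C) n)
    (hn : n + 1 = n') : δ n n' (cochainUncurry w) = cochainUncurry (δ n n' w) := by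
  obtain ⟨z, rfl⟩ := (cochainCurryEquiv A B C n).surjective w
  change δ n n' ((cochainCurryEquiv A B C n).symm _) =
    (cochainCurryEquiv A B C n').symm (δ n n' (cochainCurry z))
  rw [δ_cochainCurry z hn, AddEquiv.symm_apply_apply]
  exact ((cochainCurryEquiv A B C n').symm_apply_apply _).symm

/-- Currying of morphisms of complexes. -/
def cpxCurry {A B C : Cpx R} (f : A ⊗ B ⟶ C) : A ⟶ homCpx B C :=
  Cocycle.homOf (Cocycle.mk (cochainCurry (Cochain.ofHom f)) 1 (zero_add 1) (by
    rw [δ_cochainCurry _ (zero_add 1), δ_ofHom]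
    exact (cochainCurryEquiv A B C 1).map_zero))

/-- Uncurrying of morphisms of complexes. -/
def cpxUncurry {A B C : Cpx R} (g : A ⟶ homCpx B C) : A ⊗ B ⟶ C :=
  Cocycle.homOf (Cocycle.mk (cochainUncurry (Cochain.ofHom g)) 1 (zero_add 1) (by
    rw [δ_cochainUncurry _ (zero_add 1), δ_ofHom]
    exact (cochainCurryEquiv A B C 1).symm.map_zero))

lemma ofHom_cpxCurry {A B C : Cpx R} (f : A ⊗ B ⟶ C) :
    Cochain.ofHom (cpxCurry f) = cochainCurry (Cochain.ofHom f) :=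
  Cocycle.cochain_ofHom_homOf_eq_coe _

lemma ofHom_cpxUncurry {A B C : Cpx R} (g : A ⟶ homCpx B C) :
    Cochain.ofHom (cpxUncurry g) = cochainUncurry (Cochain.ofHom g) :=
  Cocycle.cochain_ofHom_homOf_eq_coe _

/-- The adjunction between the tensor product and the internal Hom of complexes. -/
def tensorHomEquiv (A B C : Cpx R) : (A ⊗ B ⟶ C) ≃ (A ⟶ homCpx B C) where
  toFun := cpxCurry
  invFun := cpxUncurry
  left_inv f := by
    apply Cochain.ofHom_injective
    rw [ofHom_cpxUncurry, ofHom_cpxCurry]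
    exact (cochainCurryEquiv A B C 0).symm_apply_apply _
  right_inv g := by
    apply Cochain.ofHom_injective
    rw [ofHom_cpxCurry, ofHom_cpxUncurry]
    exact (cochainCurryEquiv A B C 0).apply_symm_apply _

lemma ofHom_tensorHomEquiv {A B C : Cpx R} (f : A ⊗ B ⟶ C) :
    Cochain.ofHom (tensorHomEquiv A B C f) = cochainCurry (Cochain.ofHom f) :=
  ofHom_cpxCurry f

lemma tensorHomEquiv_f_homEval {A B C : Cpx R} (f : A ⊗ B ⟶ C) (p j k : ℤ) (h : j + p = k) :
    (tensorHomEquiv A B C f).f p ▷ B.X j ≫ homEval B C p j k h =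
      tensorι A B p j k ((add_comm p j).trans h) ≫ f.f k := by
  have := cochainCurry_v_homEval (Cochain.ofHom f) p p j k k (add_zero p) h (by lia)
  rwa [← ofHom_tensorHomEquiv, Cochain.ofHom_v, Cochain.ofHom_v] at this

lemma tensorHomEquiv_naturality {A A' B B' C C' : Cpx R} (a : A' ⟶ A) (b : B' ⟶ B) (c : C ⟶ C')
    (f : A ⊗ B ⟶ C) :
    tensorHomEquiv A' B' C' ((a ⊗ₘ b) ≫ f ≫ c) =
      a ≫ tensorHomEquiv A B C f ≫ homCpxMap b c := by
  ext p : 1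
  refine hom_hom_ext fun j k h => ?_
  rw [tensorHomEquiv_f_homEval, MonoidalCategory.tensorHom_def]
  simp only [comp_f, comp_whiskerRight, Category.assoc, homCpxMap_homEval,
    reassoc_of% tensorι_whiskerRight, reassoc_of% tensorι_whiskerLeft]
  rw [← whisker_exchange_assoc, ← whisker_exchange_assoc, ← whisker_exchange_assoc,
    reassoc_of% tensorHomEquiv_f_homEval]

lemma quotient_map_tensorHomEquiv_eq_zero_iff {A B C : Cpx R} (f : A ⊗ B ⟶ C) :
    (HomotopyCategory.quotient _ _).map (tensorHomEquiv A B C f) = 0 ↔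
      (HomotopyCategory.quotient _ _).map f = 0 := by
  rw [quotient_map_eq_zero_iff_exists_δ, quotient_map_eq_zero_iff_exists_δ, ofHom_tensorHomEquiv]
  constructor
  · rintro ⟨w, hw⟩
    obtain ⟨z, rfl⟩ := (cochainCurryEquiv A B C _).surjective w
    exact ⟨z, (cochainCurryEquiv A B C _).injective
      ((δ_cochainCurry z (by lia)).symm.trans hw)⟩
  · rintro ⟨z, hz⟩
    exact ⟨cochainCurry z, by rw [δ_cochainCurry z (by lia), hz]⟩

lemma tensorHomEquiv_sub {A B C : Cpx R} (f g : A ⊗ B ⟶ C) :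
    tensorHomEquiv A B C (f - g) = tensorHomEquiv A B C f - tensorHomEquiv A B C g := by
  apply Cochain.ofHom_injective
  rw [Cochain.ofHom_sub]
  simp only [ofHom_tensorHomEquiv, Cochain.ofHom_sub]
  exact (cochainCurryEquiv A B C 0).map_sub _ _

lemma quotient_map_tensorHomEquiv_eq_iff {A B C : Cpx R} (f g : A ⊗ B ⟶ C) :
    (HomotopyCategory.quotient _ _).map (tensorHomEquiv A B C f) =
      (HomotopyCategory.quotient _ _).map (tensorHomEquiv A B C g) ↔
      (HomotopyCategory.quotient _ _).map f = (HomotopyCategory.quotient _ _).map g := by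
  rw [← sub_eq_zero, ← Functor.map_sub, ← tensorHomEquiv_sub,
    quotient_map_tensorHomEquiv_eq_zero_iff, Functor.map_sub, sub_eq_zero]

end

/-! ### Character complexes, and orthogonality to the pure acyclic complexes -/

section

open HomologicalComplex CochainComplex.HomComplex

variable (R) in
/-- The canonical injective cogenerator of the category of `R`-modules. -/
def cogen : ModuleCat.{u} R := ModuleCat.of R (CharacterModule R)

instance : Injective (cogen R) :=
  have : Module.Injective R (CharacterModule R) :=
    Module.Flat.iff_characterModule_injective.1 inferInstance
  Module.injective_object_of_injective_module R (CharacterModule R)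

lemma exists_hom_cogen_ne_zero {M : ModuleCat.{u} R} {x : M} (hx : x ≠ 0) :
    ∃ f : M ⟶ cogen R, f x ≠ 0 := by
  obtain ⟨c, hc⟩ := CharacterModule.exists_character_apply_ne_zero_of_ne_zero hx
  let f : M →ₗ[R] CharacterModule R :=
    { toFun := fun x => c.comp ((LinearMap.toSpanSingleton R M x).toAddMonoidHom)
      map_add' := fun x y => by
        ext r
        change c (r • (x + y)) = c (r • x) + c (r • y)
        rw [smul_add, map_add]
      map_smul' := fun r x => by
        ext s
        change c (s • r • x) = c ((r • s) • x)
        rw [smul_smul, smul_eq_mul, mul_comm] }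
  refine ⟨ModuleCat.ofHom f, fun h => hc ?_⟩
  have : f x 1 = (0 : CharacterModule R) 1 := congrArg (fun e : CharacterModule R => e 1) h
  have h1 : c ((1 : R) • x) = 0 := this
  rwa [one_smul] at h1

lemma acyclic_iff_forall_exists (Z : Cpx R) :
    Z.Acyclic ↔ ∀ (i j k : ℤ), i + 1 = j → j + 1 = k → ∀ x : Z.X j, Z.d j k x = 0 →
      ∃ y : Z.X i, Z.d i j y = x := by
  constructor
  · rintro h i j k hi hk x hx
    have := (Z.exactAt_iff' i j k (by simp [← hi]) (by simp [hk])).1 (h j)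
    exact (ShortComplex.moduleCat_exact_iff _).1 this x hx
  · intro h j
    rw [Z.exactAt_iff' (j - 1) j (j + 1) (by simp) (by simp), ShortComplex.moduleCat_exact_iff]
    exact fun x hx => h (j - 1) j (j + 1) (by lia) rfl x hx

lemma exists_desc_of_acyclic {Z : Cpx R} (hZ : Z.Acyclic) {J : ModuleCat.{u} R} [Injective J]
    {i j k : ℤ} (hi : i + 1 = j) (hk : j + 1 = k) (g : Z.X j ⟶ J) (hg : Z.d i j ≫ g = 0) :
    ∃ h : Z.X k ⟶ J, Z.d j k ≫ h = g := by
  have := (Z.exactAt_iff' i j k (by simp [← hi]) (by simp [hk])).1 (hZ j)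
  exact ⟨this.descToInjective g hg, this.comp_descToInjective g hg⟩

/-- The map `g` kills the cohomology of `Hom(N, -)`. -/
def HomKills (N : ModuleCat.{u} R) {X Y : Cpx R} (g : X ⟶ Y) : Prop :=
  ∀ (i j k : ℤ), i + 1 = j → j + 1 = k → ∀ φ : N ⟶ X.X j, φ ≫ X.d j k = 0 →
    ∃ ψ : N ⟶ Y.X i, ψ ≫ Y.d i j = φ ≫ g.f j

/-- The map `g` kills the cohomology of `N ⊗ -`. -/
def TensorKills (N : ModuleCat.{u} R) {X Y : Cpx R} (g : X ⟶ Y) : Prop :=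
  ∀ (i j k : ℤ), i + 1 = j → j + 1 = k → ∀ x : (N ⊗ X.X j : ModuleCat.{u} R),
    (N ◁ X.d j k) x = 0 → ∃ y : (N ⊗ Y.X i : ModuleCat.{u} R), (N ◁ Y.d i j) y = (N ◁ g.f j) x

lemma isPureAcyclic_iff_tensorKills (X : Cpx R) :
    IsPureAcyclic X ↔ ∀ N : ModuleCat.{u} R, TensorKills N (𝟙 X) := by
  refine forall_congr' fun N => ?_
  rw [acyclic_iff_forall_exists]
  simp [TensorKills]
  rfl

/-- A morphism N[-m] → X is a cocycle N → X^m, and it is null-homotopic iff that cocycle is a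
boundary. -/
lemma homKills_iff (N : ModuleCat.{u} R) {X Y : Cpx R} (g : X ⟶ Y) :
    HomKills N g ↔ ∀ (m : ℤ) (f : (HomotopyCategory.quotient _ _).obj
      ((CochainComplex.singleFunctor (ModuleCat.{u} R) m).obj N) ⟶
        (HomotopyCategory.quotient _ _).obj X),
      f ≫ (HomotopyCategory.quotient _ _).map g = 0 := by
  have key (m : ℤ) (φ : N ⟶ X.X m) (hφ : φ ≫ X.d m (m + 1) = 0) :
      (HomotopyCategory.quotient _ _).map
        (Cocycle.homOf (Cocycle.fromSingleMk φ (add_zero m) (m + 1) rfl hφ) ≫ g) = 0 ↔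
      ∃ ψ : N ⟶ Y.X (m - 1), ψ ≫ Y.d (m - 1) m = φ ≫ g.f m := by
    rw [← Cocycle.fromSingleMk_mem_coboundaries_iff (φ ≫ g.f m) (add_zero m) (m + 1) rfl
      (by rw [Category.assoc, g.comm, reassoc_of% hφ, zero_comp]),
      quotient_map_eq_zero_iff_exists_δ, mem_coboundaries_iff _ (-1) (by lia)]
    · rw [Cocycle.fromSingleMk_postcomp, Cocycle.postcomp_coe, Cochain.ofHom_comp,
        Cocycle.cochain_ofHom_homOf_eq_coe]
    · lia
  constructor
  · intro h m f
    obtain ⟨f, rfl⟩ := (HomotopyCategory.quotient _ _).map_surjective f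
    obtain ⟨φ, hφ, hf⟩ := Cocycle.fromSingleMk_surjective (Cocycle.ofHom f) m (add_zero m) _ rfl
    rw [← Functor.map_comp, ← Cocycle.homOf_ofHom_eq_self f, ← hf, key]
    exact h _ _ _ (by lia) rfl φ hφ
  · rintro h i j k hi rfl φ hφ
    obtain rfl : i = j - 1 := by lia
    rw [← key j φ hφ, Functor.map_comp]
    exact h _ _


variable (R) in
/-- The cogenerator, as a complex concentrated in degree `0`. -/
abbrev cogenCpx : Cpx R := (single (ModuleCat.{u} R) (ComplexShape.up ℤ) 0).obj (cogen R)

/-- The character complex of a complex. -/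
abbrev dualCpx (X : Cpx R) : Cpx R := homCpx X (cogenCpx R)

/-- The morphism `N ⊗ X^p ⟶ E` attached to a morphism from `N` to degree `-p` of the
character complex of `X`. -/
def dualEval {N : ModuleCat.{u} R} {X : Cpx R} {m : ℤ} (φ : N ⟶ (dualCpx X).X m) (p : ℤ)
    (h : p + m = 0) : N ⊗ X.X p ⟶ cogen R :=
  φ ▷ X.X p ≫ homEval X (cogenCpx R) m p 0 h ≫
    (singleObjXSelf (ComplexShape.up ℤ) 0 (cogen R)).hom

lemma dualEval_injective {N : ModuleCat.{u} R} {X : Cpx R} {m : ℤ} (p : ℤ) (h : p + m = 0)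
    {φ φ' : N ⟶ (dualCpx X).X m} (hφ : dualEval φ p h = dualEval φ' p h) : φ = φ' := by
  refine hom_hom_ext fun j k hk => ?_
  by_cases h0 : k = 0
  · subst h0
    obtain rfl : p = j := by lia
    rw [← cancel_mono (singleObjXSelf (ComplexShape.up ℤ) 0 (cogen R)).hom]
    simpa [dualEval] using hφ
  · exact (isZero_single_obj_X (ComplexShape.up ℤ) 0 (cogen R) k h0).eq_of_tgt _ _

lemma dualEval_surjective {N : ModuleCat.{u} R} {X : Cpx R} {m : ℤ} (p : ℤ) (h : p + m = 0)
    (g : N ⊗ X.X p ⟶ cogen R) : ∃ φ : N ⟶ (dualCpx X).X m, dualEval φ p h = g := by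
  refine ⟨homLift fun j k hk => if hj : j = p then N ◁ (X.XIsoOfEq hj).hom ≫ g ≫
    (singleObjXIsoOfEq (ComplexShape.up ℤ) 0 (cogen R) k (by lia)).inv else 0, ?_⟩
  rw [dualEval, reassoc_of% homLift_homEval, dif_pos rfl]
  simp [singleObjXIsoOfEq, singleObjXSelf]

lemma dualEval_d {N : ModuleCat.{u} R} {X : Cpx R} {m m' : ℤ} (hm : m + 1 = m')
    (φ : N ⟶ (dualCpx X).X m) (p p' : ℤ) (hp : p + 1 = p') (h : p' + m = 0) :
    dualEval (φ ≫ (dualCpx X).d m m') p (by lia) =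
      m'.negOnePow • (N ◁ X.d p p' ≫ dualEval φ p' h) := by
  rw [dualEval, comp_whiskerRight, Category.assoc, ← Category.assoc ((dualCpx X).d m m' ▷ _),
    homCpx_d_homEval X (cogenCpx R) m m' hm p p' (-1) 0 hp (by lia) (by lia)]
  rw [single_obj_d, comp_zero, zero_add, Linear.units_smul_comp, Linear.comp_units_smul,
    Category.assoc, ← whisker_exchange_assoc]
  rfl

lemma dualEval_map {N : ModuleCat.{u} R} {X Y : Cpx R} (g : X ⟶ Y) {m : ℤ}
    (φ : N ⟶ (dualCpx Y).X m) (p : ℤ) (h : p + m = 0) :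
    dualEval (φ ≫ (homCpxMap g (𝟙 (cogenCpx R))).f m) p h = N ◁ g.f p ≫ dualEval φ p h := by
  rw [dualEval, comp_whiskerRight, Category.assoc, reassoc_of% homCpxMap_homEval, id_f,
    Category.id_comp, ← whisker_exchange_assoc]
  rfl

/-- Up to signs, Hom(N, X*) is the complex Hom(N ⊗ X, E), and Hom(-, E) is exact. -/
lemma homKills_dualCpx_of_acyclic {N : ModuleCat.{u} R} {X : Cpx R}
    (h : (((tensorLeft N).mapHomologicalComplex (ComplexShape.up ℤ)).obj X).Acyclic) :
    HomKills N (𝟙 (dualCpx X)) := by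
  rintro i j k hi hk φ hφ
  have hd : dualEval (φ ≫ (dualCpx X).d j k) (-k) (by lia) = 0 := by
    rw [hφ]; simp [dualEval]
  rw [dualEval_d hk φ (-k) (-j) (by lia) (by lia), smul_eq_zero_iff_eq] at hd
  obtain ⟨g, hg⟩ : ∃ g : N ⊗ X.X (-i) ⟶ cogen R, N ◁ X.d (-j) (-i) ≫ g =
      dualEval φ (-j) (by lia) :=
    exists_desc_of_acyclic h (show -k + 1 = -j by lia) (show -j + 1 = -i by lia)
    (dualEval φ (-j) (by lia)) hd
  obtain ⟨ψ, hψ⟩ := dualEval_surjective (m := i) (-i) (by lia) (j.negOnePow • g)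
  refine ⟨ψ, dualEval_injective (-j) (by lia) ?_⟩
  rw [dualEval_d hi ψ (-j) (-i) (by lia) (by lia), hψ, Linear.comp_units_smul, smul_smul,
    Int.units_mul_self, one_smul, id_f, Category.comp_id]
  exact hg

/-- If the image of a cycle x were not a boundary, some functional χ to E would kill the boundaries
but not this image. As a cocycle of Hom(N, Y*), χ becomes a coboundary after pulling back along g,
hence vanishes on x: a contradiction. -/
lemma tensorKills_of_homKills {N : ModuleCat.{u} R} {X Y : Cpx R} {g : X ⟶ Y}
    (h : HomKills N (homCpxMap g (𝟙 (cogenCpx R)))) : TensorKills N g := by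
  rintro i j k hi hk x hx
  by_contra hy
  let S := LinearMap.range (N ◁ Y.d i j).hom
  have hx' : S.mkQ ((N ◁ g.f j) x) ≠ 0 := by
    rw [Submodule.mkQ_apply, ne_eq, Submodule.Quotient.mk_eq_zero]
    exact hy
  obtain ⟨χ, hχ⟩ := exists_hom_cogen_ne_zero (M := ModuleCat.of R (_ ⧸ S)) hx'
  have hχd : N ◁ Y.d i j ≫ ModuleCat.ofHom S.mkQ ≫ χ = 0 := by
    rw [← Category.assoc]
    convert zero_comp
    ext z : 2
    exact (Submodule.Quotient.mk_eq_zero _).2 ⟨z, rfl⟩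
  obtain ⟨φ, hφ⟩ := dualEval_surjective (m := -j) j (by lia) (ModuleCat.ofHom S.mkQ ≫ χ)
  obtain ⟨ψ, hψ⟩ := h (-k) (-j) (-i) (by lia) (by lia) φ (dualEval_injective i (by lia) (by
    rw [dualEval_d (by lia) φ i j hi (by lia), hφ, hχd]
    simp [dualEval]))
  have := congrArg (fun φ => dualEval φ j (by lia)) hψ
  simp only [dualEval_map] at this
  rw [dualEval_d (by lia) ψ j k hk (by lia), hφ] at this
  rw [← Linear.comp_units_smul] at this
  refine hχ (Eq.trans congr($this x).symm ?_)
  rw [ModuleCat.comp_apply, hx, map_zero]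

/-- The hypothesis for N the module of cycles splits each differential onto the cycles, and the
splittings assemble to a contraction. -/
lemma isZero_quotient_obj_of_homKills {Y : Cpx R}
    (h : ∀ N : ModuleCat.{u} R, HomKills N (𝟙 Y)) :
    IsZero ((HomotopyCategory.quotient _ _).obj Y) := by
  have (m : ℤ) : ∃ σ : Y.cycles (m + 1) ⟶ Y.X m, σ ≫ Y.d m (m + 1) = Y.iCycles (m + 1) := by
    obtain ⟨σ, hσ⟩ := h (Y.cycles (m + 1)) m (m + 1) (m + 1 + 1) rfl rfl (Y.iCycles (m + 1))
      (by simp)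
    exact ⟨σ, by simpa using hσ⟩
  choose σ hσ using this
  -- The projection of Y^m onto its cycles along the image of σ; the contraction s is this
  -- projection followed by σ.
  let τ (m : ℤ) : Y.X m ⟶ Y.X m := 𝟙 _ - Y.toCycles m (m + 1) ≫ σ m
  have hτ (m : ℤ) : τ m ≫ Y.d m (m + 1) = 0 := by simp [τ, hσ]
  have hdτ (m : ℤ) : Y.d m (m + 1) ≫ τ (m + 1) = Y.d m (m + 1) := by
    have : Y.d m (m + 1) ≫ Y.toCycles (m + 1) (m + 1 + 1) = 0 := by
      rw [← cancel_mono (Y.iCycles _)]; simp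
    simp [τ, reassoc_of% this]
  let s (m : ℤ) : Y.X (m + 1) ⟶ Y.X m :=
    Y.liftCycles (τ (m + 1)) (m + 1 + 1) (by simp) (hτ _) ≫ σ m
  have hs (m : ℤ) : s m ≫ Y.d m (m + 1) = τ (m + 1) := by simp [s, hσ]
  have hds (m : ℤ) : Y.d m (m + 1) ≫ s m = Y.toCycles m (m + 1) ≫ σ m := by
    have : Y.d m (m + 1) ≫ Y.liftCycles (τ (m + 1)) (m + 1 + 1) (by simp) (hτ _) =
        Y.toCycles m (m + 1) := by
      rw [← cancel_mono (Y.iCycles _)]; simp [hdτ]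
    simp [s, reassoc_of% this]
  rw [IsZero.iff_id_eq_zero, ← CategoryTheory.Functor.map_id, quotient_map_eq_zero_iff_exists_δ]
  refine ⟨Cochain.mk fun p r hpr => (Y.XIsoOfEq (show p = r + 1 by lia)).hom ≫ s r,
    Cochain.ext _ _ fun p r hpr => ?_⟩
  obtain rfl : p = r := by lia
  obtain ⟨r, rfl⟩ : ∃ r, p = r + 1 := ⟨p - 1, by lia⟩
  rw [δ_v (-1) 0 (by lia) _ _ _ hpr r (r + 1 + 1) (by lia) (by lia)]
  simp [hs, hds, τ]

variable (R) in
/-- The quotient functor from complexes to the homotopy category. -/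
abbrev qK : Cpx R ⥤ K R := HomotopyCategory.quotient _ _

lemma Kpac_qK_iff (X : Cpx R) : Kpac R ((qK R).obj X) ↔ IsPureAcyclic X := Iff.rfl

lemma isZero_dualCpx_of_isPureAcyclic {X : Cpx R} (hX : IsPureAcyclic X) :
    IsZero ((qK R).obj (dualCpx X)) :=
  isZero_quotient_obj_of_homKills fun N => homKills_dualCpx_of_acyclic (hX N)

/-- The adjunction between tensor product and Hom, in terms of vanishing of morphisms in the
homotopy category. -/
lemma forall_hom_tensor_eq_zero_iff (A B C : Cpx R) :
    (∀ f : (qK R).obj (A ⊗ B) ⟶ (qK R).obj C, f = 0) ↔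
      ∀ f : (qK R).obj A ⟶ (qK R).obj (homCpx B C), f = 0 := by
  constructor
  · intro h f
    obtain ⟨f, rfl⟩ := (qK R).map_surjective f
    obtain ⟨f, rfl⟩ := (tensorHomEquiv A B C).surjective f
    exact (quotient_map_tensorHomEquiv_eq_zero_iff f).2 (h _)
  · intro h f
    obtain ⟨f, rfl⟩ := (qK R).map_surjective f
    exact (quotient_map_tensorHomEquiv_eq_zero_iff f).1 (h _)

/-- By adjunction the right side says Hom_K(A, X*) = 0. This holds when X is pure acyclic, since X*
is then contractible; conversely the case where A is a module in one degree suffices, E being a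
cogenerator. In this form stability under tensor products is immediate from associativity and
symmetry. -/
lemma isPureAcyclic_iff_forall_tensor (X : Cpx R) :
    IsPureAcyclic X ↔
      ∀ (A : Cpx R) (f : (qK R).obj (A ⊗ X) ⟶ (qK R).obj (cogenCpx R)), f = 0 := by
  constructor
  · intro h A
    rw [forall_hom_tensor_eq_zero_iff]
    exact fun f => (isZero_dualCpx_of_isPureAcyclic h).eq_of_tgt _ _
  · intro h
    rw [isPureAcyclic_iff_tensorKills]
    refine fun N => tensorKills_of_homKills ((homKills_iff _ _).2 fun m f => ?_)
    rw [(forall_hom_tensor_eq_zero_iff _ _ _).1 (h _) f, zero_comp]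

lemma forall_hom_eq_zero_of_iso {C : Type*} [Category C] [HasZeroMorphisms C] {X X' Y : C}
    (e : X ≅ X') (h : ∀ f : X ⟶ Y, f = 0) (f : X' ⟶ Y) : f = 0 := by
  rw [← cancel_epi e.hom, h (e.hom ≫ f), comp_zero]

lemma IsPureAcyclic.tensor_right {X : Cpx R} (hX : IsPureAcyclic X) (B : Cpx R) :
    IsPureAcyclic (X ⊗ B) := by
  rw [isPureAcyclic_iff_forall_tensor] at hX ⊢
  exact fun A => forall_hom_eq_zero_of_iso
    ((qK R).mapIso (α_ A B X ≪≫ whiskerLeftIso A (β_ B X))) (hX (A ⊗ B))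

lemma IsPureAcyclic.tensor_left {X : Cpx R} (hX : IsPureAcyclic X) (B : Cpx R) :
    IsPureAcyclic (B ⊗ X) := by
  rw [isPureAcyclic_iff_forall_tensor] at hX ⊢
  exact fun A => forall_hom_eq_zero_of_iso ((qK R).mapIso (α_ A B X)) (hX (A ⊗ B))

lemma rightOrthogonal_homCpx (A : Cpx R) {I : Cpx R}
    (hI : (Kpac R).rightOrthogonal ((qK R).obj I)) :
    (Kpac R).rightOrthogonal ((qK R).obj (homCpx A I)) := by
  intro X f hX
  obtain ⟨X, rfl⟩ := HomotopyCategory.quotient_obj_surjective X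
  exact (forall_hom_tensor_eq_zero_iff _ _ _).1
    (fun g => hI g ((Kpac_qK_iff _).2 (((Kpac_qK_iff _).1 hX).tensor_right A))) f

variable (R) in
lemma rightOrthogonal_cogenCpx : (Kpac R).rightOrthogonal ((qK R).obj (cogenCpx R)) := by
  intro X f hX
  obtain ⟨X, rfl⟩ := HomotopyCategory.quotient_obj_surjective X
  exact forall_hom_eq_zero_of_iso ((qK R).mapIso (λ_ X))
    ((isPureAcyclic_iff_forall_tensor X).1 hX _) f

variable (R) in
-- The complexes Hom(A, E) lie in the right orthogonal, and orthogonality to them alone is already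
-- pure acyclicity.
lemma leftOrthogonal_rightOrthogonal_Kpac :
    (Kpac R).rightOrthogonal.leftOrthogonal = Kpac R := by
  ext X
  refine ⟨fun h => ?_, fun h Y f hY => hY f h⟩
  obtain ⟨X, rfl⟩ := HomotopyCategory.quotient_obj_surjective X
  rw [Kpac_qK_iff, isPureAcyclic_iff_forall_tensor]
  exact fun A => forall_hom_eq_zero_of_iso ((qK R).mapIso (β_ X A))
    ((forall_hom_tensor_eq_zero_iff _ _ _).2 fun f =>
      h f (rightOrthogonal_homCpx A (rightOrthogonal_cogenCpx R)))

/-- Turns "pure acyclic cone" into a statement about Hom sets, to which the tensor-Hom adjunction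
can be applied directly. -/
lemma trW_Kpac_iff {X Y : K R} (f : X ⟶ Y) :
    (Kpac R).trW f ↔ ∀ I, (Kpac R).rightOrthogonal I →
      Function.Bijective (fun g : Y ⟶ I => f ≫ g) := by
  constructor
  · intro hf I hI
    rw [← ObjectProperty.isLocal_trW] at hI
    exact hI f hf
  · intro h
    obtain ⟨Z, g, k, hT⟩ := Pretriangulated.distinguished_cocone_triangle f
    refine ⟨Z, g, k, hT, ?_⟩
    rw [← leftOrthogonal_rightOrthogonal_Kpac]
    intro I a hI
    have hfg : f ≫ g = 0 := Pretriangulated.comp_distTriang_mor_zero₁₂ _ hT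
    have hkf : k ≫ f⟦(1 : ℤ)⟧' = 0 := Pretriangulated.comp_distTriang_mor_zero₃₁ _ hT
    have hga : g ≫ a = 0 := (h I hI).1 (by
      simp only [← Category.assoc, hfg, zero_comp, comp_zero])
    obtain ⟨b, hb⟩ : ∃ b : X⟦(1 : ℤ)⟧ ⟶ I, a = k ≫ b :=
      Pretriangulated.Triangle.yoneda_exact₃ _ hT a hga
    -- Transposing X[1] → I to X → I[-1] allows surjectivity to be used for I[-1], which is again
    -- right orthogonal. Then b factors through f[1], which k annihilates.
    let adj := (shiftEquiv (K R) (1 : ℤ)).toAdjunction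
    obtain ⟨b, rfl⟩ := (adj.homEquiv _ _).symm.surjective b
    obtain ⟨c, rfl⟩ := (h _ (ObjectProperty.le_shift _ (-1) _ hI)).2 b
    have := adj.homEquiv_naturality_left_symm f c
    refine hb.trans ((congrArg (k ≫ ·) this).trans ?_)
    exact (Category.assoc _ _ _).symm.trans ((congrArg (· ≫ _) hkf).trans zero_comp)

end

/-! ### Finitely presented modules as tests for pure acyclicity -/

section

open HomologicalComplex CochainComplex.HomComplex TensorProduct

lemma exists_eq_sum_tmul_of_span {ι : Type*} [Fintype ι] {M N : Type*} [AddCommGroup M] [Module R M]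
    [AddCommGroup N] [Module R N] {m : ι → M} (hm : Submodule.span R (Set.range m) = ⊤)
    (z : M ⊗[R] N) : ∃ n : ι → N, z = ∑ i, m i ⊗ₜ[R] n i := by
  induction z with
  | zero => exact ⟨0, by simp⟩
  | add x y hx hy =>
    obtain ⟨a, rfl⟩ := hx
    obtain ⟨b, rfl⟩ := hy
    exact ⟨a + b, by simp [TensorProduct.tmul_add, Finset.sum_add_distrib]⟩
  | tmul x y =>
    obtain ⟨c, rfl⟩ := (Submodule.mem_span_range_iff_exists_fun R).1
      (show x ∈ Submodule.span R (Set.range m) by rw [hm]; trivial)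
    exact ⟨fun i => c i • y, by simp [TensorProduct.sum_tmul, TensorProduct.smul_tmul]⟩

/-- The finitely presented module with generators indexed by the columns of a matrix and relations
given by its rows. -/
def fpMod {k n : ℕ} (a : Fin k → Fin n → R) : ModuleCat.{u} R :=
  ModuleCat.of R ((Fin n → R) ⧸ Submodule.span R (Set.range a))

/-- The generators of the module presented by a matrix. -/
def fpMod.gen {k n : ℕ} (a : Fin k → Fin n → R) (j : Fin n) : fpMod a :=
  (Submodule.span R (Set.range a)).mkQ (Pi.single j 1)

lemma fpMod.mkQ_eq_sum {k n : ℕ} (a : Fin k → Fin n → R) (c : Fin n → R) :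
    ((Submodule.span R (Set.range a)).mkQ c : fpMod a) = ∑ j, c j • gen a j := by
  have h : c = ∑ j, c j • (Pi.single j 1 : Fin n → R) := by
    ext i
    simp [Pi.single_apply]
  refine (congrArg _ h).trans ((map_sum (Submodule.span R (Set.range a)).mkQ _ _).trans ?_)
  exact Finset.sum_congr rfl fun j _ => map_smul _ _ _

lemma fpMod.sum_smul_gen {k n : ℕ} (a : Fin k → Fin n → R) (i : Fin k) :
    ∑ j, a i j • gen a j = 0 := by
  rw [← mkQ_eq_sum a (a i)]
  exact (Submodule.Quotient.mk_eq_zero _).2 (Submodule.subset_span ⟨i, rfl⟩)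

lemma fpMod.span_gen {k n : ℕ} (a : Fin k → Fin n → R) :
    Submodule.span R (Set.range (gen a)) = ⊤ := by
  rw [eq_top_iff]
  rintro x -
  obtain ⟨c, rfl⟩ := Submodule.mkQ_surjective _ x
  exact (Submodule.mem_span_range_iff_exists_fun R).2 ⟨c, (mkQ_eq_sum a c).symm⟩

lemma fpMod.exists_hom {k n : ℕ} (a : Fin k → Fin n → R) {M : ModuleCat.{u} R}
    (x : Fin n → M) (hx : ∀ i, ∑ j, a i j • x j = 0) :
    ∃ f : fpMod a ⟶ M, ∀ j, f (gen a j) = x j := by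
  let g : (Fin n → R) →ₗ[R] M := Fintype.linearCombination R x
  refine ⟨ModuleCat.ofHom ((Submodule.span R (Set.range a)).liftQ g ?_), fun j => ?_⟩
  · rw [Submodule.span_le]
    rintro _ ⟨i, rfl⟩
    exact hx i
  · change g (Pi.single j 1) = x j
    simp [g, Fintype.linearCombination_apply_single]

lemma fpMod.hom_ext {k n : ℕ} {a : Fin k → Fin n → R} {M : ModuleCat.{u} R}
    {f g : fpMod a ⟶ M} (h : ∀ j, f (gen a j) = g (gen a j)) : f = g := by
  ext x : 2
  obtain ⟨c, rfl⟩ := Submodule.mkQ_surjective _ x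
  rw [mkQ_eq_sum, map_sum, map_sum]
  exact Finset.sum_congr rfl fun j _ => by rw [map_smul, map_smul]; exact congrArg _ (h j)

/-- Right exactness: fpMod(a) ⊗ M is the cokernel of the map M^k → M^n given by the transpose of a.
-/
lemma fpMod.exists_of_sum_gen_tmul_eq_zero {k n : ℕ} (a : Fin k → Fin n → R)
    {M : ModuleCat.{u} R} (u : Fin n → M) (h : ∑ i, gen a i ⊗ₜ[R] u i = 0) :
    ∃ s : Fin k → M, ∀ i, u i = ∑ j, a j i • s j := by
  obtain ⟨l, c, y, hu, hc⟩ := vanishesTrivially_of_sum_tmul_eq_zero R (span_gen a) h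
  have (t : Fin l) : ∃ r : Fin k → R, ∑ j, r j • a j = fun i => c i t := by
    rw [← Submodule.mem_span_range_iff_exists_fun, ← Submodule.Quotient.mk_eq_zero]
    exact (mkQ_eq_sum a _).trans (hc t)
  choose r hr using this
  refine ⟨fun j => ∑ t, r t j • y t, fun i => ?_⟩
  rw [hu i]
  simp_rw [Finset.smul_sum]
  rw [Finset.sum_comm]
  refine Finset.sum_congr rfl fun t _ => ?_
  rw [← congrFun (hr t) i]
  simp [Finset.sum_smul, smul_smul, mul_comm]

/-- One generator and no relation present R itself, so this is the statement that g is zero on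
cohomology. -/
lemma TensorKills.exists_d_eq {X Y : Cpx R} {g : X ⟶ Y}
    (h : TensorKills (fpMod (0 : Fin 0 → Fin 1 → R)) g) {i j k : ℤ} (hi : i + 1 = j)
    (hk : j + 1 = k) (x : X.X j) (hx : X.d j k x = 0) : ∃ y : Y.X i, Y.d i j y = g.f j x := by
  let a : Fin 0 → Fin 1 → R := 0
  obtain ⟨ρ, hρ⟩ := fpMod.exists_hom a
    (M := MonoidalCategoryStruct.tensorUnit (ModuleCat.{u} R)) (fun _ => (1 : R)) (fun i => i.elim0)
  obtain ⟨y, hy⟩ := h i j k hi hk (fpMod.gen a 0 ⊗ₜ[R] x) (by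
    refine (ModuleCat.MonoidalCategory.whiskerLeft_apply _ _ _ _).trans ?_
    rw [hx, TensorProduct.tmul_zero])
  let l (i : ℤ) : fpMod a ⊗ Y.X i ⟶ Y.X i := ρ ▷ Y.X i ≫ (λ_ (Y.X i)).hom
  have hl : l i ≫ Y.d i j = (fpMod a ◁ Y.d i j) ≫ l j := by
    rw [whisker_exchange_assoc, leftUnitor_naturality, Category.assoc]
  have hl' (y : Y.X j) : l j (fpMod.gen a 0 ⊗ₜ[R] y) = y :=
    (congrArg (fun r : R => r • y) (hρ 0)).trans (one_smul R y)
  exact ⟨l i y, (congr($hl y)).trans ((congrArg (l j) hy).trans (hl' _))⟩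

lemma whiskerLeft_sum_tmul {ι : Type*} [Fintype ι] (N : ModuleCat.{u} R) {M M' : ModuleCat.{u} R}
    (f : M ⟶ M') (v : ι → N) (w : ι → M) :
    (N ◁ f) (∑ i, v i ⊗ₜ[R] w i) = ∑ i, v i ⊗ₜ[R] f (w i) :=
  (map_sum (N ◁ f).hom _ _).trans (Finset.sum_congr rfl fun _ _ => rfl)

lemma hom_sum_smul {ι : Type*} [Fintype ι] {M M' : ModuleCat.{u} R} (f : M ⟶ M') (c : ι → R)
    (w : ι → M) : f (∑ i, c i • w i) = ∑ i, c i • f (w i) :=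
  (map_sum f.hom _ _).trans (Finset.sum_congr rfl fun _ _ => map_smul f.hom _ _)

/-- Each map pays for one step: g₃ lifts the generators to w_j, g₂ bounds the failure of the w_j to
satisfy the relations, and g₁, tensored with the module of the transposed matrix, makes the failure
correctable. With three identities it gives half of the criterion for pure acyclicity; in general it
controls the tower of injective approximations. -/
lemma homKills_fpMod_of_tensorKills {X₃ X₂ X₁ X₀ : Cpx R} {g₃ : X₃ ⟶ X₂} {g₂ : X₂ ⟶ X₁}
    {g₁ : X₁ ⟶ X₀} (h₃ : ∀ {k n} (a : Fin k → Fin n → R), TensorKills (fpMod a) g₃)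
    (h₂ : ∀ {k n} (a : Fin k → Fin n → R), TensorKills (fpMod a) g₂)
    (h₁ : ∀ {k n} (a : Fin k → Fin n → R), TensorKills (fpMod a) g₁)
    {k n : ℕ} (a : Fin k → Fin n → R) : HomKills (fpMod a) (g₃ ≫ g₂ ≫ g₁) := by
  intro p q r hp hr φ hφ
  have hx (j : Fin n) : X₃.d q r (φ (fpMod.gen a j)) = 0 := congr($hφ (fpMod.gen a j))
  choose w hw using fun j => (h₃ 0).exists_d_eq hp hr (φ (fpMod.gen a j)) (hx j)
  have hv (i : Fin k) : X₂.d p q (∑ j, a i j • w j) = 0 := by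
    rw [hom_sum_smul]
    simp only [hw]
    rw [← hom_sum_smul (g₃.f q), ← hom_sum_smul φ, fpMod.sum_smul_gen]
    exact (congrArg (g₃.f q) (map_zero φ.hom)).trans (map_zero (g₃.f q).hom)
  choose t ht using fun i => (h₂ 0).exists_d_eq (show p - 1 + 1 = p by lia) hp _ (hv i)
  -- The module presented by the transpose: its relations ∑ᵢ aᵢⱼ eᵢ = 0 are exactly what makes ∑ᵢ eᵢ
  -- ⊗ tᵢ a cycle.
  let b : Fin n → Fin k → R := fun j i => a i j
  obtain ⟨y, hy⟩ := h₁ b (p - 2) (p - 1) p (by lia) (by lia)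
    (∑ i, fpMod.gen b i ⊗ₜ[R] t i) (by
      rw [whiskerLeft_sum_tmul]
      simp only [ht, hom_sum_smul (g₂.f p), TensorProduct.tmul_sum, TensorProduct.tmul_smul]
      rw [Finset.sum_comm]
      refine Finset.sum_eq_zero fun j _ => ?_
      have h := congrArg (fun z => z ⊗ₜ[R] (g₂.f p) (w j)) (fpMod.sum_smul_gen b j)
      simpa only [TensorProduct.sum_tmul, TensorProduct.zero_tmul, TensorProduct.smul_tmul']
        using h)
  obtain ⟨s', rfl⟩ := exists_eq_sum_tmul_of_span (fpMod.span_gen b) y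
  rw [whiskerLeft_sum_tmul, whiskerLeft_sum_tmul] at hy
  obtain ⟨s, hs⟩ := fpMod.exists_of_sum_gen_tmul_eq_zero b
    (fun i => g₁.f (p - 1) (t i) - X₀.d (p - 2) (p - 1) (s' i)) (by
      simp only [TensorProduct.tmul_sub, Finset.sum_sub_distrib]
      exact sub_eq_zero.2 hy.symm)
  have hdd (i : ℤ) (j : ℤ) (k : ℤ) (z : X₀.X i) : X₀.d j k (X₀.d i j z) = 0 :=
    congr($(X₀.d_comp_d i j k) z)
  have hd (i : Fin k) : ∑ j, a i j • X₀.d (p - 1) p (s j) =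
      ∑ j, a i j • g₁.f p (g₂.f p (w j)) := by
    rw [← hom_sum_smul, ← hom_sum_smul (g₁.f p), ← hom_sum_smul (g₂.f p), ← ht i]
    refine (congrArg (X₀.d (p - 1) p) (hs i).symm).trans ?_
    refine (map_sub (X₀.d (p - 1) p).hom _ _).trans ?_
    refine (congrArg (_ - ·) (hdd _ _ _ _)).trans ((sub_zero _).trans ?_)
    exact congr($(g₁.comm (p - 1) p) (t i))
  -- Subtracting d s_j restores the relations, since g₁ tᵢ = d s'ᵢ + ∑ⱼ aᵢⱼ sⱼ, without changing the
  -- differential.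
  obtain ⟨ψ, hψ⟩ := fpMod.exists_hom a (M := X₀.X p)
    (fun j => g₁.f p (g₂.f p (w j)) - X₀.d (p - 1) p (s j)) (fun i => by
      simp only [smul_sub, Finset.sum_sub_distrib]
      exact sub_eq_zero.2 (hd i).symm)
  refine ⟨ψ, Eq.symm (fpMod.hom_ext fun j => ?_)⟩
  refine Eq.trans ?_ (congrArg (X₀.d p q) (hψ j)).symm
  refine Eq.trans ?_ (map_sub (X₀.d p q).hom _ _).symm
  refine Eq.trans ?_ (congrArg (_ - ·) (hdd _ _ _ _)).symm
  refine Eq.trans ?_ (sub_zero _).symm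
  refine Eq.trans ?_ (congr($(g₁.comm p q) (g₂.f p (w j)))).symm
  refine congrArg (g₁.f q) ?_
  refine Eq.trans ?_ (congr($(g₂.comm p q) (w j))).symm
  exact congrArg (g₂.f q) (hw j).symm

lemma HomKills.exists_d_eq {X Y : Cpx R} {g : X ⟶ Y}
    (h : HomKills (fpMod (0 : Fin 0 → Fin 1 → R)) g) {i j k : ℤ} (hi : i + 1 = j)
    (hk : j + 1 = k) (x : X.X j) (hx : X.d j k x = 0) : ∃ y : Y.X i, Y.d i j y = g.f j x := by
  let a : Fin 0 → Fin 1 → R := 0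
  obtain ⟨φ, hφ⟩ := fpMod.exists_hom a (M := X.X j) (fun _ => x) (fun i => i.elim0)
  obtain ⟨ψ, hψ⟩ := h i j k hi hk φ (fpMod.hom_ext fun c => by
    refine (congrArg (X.d j k) (hφ c)).trans (hx.trans ?_)
    rfl)
  exact ⟨ψ (fpMod.gen a 0), (congr($hψ (fpMod.gen a 0))).trans (congrArg (g.f j) (hφ 0))⟩

/-- A refined form of the equational criterion for vanishing, for an element which is killed by a
linear map. -/
lemma exists_sum_tmul_of_lTensor_eq_zero {N M M' : Type*} [AddCommGroup M] [Module R M]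
    [AddCommGroup N] [Module R N] [AddCommGroup M'] [Module R M'] (f : M →ₗ[R] M')
    (z : N ⊗[R] M) (hz : f.lTensor N z = 0) :
    ∃ (l k : ℕ) (v : Fin l → N) (x : Fin l → M) (a : Fin l → Fin k → R) (y : Fin k → M'),
      z = ∑ i, v i ⊗ₜ[R] x i ∧ (∀ i, f (x i) = ∑ j, a i j • y j) ∧
        ∀ j, ∑ i, a i j • v i = 0 := by
  -- The tensor z lives over a finitely generated submodule J of N, and its image under f already
  -- vanishes over a larger one, J'. The equational criterion is applied to generators of J'.
  obtain ⟨J, hJ, t, rfl⟩ := Submodule.exists_fg_le_eq_rTensor_subtype z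
  have h₁ : (J.subtype.rTensor M') (f.lTensor J t) = 0 := by
    rw [← hz, ← LinearMap.comp_apply, ← LinearMap.comp_apply, LinearMap.rTensor_comp_lTensor,
      LinearMap.lTensor_comp_rTensor]
  obtain ⟨J', hJJ', hJ', h₂⟩ := TensorProduct.eq_zero_of_fg_of_subtype_eq_zero hJ h₁
  have := Module.Finite.iff_fg.2 hJ'
  obtain ⟨l, v, hv⟩ := Module.Finite.exists_fin (R := R) (M := J')
  obtain ⟨x, hx⟩ := exists_eq_sum_tmul_of_span hv ((Submodule.inclusion hJJ').rTensor M t)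
  have h₃ : ∑ i, v i ⊗ₜ[R] f (x i) = 0 := by
    rw [← h₂, ← LinearMap.comp_apply, LinearMap.rTensor_comp_lTensor,
      ← LinearMap.lTensor_comp_rTensor, LinearMap.comp_apply, hx, map_sum]
    rfl
  obtain ⟨k, a, y, h₄, h₅⟩ := vanishesTrivially_of_sum_tmul_eq_zero R hv h₃
  refine ⟨l, k, fun i => v i, x, a, y, ?_, h₄, fun j => ?_⟩
  · have : J.subtype = J'.subtype ∘ₗ Submodule.inclusion hJJ' := rfl
    rw [this, LinearMap.rTensor_comp_apply, hx, map_sum]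
    rfl
  · simpa using congrArg J'.subtype (h₅ j)

/-- A cycle of N ⊗ X only involves a finite system: z = ∑ vᵢ ⊗ xᵢ, d xᵢ = ∑ aᵢⱼ yⱼ, ∑ᵢ aᵢⱼ vᵢ = 0.
The elements d yⱼ define a cocycle on fpMod(a); a lift ψ of it corrects the yⱼ to boundaries d wⱼ,
and then the xᵢ - ∑ aᵢⱼ wⱼ are cycles, hence boundaries. -/
lemma tensorKills_of_homKills_fpMod {X : Cpx R}
    (h : ∀ {k n : ℕ} (a : Fin k → Fin n → R), HomKills (fpMod a) (𝟙 X)) (N : ModuleCat.{u} R) :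
    TensorKills N (𝟙 X) := by
  intro p q r hp hr z hz
  obtain ⟨l, k, v, x, a, y, rfl, hy, hv⟩ := exists_sum_tmul_of_lTensor_eq_zero (X.d q r).hom z hz
  have hdd (i j k : ℤ) (z : X.X i) : X.d j k (X.d i j z) = 0 := congr($(X.d_comp_d i j k) z)
  obtain ⟨φ, hφ⟩ := fpMod.exists_hom a (fun j => X.d r (r + 1) (y j)) (fun i => by
    rw [← hom_sum_smul]
    exact (congrArg (X.d r (r + 1)) (hy i).symm).trans (hdd _ _ _ _))
  obtain ⟨ψ, hψ⟩ := h a r (r + 1) (r + 2) rfl (by lia) φ (fpMod.hom_ext fun j =>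
    (congrArg (X.d (r + 1) (r + 2)) (hφ j)).trans (hdd _ _ _ _))
  have hψ' (j : Fin k) : X.d r (r + 1) (ψ (fpMod.gen a j)) = X.d r (r + 1) (y j) :=
    (congr($hψ (fpMod.gen a j))).trans (hφ j)
  choose w hw using fun j => (h 0).exists_d_eq hr (show r + 1 = r + 1 from rfl)
    (y j - ψ (fpMod.gen a j)) ((map_sub (X.d r (r + 1)).hom _ _).trans
      (sub_eq_zero.2 (hψ' j).symm))
  choose t ht using fun i => (h 0).exists_d_eq hp hr (x i - ∑ j, a i j • w j) (by
    refine (map_sub (X.d q r).hom _ _).trans (sub_eq_zero.2 ((hy i).trans ?_))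
    refine Eq.trans ?_ (hom_sum_smul (X.d q r) (a i) w).symm
    simp only [hw, id_f, ModuleCat.id_apply, smul_sub, Finset.sum_sub_distrib]
    rw [← hom_sum_smul ψ, fpMod.sum_smul_gen]
    exact ((congrArg (_ - ·) (map_zero ψ.hom)).trans (sub_zero _)).symm)
  refine ⟨∑ i, v i ⊗ₜ[R] t i, (whiskerLeft_sum_tmul _ _ _ _).trans ?_⟩
  simp only [ht, id_f, ModuleCat.id_apply, tmul_sub, Finset.sum_sub_distrib, tmul_sum, tmul_smul,
    MonoidalCategory.whiskerLeft_id]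
  rw [Finset.sum_comm, sub_eq_self]
  refine Finset.sum_eq_zero fun j _ => ?_
  have h := congrArg (fun z => z ⊗ₜ[R] w j) (hv j)
  simpa only [TensorProduct.sum_tmul, TensorProduct.zero_tmul, TensorProduct.smul_tmul'] using h

/-- A complex is pure acyclic if and only if `Hom(F, -)` makes it acyclic for all finitely
presented modules `F`. -/
lemma isPureAcyclic_iff_homKills_fpMod (X : Cpx R) :
    IsPureAcyclic X ↔ ∀ {k n : ℕ} (a : Fin k → Fin n → R), HomKills (fpMod a) (𝟙 X) := by
  rw [isPureAcyclic_iff_tensorKills]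
  refine ⟨fun h k n a => ?_, tensorKills_of_homKills_fpMod⟩
  simpa using homKills_fpMod_of_tensorKills (fun b => h (fpMod b)) (fun b => h (fpMod b))
    (fun b => h (fpMod b)) a

lemma HomKills.of_iso {N N' : ModuleCat.{u} R} (e : N ≅ N') {X Y : Cpx R} {g : X ⟶ Y}
    (h : HomKills N g) : HomKills N' g := by
  intro i j k hi hk φ hφ
  obtain ⟨ψ, hψ⟩ := h i j k hi hk (e.hom ≫ φ) (by rw [Category.assoc, hφ, comp_zero])
  exact ⟨e.inv ≫ ψ, by rw [Category.assoc, hψ, Category.assoc, e.inv_hom_id_assoc]⟩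

lemma exists_iso_fpMod (N : ModuleCat.{u} R) [Module.FinitePresentation R N] :
    ∃ (k n : ℕ) (a : Fin k → Fin n → R), Nonempty (fpMod a ≅ N) := by
  obtain ⟨n, S, e, hS⟩ := Module.FinitePresentation.exists_fin R N
  obtain ⟨k, a, rfl⟩ := Submodule.fg_iff_exists_fin_generating_family.1 hS
  exact ⟨k, n, a, ⟨e.symm.toModuleIso⟩⟩

instance {k n : ℕ} (a : Fin k → Fin n → R) : Module.FinitePresentation R (fpMod a) := by
  have : Module.FinitePresentation R ((Fin n → R) ⧸ Submodule.span R (Set.range a)) :=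
    Module.finitePresentation_of_surjective (Submodule.span R (Set.range a)).mkQ
      (Submodule.mkQ_surjective _) (by
        rw [Submodule.ker_mkQ]
        exact Submodule.fg_span (Set.finite_range a))
  exact this

instance (N : ModuleCat.{u} R) [Module.FinitePresentation R N] {k n : ℕ} (a : Fin k → Fin n → R) :
    Module.FinitePresentation R (N ⊗ fpMod a : ModuleCat.{u} R) := by
  have : Module.FinitePresentation R (N ⊗[R] (Fin n → R)) :=
    .of_equiv (TensorProduct.piScalarRight R R N (Fin n)).symm
  have : Module.Finite R (Submodule.span R (Set.range a)) :=
    Module.Finite.iff_fg.2 (Submodule.fg_span (Set.finite_range a))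
  have : Module.FinitePresentation R
      (N ⊗[R] ((Fin n → R) ⧸ Submodule.span R (Set.range a))) := by
    refine Module.finitePresentation_of_surjective
      ((Submodule.span R (Set.range a)).mkQ.lTensor N)
      (LinearMap.lTensor_surjective _ (Submodule.mkQ_surjective _)) ?_
    rw [(lTensor_exact N (f := (Submodule.span R (Set.range a)).subtype)
      (LinearMap.exact_subtype_mkQ _) (Submodule.mkQ_surjective _)).linearMap_ker_eq,
      LinearMap.range_eq_map]
    exact Submodule.FG.map _ Module.Finite.fg_top
  exact this

lemma IsPureAcyclic.homKills {X : Cpx R} (hX : IsPureAcyclic X) (N : ModuleCat.{u} R)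
    [Module.FinitePresentation R N] : HomKills N (𝟙 X) := by
  obtain ⟨k, n, a, ⟨e⟩⟩ := exists_iso_fpMod N
  exact ((isPureAcyclic_iff_homKills_fpMod X).1 hX a).of_iso e

instance : Module.FinitePresentation R (MonoidalCategoryStruct.tensorUnit (ModuleCat.{u} R) : ModuleCat.{u} R) :=
  inferInstanceAs (Module.FinitePresentation R R)

/-- The nonzero degree of a complex concentrated in degree `m`. -/
def singleXIso (m : ℤ) (F : ModuleCat.{u} R) :
    ((CochainComplex.singleFunctor (ModuleCat.{u} R) m).obj F).X m ≅ F :=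
  singleObjXSelf (ComplexShape.up ℤ) m F

/-- The morphism `N ⊗ F ⟶ M^k` attached to a morphism from `N` to the complex `Hom(F, M)`, where
`F` is seen as a complex concentrated in degree `m`. -/
def singleEval {N F : ModuleCat.{u} R} {M : Cpx R} {m q : ℤ}
    (φ : N ⟶ (homCpx ((CochainComplex.singleFunctor (ModuleCat.{u} R) m).obj F) M).X q) (k : ℤ)
    (h : m + q = k) : N ⊗ F ⟶ M.X k :=
  N ◁ (singleXIso m F).inv ≫
    φ ▷ ((CochainComplex.singleFunctor (ModuleCat.{u} R) m).obj F).X m ≫ homEval _ M q m k h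

lemma singleEval_injective {N F : ModuleCat.{u} R} {M : Cpx R} {m q : ℤ} (k : ℤ) (h : m + q = k)
    {φ φ' : N ⟶ (homCpx ((CochainComplex.singleFunctor (ModuleCat.{u} R) m).obj F) M).X q}
    (hφ : singleEval φ k h = singleEval φ' k h) : φ = φ' := by
  refine hom_hom_ext fun j l hl => ?_
  by_cases h0 : j = m
  · subst h0
    obtain rfl : k = l := by lia
    rw [← cancel_epi (N ◁ (singleXIso j F).inv)]
    exact hφ
  · have : IsZero (N ⊗ ((CochainComplex.singleFunctor (ModuleCat.{u} R) m).obj F).X j :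
        ModuleCat.{u} R) :=
      (tensorLeft N).map_isZero (isZero_single_obj_X (ComplexShape.up ℤ) m F j h0)
    exact this.eq_of_src _ _

lemma singleEval_surjective {N F : ModuleCat.{u} R} {M : Cpx R} {m q : ℤ} (k : ℤ) (h : m + q = k)
    (g : N ⊗ F ⟶ M.X k) :
    ∃ φ : N ⟶ (homCpx ((CochainComplex.singleFunctor (ModuleCat.{u} R) m).obj F) M).X q,
      singleEval φ k h = g := by
  subst h
  refine ⟨homLift fun j l hl => if hj : j = m then
    eqToHom (by rw [hj]) ≫ N ◁ (singleXIso m F).hom ≫ g ≫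
      eqToHom (by rw [← hl, hj]) else 0, ?_⟩
  rw [singleEval, homLift_homEval, dif_pos rfl]
  simp [← whiskerLeft_comp_assoc]

lemma singleEval_d {N F : ModuleCat.{u} R} {M : Cpx R} {m q q' : ℤ} (hq : q + 1 = q')
    (φ : N ⟶ (homCpx ((CochainComplex.singleFunctor (ModuleCat.{u} R) m).obj F) M).X q)
    (k k' : ℤ) (h : m + q = k) (hk : k + 1 = k') :
    singleEval (φ ≫ (homCpx _ M).d q q') k' (by lia) = singleEval φ k h ≫ M.d k k' := by
  have hd : ((CochainComplex.singleFunctor (ModuleCat.{u} R) m).obj F).d m (m + 1) = 0 :=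
    (isZero_single_obj_X (ComplexShape.up ℤ) m F (m + 1) (by lia)).eq_of_tgt _ _
  rw [singleEval, comp_whiskerRight, Category.assoc, homCpx_d_homEval _ _ _ _ hq _ _ _ _ rfl hk h,
    hd, MonoidalPreadditive.whiskerLeft_zero, zero_comp, smul_zero, add_zero]
  simp [singleEval]

/-- Hom(N, Hom(F, M)) is Hom(N ⊗ F, M), up to a shift of degrees. -/
lemma homKills_homCpx_single {N F : ModuleCat.{u} R} {M : Cpx R} (h : HomKills (N ⊗ F) (𝟙 M))
    (m : ℤ) :
    HomKills N (𝟙 (homCpx ((CochainComplex.singleFunctor (ModuleCat.{u} R) m).obj F) M)) := by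
  intro i j k hi hk φ hφ
  obtain ⟨ψ, hψ⟩ := h (m + i) (m + j) (m + k) (by lia) (by lia) (singleEval φ _ rfl) (by
    rw [← singleEval_d hk φ _ _ rfl (by lia), hφ, singleEval,
      MonoidalPreadditive.zero_whiskerRight, zero_comp, comp_zero])
  obtain ⟨ψ, rfl⟩ := singleEval_surjective (m + i) rfl ψ
  refine ⟨ψ, singleEval_injective _ rfl ?_⟩
  rw [singleEval_d hi ψ _ _ rfl (by lia), hψ]
  simp

lemma IsPureAcyclic.homCpx_single {M : Cpx R} (hM : IsPureAcyclic M) (m : ℤ) {k n : ℕ}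
    (a : Fin k → Fin n → R) :
    IsPureAcyclic
      (homCpx ((CochainComplex.singleFunctor (ModuleCat.{u} R) m).obj (fpMod a)) M) :=
  (isPureAcyclic_iff_homKills_fpMod _).2 fun _ => homKills_homCpx_single (hM.homKills _) m

lemma isPureAcyclic_iff_forall_single (X : Cpx R) :
    IsPureAcyclic X ↔ ∀ {k n : ℕ} (a : Fin k → Fin n → R) (m : ℤ)
      (f : (qK R).obj ((CochainComplex.singleFunctor (ModuleCat.{u} R) m).obj (fpMod a)) ⟶
        (qK R).obj X), f = 0 := by
  rw [isPureAcyclic_iff_homKills_fpMod]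
  simp only [homKills_iff, CategoryTheory.Functor.map_id, Category.comp_id]

lemma HomKills.hom_single_eq_zero {N : ModuleCat.{u} R} {X : Cpx R} (h : HomKills N (𝟙 X)) (m : ℤ)
    (f : (qK R).obj ((CochainComplex.singleFunctor (ModuleCat.{u} R) m).obj N) ⟶ (qK R).obj X) :
    f = 0 := by
  have := (homKills_iff _ _).1 h m f
  rwa [CategoryTheory.Functor.map_id, Category.comp_id] at this

lemma IsPureAcyclic.hom_unit_eq_zero {X : Cpx R} (hX : IsPureAcyclic X)
    (f : (qK R).obj (MonoidalCategoryStruct.tensorUnit (Cpx R)) ⟶ (qK R).obj X) : f = 0 :=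
  (hX.homKills (MonoidalCategoryStruct.tensorUnit (ModuleCat.{u} R))).hom_single_eq_zero 0 f

/-- If Hom(X, I) is pure acyclic, no nonzero morphism from the unit reaches it, so Hom_K(X, I) = 0.
Conversely, Hom_K(F[m], Hom(X, I)) = Hom_K(F[m] ⊗ X, I), and F[m] ⊗ X is pure acyclic with X. -/
lemma isKPureInjective_iff (I : Cpx R) :
    IsKPureInjective I ↔ (Kpac R).rightOrthogonal ((qK R).obj I) := by
  constructor
  · intro h X f hX
    obtain ⟨X, rfl⟩ := HomotopyCategory.quotient_obj_surjective X
    refine forall_hom_eq_zero_of_iso ((qK R).mapIso (λ_ X))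
      ((forall_hom_tensor_eq_zero_iff _ _ _).2 fun g => ?_) f
    exact (h X hX).hom_unit_eq_zero g
  · intro h X hX
    refine (isPureAcyclic_iff_forall_single _).2 fun a m => ?_
    exact (forall_hom_tensor_eq_zero_iff _ _ _).1 fun f => h f (hX.tensor_left _)

/-- As for injectives, except that the converse moves F[m] to the other side: Hom_K(F[m], Hom(P, X))
= Hom_K(P, Hom(F[m], X)). -/
lemma isKPureProjective_iff (P : Cpx R) :
    IsKPureProjective P ↔ (Kpac R).leftOrthogonal ((qK R).obj P) := by
  constructor
  · intro h X f hX
    obtain ⟨X, rfl⟩ := HomotopyCategory.quotient_obj_surjective X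
    refine forall_hom_eq_zero_of_iso ((qK R).mapIso (λ_ P))
      ((forall_hom_tensor_eq_zero_iff _ _ _).2 fun g => ?_) f
    exact (h X hX).hom_unit_eq_zero g
  · intro h X hX
    refine (isPureAcyclic_iff_forall_single _).2 fun a m => ?_
    refine (forall_hom_tensor_eq_zero_iff _ _ _).1 (forall_hom_eq_zero_of_iso
      ((qK R).mapIso (β_ _ _)) ((forall_hom_tensor_eq_zero_iff _ _ _).2 fun f => ?_))
    exact h f (hX.homCpx_single m a)

/-- Morphisms from `P` lift along the differentials of pure acyclic complexes. -/
def LiftsPure (P : ModuleCat.{u} R) : Prop :=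
  ∀ M : Cpx R, IsPureAcyclic M → HomKills P (𝟙 M)

lemma LiftsPure.leftOrthogonal_single {P : ModuleCat.{u} R} (h : LiftsPure P) (m : ℤ) :
    (Kpac R).leftOrthogonal
      ((qK R).obj ((CochainComplex.singleFunctor (ModuleCat.{u} R) m).obj P)) := by
  intro X f hX
  obtain ⟨X, rfl⟩ := HomotopyCategory.quotient_obj_surjective X
  exact (h X hX).hom_single_eq_zero m f

lemma LiftsPure.isPureProjective {P : ModuleCat.{u} R} (h : LiftsPure P) : IsPureProjective P :=
  (isKPureProjective_iff _).2 (h.leftOrthogonal_single 0)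

lemma liftsPure_of_finitePresentation (N : ModuleCat.{u} R) [Module.FinitePresentation R N] :
    LiftsPure N :=
  fun _ hM => hM.homKills N

lemma LiftsPure.of_isZero {P : ModuleCat.{u} R} (h : IsZero P) : LiftsPure P :=
  fun _ _ _ _ _ _ _ _ _ => ⟨0, h.eq_of_src _ _⟩

lemma LiftsPure.of_iso {P P' : ModuleCat.{u} R} (e : P ≅ P') (h : LiftsPure P) : LiftsPure P' :=
  fun M hM => (h M hM).of_iso e

lemma LiftsPure.of_add_eq_id {P P₁ P₂ : ModuleCat.{u} R} (h₁ : LiftsPure P₁) (h₂ : LiftsPure P₂)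
    (i₁ : P₁ ⟶ P) (i₂ : P₂ ⟶ P) (p₁ : P ⟶ P₁) (p₂ : P ⟶ P₂) (h : p₁ ≫ i₁ + p₂ ≫ i₂ = 𝟙 P) :
    LiftsPure P := by
  intro M hM i j k hi hk φ hφ
  obtain ⟨ψ₁, hψ₁⟩ := h₁ M hM i j k hi hk (i₁ ≫ φ) (by rw [Category.assoc, hφ, comp_zero])
  obtain ⟨ψ₂, hψ₂⟩ := h₂ M hM i j k hi hk (i₂ ≫ φ) (by rw [Category.assoc, hφ, comp_zero])
  refine ⟨p₁ ≫ ψ₁ + p₂ ≫ ψ₂, ?_⟩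
  rw [id_f, Category.comp_id] at hψ₁ hψ₂
  rw [Preadditive.add_comp, Category.assoc, Category.assoc, hψ₁, hψ₂, id_f, Category.comp_id,
    ← Category.assoc, ← Category.assoc, ← Preadditive.add_comp, h,
    Category.id_comp]

lemma LiftsPure.of_isColimit {ι : Type u} {P : ι → ModuleCat.{u} R} (hP : ∀ i, LiftsPure (P i))
    (c : Cofan P) (hc : IsColimit c) : LiftsPure c.pt := by
  intro M hM i j k hi hk φ hφ
  choose ψ hψ using fun t => hP t M hM i j k hi hk (c.inj t ≫ φ)
    (by rw [Category.assoc, hφ, comp_zero])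
  refine ⟨Cofan.IsColimit.desc hc ψ, Cofan.IsColimit.hom_ext hc _ _ fun t => ?_⟩
  rw [← Category.assoc, Cofan.IsColimit.fac hc, hψ, Category.assoc]

/-- Morphisms to `J` extend along the differentials of pure acyclic complexes. -/
def ExtendsPure (J : ModuleCat.{u} R) : Prop :=
  ∀ X : Cpx R, IsPureAcyclic X → ∀ i j k : ℤ, i + 1 = j → j + 1 = k →
    ∀ g : X.X j ⟶ J, X.d i j ≫ g = 0 → ∃ h : X.X k ⟶ J, X.d j k ≫ h = g

lemma ExtendsPure.isPureInjective {J : ModuleCat.{u} R} (h : ExtendsPure J) :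
    IsPureInjective J := by
  refine (isKPureInjective_iff _).2 fun X f hX => ?_
  obtain ⟨X, rfl⟩ := HomotopyCategory.quotient_obj_surjective X
  obtain ⟨f, rfl⟩ := (qK R).map_surjective f
  obtain ⟨g, hg⟩ := Cochain.toSingleMk_surjective (Cochain.ofHom f) 0 (add_zero 0)
  have hg' : X.d (-1) 0 ≫ g = 0 := by
    have := δ_ofHom (p := 1) f
    rw [← hg, Cochain.δ_toSingleMk _ _ 1 (-1) (by lia)] at this
    simpa using congrArg (Cochain.toSingleEquiv (show (-1 : ℤ) + 1 = 0 by lia)) this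
  obtain ⟨k, hk⟩ := h X hX (-1) 0 1 rfl rfl g hg'
  refine (quotient_map_eq_zero_iff_exists_δ f).2
    ⟨Cochain.toSingleMk k (show (1 : ℤ) + -1 = 0 by lia), ?_⟩
  rw [Cochain.δ_toSingleMk _ _ 0 0 (by lia), ← hg, hk]
  simp

lemma ExtendsPure.of_add_eq_id {J J₁ J₂ : ModuleCat.{u} R} (h₁ : ExtendsPure J₁)
    (h₂ : ExtendsPure J₂) (i₁ : J₁ ⟶ J) (i₂ : J₂ ⟶ J) (p₁ : J ⟶ J₁) (p₂ : J ⟶ J₂)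
    (h : p₁ ≫ i₁ + p₂ ≫ i₂ = 𝟙 J) : ExtendsPure J := by
  intro X hX i j k hi hk g hg
  obtain ⟨t₁, ht₁⟩ := h₁ X hX i j k hi hk (g ≫ p₁) (by rw [← Category.assoc, hg, zero_comp])
  obtain ⟨t₂, ht₂⟩ := h₂ X hX i j k hi hk (g ≫ p₂) (by rw [← Category.assoc, hg, zero_comp])
  refine ⟨t₁ ≫ i₁ + t₂ ≫ i₂, ?_⟩
  rw [Preadditive.comp_add, ← Category.assoc, ← Category.assoc, ht₁, ht₂, Category.assoc,
    Category.assoc, ← Preadditive.comp_add, h, Category.comp_id]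

lemma ExtendsPure.of_isLimit {ι : Type u} {J : ι → ModuleCat.{u} R} (hJ : ∀ i, ExtendsPure (J i))
    (c : Fan J) (hc : IsLimit c) : ExtendsPure c.pt := by
  intro X hX i j k hi hk g hg
  choose t ht using fun s => hJ s X hX i j k hi hk (g ≫ c.proj s)
    (by rw [← Category.assoc, hg, zero_comp])
  refine ⟨Fan.IsLimit.lift hc t, Fan.IsLimit.hom_ext hc _ _ fun s => ?_⟩
  rw [Category.assoc, Fan.IsLimit.fac hc, ht]

lemma IsPureAcyclic.exists_desc {X : Cpx R} (hX : IsPureAcyclic X) (N : ModuleCat.{u} R)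
    {i j k : ℤ} (hi : i + 1 = j) (hk : j + 1 = k) (g : N ⊗ X.X j ⟶ cogen R)
    (hg : N ◁ X.d i j ≫ g = 0) : ∃ h : N ⊗ X.X k ⟶ cogen R, N ◁ X.d j k ≫ h = g :=
  exists_desc_of_acyclic (hX N) hi hk g hg

/-- Degree m of A* is Hom(A^(-m), E), so the extension problem becomes one for A^(-m) ⊗ X → E,
solved by acyclicity of A^(-m) ⊗ X and injectivity of E. -/
lemma extendsPure_dualCpx (A : Cpx R) (m : ℤ) : ExtendsPure ((dualCpx A).X m) := by
  intro X hX i j k hi hk g hg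
  have hp : -m + m = 0 := by lia
  have hw {Y Y' : ModuleCat.{u} R} (f : Y ⟶ Y') (φ : Y' ⟶ (dualCpx A).X m) :
      dualEval (f ≫ φ) (-m) hp = f ▷ A.X (-m) ≫ dualEval φ (-m) hp := by
    rw [dualEval, comp_whiskerRight, Category.assoc, dualEval]
  obtain ⟨t, ht⟩ := hX.exists_desc (A.X (-m)) hi hk
    ((β_ (A.X (-m)) (X.X j)).hom ≫ dualEval g (-m) hp) (by
      rw [BraidedCategory.braiding_naturality_right_assoc, ← hw, hg, dualEval,
        MonoidalPreadditive.zero_whiskerRight, zero_comp, comp_zero])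
  obtain ⟨h, hh⟩ := dualEval_surjective (-m) hp ((β_ (X.X k) (A.X (-m))).hom ≫ t)
  refine ⟨h, dualEval_injective (-m) hp ?_⟩
  rw [hw, hh, BraidedCategory.braiding_naturality_left_assoc,
    ← cancel_epi (β_ (A.X (-m)) (X.X j)).hom]
  refine Eq.trans ?_ ht
  exact SymmetricCategory.symmetry_assoc _ _ _

end

/-! ### Coproducts, products and cones of the resolving complexes in K(R) -/

section

open HomologicalComplex CochainComplex.HomComplex Pretriangulated

/-- A degree of a coproduct of complexes is a coproduct. -/
def sigmaXIsColimit {ι : Type u} (Z : ι → Cpx R) (p : ℤ) :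
    IsColimit (Cofan.mk ((∐ Z).X p) (fun i => (Sigma.ι Z i).f p)) :=
  isColimitCofanMkObjOfIsColimit (eval (ModuleCat.{u} R) (ComplexShape.up ℤ) p) Z _
    (coproductIsCoproduct Z)

/-- A degree of a product of complexes is a product. -/
def piXIsLimit {ι : Type u} (Z : ι → Cpx R) (p : ℤ) :
    IsLimit (Fan.mk ((∏ᶜ Z).X p) (fun i => (Pi.π Z i).f p)) :=
  isLimitFanMkObjOfIsLimit (eval (ModuleCat.{u} R) (ComplexShape.up ℤ) p) Z _
    (productIsProduct Z)

lemma exists_qK_sigma_desc {ι : Type u} (Z : ι → Cpx R) {Y : K R}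
    (f : ∀ i, (qK R).obj (Z i) ⟶ Y) :
    ∃ g : (qK R).obj (∐ Z) ⟶ Y, ∀ i, (qK R).map (Sigma.ι Z i) ≫ g = f i := by
  obtain ⟨Y, rfl⟩ := HomotopyCategory.quotient_obj_surjective Y
  choose f' hf' using fun i => (qK R).map_surjective (f i)
  refine ⟨(qK R).map (Sigma.desc f'), fun i => ?_⟩
  rw [← Functor.map_comp, Sigma.ι_desc, hf']

lemma exists_qK_pi_lift {ι : Type u} (Z : ι → Cpx R) {Y : K R}
    (f : ∀ i, Y ⟶ (qK R).obj (Z i)) :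
    ∃ g : Y ⟶ (qK R).obj (∏ᶜ Z), ∀ i, g ≫ (qK R).map (Pi.π Z i) = f i := by
  obtain ⟨Y, rfl⟩ := HomotopyCategory.quotient_obj_surjective Y
  choose f' hf' using fun i => (qK R).map_surjective (f i)
  refine ⟨(qK R).map (Pi.lift f'), fun i => ?_⟩
  rw [← Functor.map_comp, Pi.lift_π, hf']

lemma sigma_cochain_ext {ι : Type u} {Z : ι → Cpx R} {Y : Cpx R} {n : ℤ}
    {z w : Cochain (∐ Z) Y n}
    (h : ∀ i, (Cochain.ofHom (Sigma.ι Z i)).comp z (zero_add n) =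
      (Cochain.ofHom (Sigma.ι Z i)).comp w (zero_add n)) : z = w := by
  refine Cochain.ext _ _ fun p q hpq =>
    Cofan.IsColimit.hom_ext (sigmaXIsColimit Z p) _ _ fun i => ?_
  simpa using congrArg (fun t => Cochain.v t p q hpq) (h i)

lemma pi_cochain_ext {ι : Type u} {Z : ι → Cpx R} {Y : Cpx R} {n : ℤ}
    {z w : Cochain Y (∏ᶜ Z) n}
    (h : ∀ i, z.comp (Cochain.ofHom (Pi.π Z i)) (add_zero n) =
      w.comp (Cochain.ofHom (Pi.π Z i)) (add_zero n)) : z = w := by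
  refine Cochain.ext _ _ fun p q hpq => Fan.IsLimit.hom_ext (piXIsLimit Z q) _ _ fun i => ?_
  simpa using congrArg (fun t => Cochain.v t p q hpq) (h i)

/-- Chosen null-homotopies on the summands glue degreewise, so coproducts of complexes remain
coproducts in K(R). -/
lemma qK_sigma_eq_zero {ι : Type u} {Z : ι → Cpx R} {Y : K R} {f : (qK R).obj (∐ Z) ⟶ Y}
    (hf : ∀ i, (qK R).map (Sigma.ι Z i) ≫ f = 0) : f = 0 := by
  obtain ⟨Y, rfl⟩ := HomotopyCategory.quotient_obj_surjective Y
  obtain ⟨f, rfl⟩ := (qK R).map_surjective f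
  simp only [← Functor.map_comp, quotient_map_eq_zero_iff_exists_δ] at hf
  choose z hz using hf
  let w : Cochain (∐ Z) Y (-1) := Cochain.mk fun p q hpq =>
    Cofan.IsColimit.desc (sigmaXIsColimit Z p) fun i => (z i).v p q hpq
  have hw (i : ι) : (Cochain.ofHom (Sigma.ι Z i)).comp w (zero_add _) = z i := by
    refine Cochain.ext _ _ fun p q hpq => ?_
    rw [Cochain.zero_cochain_comp_v, Cochain.ofHom_v]
    exact Cofan.IsColimit.fac (sigmaXIsColimit Z p) _ i
  refine (quotient_map_eq_zero_iff_exists_δ f).2 ⟨w, sigma_cochain_ext fun i => ?_⟩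
  rw [← δ_ofHom_comp, hw, hz, Cochain.ofHom_comp]

lemma qK_pi_eq_zero {ι : Type u} {Z : ι → Cpx R} {Y : K R} {f : Y ⟶ (qK R).obj (∏ᶜ Z)}
    (hf : ∀ i, f ≫ (qK R).map (Pi.π Z i) = 0) : f = 0 := by
  obtain ⟨Y, rfl⟩ := HomotopyCategory.quotient_obj_surjective Y
  obtain ⟨f, rfl⟩ := (qK R).map_surjective f
  simp only [← Functor.map_comp, quotient_map_eq_zero_iff_exists_δ] at hf
  choose z hz using hf
  let w : Cochain Y (∏ᶜ Z) (-1) := Cochain.mk fun p q hpq =>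
    Fan.IsLimit.lift (piXIsLimit Z q) fun i => (z i).v p q hpq
  have hw (i : ι) : w.comp (Cochain.ofHom (Pi.π Z i)) (add_zero _) = z i := by
    refine Cochain.ext _ _ fun p q hpq => ?_
    rw [Cochain.comp_zero_cochain_v, Cochain.ofHom_v]
    exact Fan.IsLimit.fac (piXIsLimit Z q) _ i
  refine (quotient_map_eq_zero_iff_exists_δ f).2 ⟨w, pi_cochain_ext fun i => ?_⟩
  rw [← δ_comp_ofHom, hw, hz, Cochain.ofHom_comp]

/-- The complexes of pure projective modules which are left orthogonal to pure acyclic complexes,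
in the homotopy category. -/
def Kproj (R : Type u) [CommRing R] : ObjectProperty (K R) := fun X =>
  ∃ P : Cpx R, Nonempty (X ≅ (qK R).obj P) ∧ (∀ i, LiftsPure (P.X i)) ∧
    (Kpac R).leftOrthogonal ((qK R).obj P)

/-- The complexes of pure injective modules which are right orthogonal to pure acyclic complexes,
in the homotopy category. -/
def Kinj (R : Type u) [CommRing R] : ObjectProperty (K R) := fun X =>
  ∃ I : Cpx R, Nonempty (X ≅ (qK R).obj I) ∧ (∀ i, ExtendsPure (I.X i)) ∧
    (Kpac R).rightOrthogonal ((qK R).obj I)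

lemma Kinj.of_iso {X Y : K R} (e : X ≅ Y) (h : Kinj R X) : Kinj R Y := by
  obtain ⟨P, ⟨f⟩, h⟩ := h
  exact ⟨P, ⟨e.symm ≪≫ f⟩, h⟩

lemma Kproj.single {P : ModuleCat.{u} R} (h : LiftsPure P) (m : ℤ) :
    Kproj R ((qK R).obj ((CochainComplex.singleFunctor (ModuleCat.{u} R) m).obj P)) := by
  refine ⟨_, ⟨Iso.refl _⟩, fun i => ?_, h.leftOrthogonal_single m⟩
  by_cases hi : i = m
  · subst hi
    exact h.of_iso (singleXIso i P).symm
  · exact .of_isZero (isZero_single_obj_X (ComplexShape.up ℤ) m P i hi)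

lemma Kinj.dualCpx (A : Cpx R) : Kinj R ((qK R).obj (dualCpx A)) :=
  ⟨_, ⟨Iso.refl _⟩, extendsPure_dualCpx A,
    rightOrthogonal_homCpx A (rightOrthogonal_cogenCpx R)⟩

lemma Kinj.shift {X : K R} (h : Kinj R X) (n : ℤ) : Kinj R (X⟦n⟧) := by
  obtain ⟨P, ⟨f⟩, h, h'⟩ := h
  refine ⟨P⟦n⟧, ⟨(shiftFunctor (K R) n).mapIso f ≪≫ ((qK R).commShiftIso n).symm.app P⟩,
    fun i => h (i + n), ?_⟩
  exact ObjectProperty.prop_of_iso _ (((qK R).commShiftIso n).symm.app P)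
    (ObjectProperty.le_shift _ n _ h')

lemma exists_distTriang_iso {T : Triangle (K R)} (hT : T ∈ distTriang _) {A B : Cpx R}
    (a : T.obj₁ ≅ (qK R).obj A) (b : T.obj₂ ≅ (qK R).obj B) :
    ∃ f : A ⟶ B, Nonempty (T.obj₃ ≅ (qK R).obj (CochainComplex.mappingCone f)) := by
  obtain ⟨f, hf⟩ := (qK R).map_surjective (a.inv ≫ T.mor₁ ≫ b.hom)
  refine ⟨f, ⟨Triangle.π₃.mapIso (isoTriangleOfIso₁₂ T _ hT
    (HomotopyCategory.mappingCone_triangleh_distinguished f) a b ?_)⟩⟩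
  change T.mor₁ ≫ b.hom = a.hom ≫ (qK R).map f
  rw [hf, a.hom_inv_id_assoc]

lemma Kproj.distTriang₃ {T : Triangle (K R)} (hT : T ∈ distTriang _) (h₁ : Kproj R T.obj₁)
    (h₂ : Kproj R T.obj₂) : Kproj R T.obj₃ := by
  obtain ⟨A, ⟨a⟩, hA, hA'⟩ := h₁
  obtain ⟨B, ⟨b⟩, hB, hB'⟩ := h₂
  obtain ⟨f, ⟨e⟩⟩ := exists_distTriang_iso hT a b
  refine ⟨_, ⟨e⟩, fun i => (hA (i + 1)).of_add_eq_id (hB i) _ _ _ _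
    (CochainComplex.mappingCone.id_X f i (i + 1) rfl), ?_⟩
  exact ObjectProperty.prop_of_iso _ e (ObjectProperty.ext_of_isTriangulatedClosed₃ _ T hT
    (ObjectProperty.prop_of_iso _ a.symm hA') (ObjectProperty.prop_of_iso _ b.symm hB'))

lemma Kinj.distTriang₃ {T : Triangle (K R)} (hT : T ∈ distTriang _) (h₁ : Kinj R T.obj₁)
    (h₂ : Kinj R T.obj₂) : Kinj R T.obj₃ := by
  obtain ⟨A, ⟨a⟩, hA, hA'⟩ := h₁
  obtain ⟨B, ⟨b⟩, hB, hB'⟩ := h₂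
  obtain ⟨f, ⟨e⟩⟩ := exists_distTriang_iso hT a b
  refine ⟨_, ⟨e⟩, fun i => (hA (i + 1)).of_add_eq_id (hB i) _ _ _ _
    (CochainComplex.mappingCone.id_X f i (i + 1) rfl), ?_⟩
  exact ObjectProperty.prop_of_iso _ e (ObjectProperty.ext_of_isTriangulatedClosed₃ _ T hT
    (ObjectProperty.prop_of_iso _ a.symm hA') (ObjectProperty.prop_of_iso _ b.symm hB'))

lemma Kinj.distTriang₁ {T : Triangle (K R)} (hT : T ∈ distTriang _) (h₂ : Kinj R T.obj₂)
    (h₃ : Kinj R T.obj₃) : Kinj R T.obj₁ :=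
  ((Kinj.distTriang₃ (rot_of_distTriang _ hT) h₂ h₃).shift (-1)).of_iso
    ((shiftEquiv (K R) (1 : ℤ)).unitIso.symm.app T.obj₁)

/-- The test objects of the homotopy category: the finitely presented modules, placed in any
degree. -/
def IsTest (T : K R) : Prop :=
  ∃ (k n : ℕ) (a : Fin k → Fin n → R) (m : ℤ),
    Nonempty (T ≅ (qK R).obj ((CochainComplex.singleFunctor (ModuleCat.{u} R) m).obj (fpMod a)))

lemma IsTest.single {k n : ℕ} (a : Fin k → Fin n → R) (m : ℤ) :
    IsTest ((qK R).obj ((CochainComplex.singleFunctor (ModuleCat.{u} R) m).obj (fpMod a))) :=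
  ⟨k, n, a, m, ⟨Iso.refl _⟩⟩

lemma IsTest.shift {T : K R} (h : IsTest T) (j : ℤ) : IsTest (T⟦j⟧) := by
  obtain ⟨k, n, a, m, ⟨e⟩⟩ := h
  refine ⟨k, n, a, m - j, ⟨(shiftFunctor (K R) j).mapIso e ≪≫
    ((qK R).commShiftIso j).symm.app _ ≪≫ (qK R).mapIso
      (((CochainComplex.singleFunctors (ModuleCat.{u} R)).shiftIso j (m - j) m
        (by lia)).app (fpMod a))⟩⟩

lemma Kpac_iff_forall_isTest (X : K R) :
    Kpac R X ↔ ∀ T, IsTest T → ∀ f : T ⟶ X, f = 0 := by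
  obtain ⟨X, rfl⟩ := HomotopyCategory.quotient_obj_surjective X
  refine (isPureAcyclic_iff_forall_single X).trans ⟨fun h T hT => ?_, fun h k n a m f =>
    h _ (.single a m) f⟩
  obtain ⟨k, n, a, m, ⟨e⟩⟩ := hT
  exact forall_hom_eq_zero_of_iso e.symm (h a m)

end

/-! ### Pure projective resolutions: cell attachment and a homotopy colimit -/

section

open HomologicalComplex CochainComplex.HomComplex Pretriangulated

/-- The elements of finite support form a submodule containing the image of every summand, so the
quotient by it is zero. Allowing every t ⊇ s makes closure under addition immediate. -/
lemma exists_finset_sum_sigma {ι : Type u} [DecidableEq ι] (Z : ι → Cpx R) (m : ℤ) (x : (∐ Z).X m) :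
    ∃ s : Finset ι, ∀ t, s ⊆ t →
      ∑ i ∈ t, (Sigma.ι Z i).f m ((Sigma.π Z i).f m x) = x := by
  let S : Submodule R ((∐ Z).X m) :=
    { carrier := {x | ∃ s : Finset ι, ∀ t, s ⊆ t →
        ∑ i ∈ t, (Sigma.ι Z i).f m ((Sigma.π Z i).f m x) = x}
      zero_mem' := ⟨∅, fun t _ => by simp⟩
      add_mem' := by
        rintro x y ⟨s, hs⟩ ⟨s', hs'⟩
        refine ⟨s ∪ s', fun t ht => ?_⟩
        simp only [map_add, Finset.sum_add_distrib, hs t (Finset.union_subset_left ht),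
          hs' t (Finset.union_subset_right ht)]
      smul_mem' := by
        rintro r x ⟨s, hs⟩
        refine ⟨s, fun t ht => ?_⟩
        simp only [map_smul, ← Finset.smul_sum, hs t ht] }
  have hS : ModuleCat.ofHom S.mkQ = 0 := by
    refine Cofan.IsColimit.hom_ext (sigmaXIsColimit Z m) _ _ fun i => ?_
    ext y
    refine (Submodule.Quotient.mk_eq_zero S).2 ⟨{i}, fun t ht => ?_⟩
    have hi : i ∈ t := ht (Finset.mem_singleton_self i)
    rw [Finset.sum_eq_single_of_mem i hi]
    · have := congr(Hom.f $(Sigma.ι_π_eq_id Z i) m y)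
      exact congrArg ((Sigma.ι Z i).f m) this
    · intro j _ hj
      have := congr(Hom.f $(Sigma.ι_π_of_ne Z hj.symm) m y)
      exact (congrArg ((Sigma.ι Z j).f m) this).trans (map_zero _)
  exact (Submodule.Quotient.mk_eq_zero S).1 congr($hS x)

lemma exists_finset_sum_comp_sigma {ι : Type u} [DecidableEq ι] (Z : ι → Cpx R) (m : ℤ)
    {N : ModuleCat.{u} R}
    [Module.Finite R N] (φ : N ⟶ (∐ Z).X m) :
    ∃ s : Finset ι, φ = ∑ i ∈ s, φ ≫ (Sigma.π Z i).f m ≫ (Sigma.ι Z i).f m := by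
  obtain ⟨n, v, hv⟩ := Module.Finite.exists_fin (R := R) (M := N)
  choose s hs using fun j => exists_finset_sum_sigma Z m (φ (v j))
  refine ⟨Finset.univ.biUnion s, ?_⟩
  ext1
  refine LinearMap.ext_on_range hv fun j => ?_
  rw [ModuleCat.hom_sum, LinearMap.sum_apply]
  exact (hs j _ (Finset.subset_biUnion_of_mem s (Finset.mem_univ j))).symm

/-- Compactness of the test objects: a morphism from a finitely generated module in one degree meets
only finitely many summands. -/
lemma exists_finset_sum_test {ι : Type u} (Z : ι → Cpx R) {T : K R} (hT : IsTest T)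
    (w : T ⟶ (qK R).obj (∐ Z)) :
    ∃ (s : Finset ι) (f : ∀ i, T ⟶ (qK R).obj (Z i)),
      w = ∑ i ∈ s, f i ≫ (qK R).map (Sigma.ι Z i) := by
  classical
  obtain ⟨k, n, a, m, ⟨e⟩⟩ := hT
  obtain ⟨v, hv⟩ := (qK R).map_surjective (e.inv ≫ w)
  have : Module.Finite R
      (((CochainComplex.singleFunctor (ModuleCat.{u} R) m).obj (fpMod a)).X m) :=
    Module.Finite.equiv (singleXIso m (fpMod a)).symm.toLinearEquiv
  obtain ⟨s, hs⟩ := exists_finset_sum_comp_sigma Z m (v.f m)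
  have hs' : v = ∑ i ∈ s, v ≫ Sigma.π Z i ≫ Sigma.ι Z i := by
    apply from_single_hom_ext
    exact hs.trans ((HomologicalComplex.eval (ModuleCat.{u} R) (ComplexShape.up ℤ) m).map_sum
      (fun i => v ≫ Sigma.π Z i ≫ Sigma.ι Z i) s).symm
  refine ⟨s, fun i => e.hom ≫ (qK R).map (v ≫ Sigma.π Z i), ?_⟩
  rw [← cancel_epi e.inv, ← hv, Preadditive.comp_sum]
  simp only [Category.assoc, e.inv_hom_id_assoc, ← Functor.map_comp]
  rw [← Functor.map_sum, ← hs']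

lemma Kproj.exists_coproduct {ι : Type u} (X : ι → K R) (h : ∀ i, Kproj R (X i)) :
    ∃ (S : K R) (c : ∀ i, X i ⟶ S), Kproj R S ∧
      (∀ (Y : K R) (f : ∀ i, X i ⟶ Y), ∃ g : S ⟶ Y, ∀ i, c i ≫ g = f i) ∧
      (∀ (Y : K R) (f : S ⟶ Y), (∀ i, c i ≫ f = 0) → f = 0) ∧
      ∀ (T : K R), IsTest T → ∀ w : T ⟶ S,
        ∃ (s : Finset ι) (f : ∀ i, T ⟶ X i), w = ∑ i ∈ s, f i ≫ c i := by
  choose P e hP hP' using h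
  replace e i := (e i).some
  have ext (Y : K R) (f : (qK R).obj (∐ P) ⟶ Y)
      (hf : ∀ i, ((e i).hom ≫ (qK R).map (Sigma.ι P i)) ≫ f = 0) : f = 0 :=
    qK_sigma_eq_zero fun i => by
      rw [← cancel_epi (e i).hom, ← Category.assoc, hf, comp_zero]
  refine ⟨(qK R).obj (∐ P), fun i => (e i).hom ≫ (qK R).map (Sigma.ι P i),
    ⟨_, ⟨Iso.refl _⟩, fun n => ?_, fun Y f hY => ?_⟩, fun Y f => ?_, ext, fun T hT w => ?_⟩
  · exact LiftsPure.of_isColimit (fun i => hP i n) _ (sigmaXIsColimit P n)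
  · exact qK_sigma_eq_zero fun i => hP' i _ hY
  · obtain ⟨g, hg⟩ := exists_qK_sigma_desc P fun i => (e i).inv ≫ f i
    exact ⟨g, fun i => by rw [Category.assoc, hg, (e i).hom_inv_id_assoc]⟩
  · obtain ⟨s, f, hf⟩ := exists_finset_sum_test P hT w
    exact ⟨s, fun i => f i ≫ (e i).inv, by simpa using hf⟩

lemma exists_Kproj_test_surjective (M : K R) :
    ∃ (P : K R) (v : P ⟶ M), Kproj R P ∧ ∀ T, IsTest T → ∀ x : T ⟶ M, ∃ y : T ⟶ P, y ≫ v = x := by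
  -- Indexing by matrices rather than by modules keeps the index set in `Type u`.
  let ι := Σ (k n : ℕ) (a : Fin k → Fin n → R) (m : ℤ),
    ((qK R).obj ((CochainComplex.singleFunctor (ModuleCat.{u} R) m).obj (fpMod a)) ⟶ M)
  obtain ⟨S, c, hS, hdesc, -, -⟩ := Kproj.exists_coproduct (fun i : ι => (qK R).obj
    ((CochainComplex.singleFunctor (ModuleCat.{u} R) i.2.2.2.1).obj (fpMod i.2.2.1)))
    (fun i => .single (liftsPure_of_finitePresentation _) _)
  obtain ⟨v, hv⟩ := hdesc M fun i => i.2.2.2.2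
  refine ⟨S, v, hS, ?_⟩
  rintro T ⟨k, n, a, m, ⟨e⟩⟩ x
  refine ⟨e.hom ≫ c ⟨k, n, a, m, e.inv ≫ x⟩, ?_⟩
  rw [Category.assoc, hv, e.hom_inv_id_assoc]

/-- P' is the cone of the sum of all test morphisms to P killed by v. -/
lemma exists_Kproj_kill {M P : K R} (v : P ⟶ M) (hP : Kproj R P) :
    ∃ (P' : K R) (s : P ⟶ P') (v' : P' ⟶ M), Kproj R P' ∧ s ≫ v' = v ∧
      ∀ T, IsTest T → ∀ y : T ⟶ P, y ≫ v = 0 → y ≫ s = 0 := by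
  let ι := Σ (k n : ℕ) (a : Fin k → Fin n → R) (m : ℤ),
    { y : (qK R).obj ((CochainComplex.singleFunctor (ModuleCat.{u} R) m).obj (fpMod a)) ⟶ P //
      y ≫ v = 0 }
  obtain ⟨S, c, hS, hdesc, hext, -⟩ := Kproj.exists_coproduct (fun i : ι => (qK R).obj
    ((CochainComplex.singleFunctor (ModuleCat.{u} R) i.2.2.2.1).obj (fpMod i.2.2.1)))
    (fun i => .single (liftsPure_of_finitePresentation _) _)
  obtain ⟨g, hg⟩ := hdesc P fun i => i.2.2.2.2.1
  have hgv : g ≫ v = 0 := hext _ _ fun i => by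
    rw [← Category.assoc, hg]
    exact i.2.2.2.2.2
  obtain ⟨P', s, t, hT⟩ := distinguished_cocone_triangle g
  obtain ⟨v', hv'⟩ : ∃ v' : P' ⟶ M, v = s ≫ v' := Triangle.yoneda_exact₂ _ hT v hgv
  refine ⟨P', s, v', Kproj.distTriang₃ hT hS hP, hv'.symm, ?_⟩
  rintro T ⟨k, n, a, m, ⟨e⟩⟩ y hy
  have h := hg ⟨k, n, a, m, e.inv ≫ y, by rw [Category.assoc, hy, comp_zero]⟩
  have hgs : g ≫ s = 0 := comp_distTriang_mor_zero₁₂ _ hT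
  dsimp only at h
  rw [← cancel_epi e.inv, ← Category.assoc, ← h, Category.assoc, hgs, comp_zero, comp_zero]

lemma shift_hom_eq_zero_of_isTest {S S' : K R} (D : S ⟶ S')
    (h : ∀ T, IsTest T → ∀ w : T ⟶ S, w ≫ D = 0 → w = 0) {T : K R} (hT : IsTest T)
    (w : T ⟶ S⟦(1 : ℤ)⟧) (hw : w ≫ D⟦(1 : ℤ)⟧' = 0) : w = 0 := by
  let e : T⟦(-1 : ℤ)⟧⟦(1 : ℤ)⟧ ≅ T := (shiftEquiv (K R) (1 : ℤ)).counitIso.app T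
  obtain ⟨t, ht⟩ := (shiftFunctor (K R) (1 : ℤ)).map_surjective (e.hom ≫ w)
  have : t = 0 := h _ (hT.shift _) t ((shiftFunctor (K R) (1 : ℤ)).map_injective (by
    rw [Functor.map_comp, ht, Category.assoc, hw, comp_zero, Functor.map_zero]))
  rw [← cancel_epi e.hom, ← ht, this, Functor.map_zero, comp_zero]

/-- Every object of the homotopy category is approximated by a complex of pure projective modules,
which is obtained as a homotopy colimit. -/
lemma exists_Kproj_test_bijective (M : K R) :
    ∃ (P : K R) (v : P ⟶ M), Kproj R P ∧
      ∀ T, IsTest T → Function.Bijective (fun y : T ⟶ P => y ≫ v) := by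
  obtain ⟨P₀, u₀, hP₀, hu₀⟩ := exists_Kproj_test_surjective M
  choose F s' u' hF hs' hkill using
    fun (p : { p : Σ P : K R, (P ⟶ M) // Kproj R p.1 }) => exists_Kproj_kill p.1.2 p.2
  let stage (k : ℕ) : { p : Σ P : K R, (P ⟶ M) // Kproj R p.1 } :=
    Nat.rec ⟨⟨P₀, u₀⟩, hP₀⟩ (fun _ p => ⟨⟨F p, u' p⟩, hF p⟩) k
  let X (k : ℕ) : K R := (stage k).1.1
  let u (k : ℕ) : X k ⟶ M := (stage k).1.2
  let s (k : ℕ) : X k ⟶ X (k + 1) := s' (stage k)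
  have hsu (k : ℕ) : s k ≫ u (k + 1) = u k := hs' (stage k)
  have hsk (k : ℕ) (T : K R) (hT : IsTest T) (y : T ⟶ X k) (hy : y ≫ u k = 0) : y ≫ s k = 0 :=
    hkill (stage k) T hT y hy
  obtain ⟨S, c', hS, hdesc, hext, hfin⟩ :=
    Kproj.exists_coproduct (fun k : ULift.{u} ℕ => X k.down) (fun k => (stage k.down).2)
  let c (k : ℕ) : X k ⟶ S := c' ⟨k⟩
  have hdesc (Y : K R) (f : ∀ k, X k ⟶ Y) : ∃ g : S ⟶ Y, ∀ k, c k ≫ g = f k := by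
    obtain ⟨g, hg⟩ := hdesc Y fun k => f k.down
    exact ⟨g, fun k => hg ⟨k⟩⟩
  have hext {Y : K R} {f g : S ⟶ Y} (hf : ∀ k, c k ≫ f = c k ≫ g) : f = g := by
    rw [← sub_eq_zero]
    exact hext _ _ fun k => by rw [Preadditive.comp_sub, sub_eq_zero]; exact hf k.down
  have hfin (T : K R) (hT : IsTest T) (w : T ⟶ S) :
      ∃ (t : Finset ℕ) (f : ∀ k, T ⟶ X k), w = ∑ k ∈ t, f k ≫ c k := by
    obtain ⟨t, f, rfl⟩ := hfin T hT w
    refine ⟨t.map ⟨ULift.down, ULift.down_injective⟩, fun k => f ⟨k⟩, ?_⟩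
    rw [Finset.sum_map]
    rfl
  -- The map "identity minus shift", whose cone is the homotopy colimit.
  obtain ⟨D, hD⟩ := hdesc S fun k => c k - s k ≫ c (k + 1)
  obtain ⟨v₀, hv₀⟩ := hdesc M u
  choose q hq using fun k => hdesc (X k) fun j =>
    if h : j = k then eqToHom (congrArg X h) else 0
  have hqq (k : ℕ) : c k ≫ q k = 𝟙 _ := by rw [hq, dif_pos rfl, eqToHom_refl]
  have hq0 {j k : ℕ} (h : j ≠ k) : c j ≫ q k = 0 := by rw [hq, dif_neg h]
  -- If w ≫ D = 0, the components of w along the projections q vanish by induction; compactness then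
  -- gives w = 0.
  have hDinj (T : K R) (hT : IsTest T) (w : T ⟶ S) (hw : w ≫ D = 0) : w = 0 := by
    have hD0 : D ≫ q 0 = q 0 := hext fun k => by
      rw [← Category.assoc, hD, Preadditive.sub_comp, Category.assoc, hq0 (Nat.succ_ne_zero k),
        comp_zero, sub_zero]
    have hDs (k : ℕ) : D ≫ q (k + 1) = q (k + 1) - q k ≫ s k := hext fun j => by
      rw [← Category.assoc, hD, Preadditive.sub_comp, Preadditive.comp_sub, Category.assoc]
      by_cases h : j = k
      · subst h
        rw [hqq, ← Category.assoc, hqq, Category.comp_id, Category.id_comp]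
      · rw [hq0 (j := j + 1) (k := k + 1) (by lia), ← Category.assoc (c j), hq0 h, comp_zero,
          zero_comp]
    have hwq (k : ℕ) : w ≫ q k = 0 := by
      induction k with
      | zero => rw [← hD0, ← Category.assoc, hw, zero_comp]
      | succ k ih =>
        have := congrArg (w ≫ ·) (hDs k)
        simp only [Preadditive.comp_sub] at this
        rw [← Category.assoc, hw, zero_comp, ← Category.assoc w (q k), ih, zero_comp,
          sub_zero] at this
        exact this.symm
    obtain ⟨t, f, rfl⟩ := hfin T hT w
    refine Finset.sum_eq_zero fun j hj => ?_
    have := hwq j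
    rw [Preadditive.sum_comp, Finset.sum_eq_single_of_mem j hj, Category.assoc, hqq,
      Category.comp_id] at this
    · rw [this, zero_comp]
    · intro k _ hk
      rw [Category.assoc, hq0 hk, comp_zero]
  obtain ⟨P, π, δ, hP⟩ := distinguished_cocone_triangle D
  have hDπ : D ≫ π = 0 := comp_distTriang_mor_zero₁₂ _ hP
  have hδD : δ ≫ D⟦(1 : ℤ)⟧' = 0 := comp_distTriang_mor_zero₃₁ _ hP
  have hDv : D ≫ v₀ = 0 := hext fun k => by
    rw [← Category.assoc, hD, Preadditive.sub_comp, Category.assoc, hv₀, hv₀, hsu, sub_self,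
      comp_zero]
  have hcs (k : ℕ) : c k ≫ π = s k ≫ c (k + 1) ≫ π := by
    have := congrArg (c k ≫ ·) hDπ
    rwa [← Category.assoc, hD, Preadditive.sub_comp, comp_zero, sub_eq_zero,
      Category.assoc] at this
  obtain ⟨v, hv⟩ : ∃ v : P ⟶ M, v₀ = π ≫ v := Triangle.yoneda_exact₂ _ hP v₀ hDv
  have hcv (k : ℕ) : c k ≫ π ≫ v = u k := by rw [← hv, hv₀]
  refine ⟨P, v, Kproj.distTriang₃ hP hS hS, fun T hT => ⟨fun x x' hx => ?_, fun x => ?_⟩⟩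
  · suffices h : ∀ x : T ⟶ P, x ≫ v = 0 → x = 0 from
      sub_eq_zero.1 (h _ (by rw [Preadditive.sub_comp, sub_eq_zero]; exact hx))
    intro x hx
    have hxδ : x ≫ δ = 0 := shift_hom_eq_zero_of_isTest D hDinj hT _ (by
      rw [Category.assoc, hδD, comp_zero])
    obtain ⟨y, hy⟩ : ∃ y : T ⟶ S, x = y ≫ π := Triangle.coyoneda_exact₃ _ hP x hxδ
    obtain ⟨t, f, hf⟩ := hfin T hT y
    -- In the homotopy colimit a component can be pushed to any later stage, so the finite sum y
    -- comes from one stage N, and dies at stage N + 1.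
    have hmove (a : ℕ) (g : T ⟶ X a) (n : ℕ) (hn : a ≤ n) :
        ∃ y' : T ⟶ X n, g ≫ c a ≫ π = y' ≫ c n ≫ π := by
      induction n, hn using Nat.le_induction with
      | base => exact ⟨g, rfl⟩
      | succ n _ ih =>
        obtain ⟨y', hy'⟩ := ih
        exact ⟨y' ≫ s n, by rw [hy', hcs, Category.assoc]⟩
    have key (t : Finset ℕ) :
        ∃ N, ∀ n, N ≤ n → ∃ y' : T ⟶ X n, (∑ k ∈ t, f k ≫ c k) ≫ π = y' ≫ c n ≫ π := by
      induction t using Finset.induction_on with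
      | empty => exact ⟨0, fun n _ => ⟨0, by simp⟩⟩
      | insert a t ha ih =>
        obtain ⟨N, hN⟩ := ih
        refine ⟨max a N, fun n hn => ?_⟩
        obtain ⟨y₁, h₁⟩ := hN n (le_of_max_le_right hn)
        obtain ⟨y₂, h₂⟩ := hmove a (f a) n (le_of_max_le_left hn)
        refine ⟨y₂ + y₁, ?_⟩
        rw [Finset.sum_insert ha, Preadditive.add_comp, h₁, Category.assoc, h₂,
          Preadditive.add_comp]
    obtain ⟨N, hN⟩ := key t
    obtain ⟨y', hy'⟩ := hN N le_rfl
    rw [← hf, ← hy] at hy'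
    have h0 : y' ≫ u N = 0 := by rw [← hcv, ← Category.assoc, ← Category.assoc, Category.assoc y',
      ← hy', hx]
    rw [hy', hcs, ← Category.assoc, hsk N T hT y' h0, zero_comp]
  · obtain ⟨y, rfl⟩ := hu₀ T hT x
    exact ⟨y ≫ c 0 ≫ π, by simp only [Category.assoc, hcv]; rfl⟩

/-- The long exact sequence of Hom(A, -): injectivity is needed for A[-1] as well, which is again a
test object. -/
lemma Kpac_of_test_bijective {T : Triangle (K R)} (hT : T ∈ distTriang _)
    (h : ∀ A, IsTest A → Function.Bijective (fun y : A ⟶ T.obj₁ => y ≫ T.mor₁)) :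
    Kpac R T.obj₃ := by
  refine (Kpac_iff_forall_isTest _).2 fun A hA f => ?_
  have hf : f ≫ T.mor₃ = 0 := shift_hom_eq_zero_of_isTest T.mor₁
    (fun B hB w hw => (h B hB).1 (by simpa using hw)) hA _ (by
      rw [Category.assoc, comp_distTriang_mor_zero₃₁ _ hT, comp_zero])
  obtain ⟨g, rfl⟩ := Triangle.coyoneda_exact₃ _ hT f hf
  obtain ⟨y, rfl⟩ := (h A hA).2 g
  dsimp only
  rw [Category.assoc, comp_distTriang_mor_zero₁₂ _ hT, comp_zero]

lemma isPureQuasiIso_of_test_bijective {X Y : Cpx R} (f : X ⟶ Y)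
    (h : ∀ A, IsTest A → Function.Bijective (fun y : A ⟶ (qK R).obj X => y ≫ (qK R).map f)) :
    IsPureQuasiIso f := by
  have := Kpac_of_test_bijective (HomotopyCategory.mappingCone_triangleh_distinguished f) h
  exact (Kpac_qK_iff (CochainComplex.mappingCone f)).1 this

theorem nonempty_pureProjectiveResolution (M : Cpx R) : Nonempty (PureProjectiveResolution M) := by
  obtain ⟨X, v, ⟨P, ⟨e⟩, hP, hP'⟩, hv⟩ := exists_Kproj_test_bijective ((qK R).obj M)
  obtain ⟨f, hf⟩ := (qK R).map_surjective (e.inv ≫ v)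
  refine ⟨P, f, fun i => (hP i).isPureProjective, isPureQuasiIso_of_test_bijective f ?_,
    (isKPureProjective_iff P).2 hP'⟩
  intro A hA
  rw [hf]
  have := (hv A hA).comp (e.symm.homToEquiv (Z := A)).bijective
  convert this using 1
  ext y
  simp

end

/-! ### Pure injective resolutions: cotest objects, ghosts and a homotopy limit -/

section

open HomologicalComplex CochainComplex.HomComplex Pretriangulated

lemma Kinj.exists_product {ι : Type u} (X : ι → K R) (h : ∀ i, Kinj R (X i)) :
    ∃ (S : K R) (p : ∀ i, S ⟶ X i), Kinj R S ∧
      (∀ (Y : K R) (f : ∀ i, Y ⟶ X i), ∃ g : Y ⟶ S, ∀ i, g ≫ p i = f i) ∧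
      (∀ (Y : K R) (f : Y ⟶ S), (∀ i, f ≫ p i = 0) → f = 0) := by
  choose P e hP hP' using h
  replace e i := (e i).some
  refine ⟨(qK R).obj (∏ᶜ P), fun i => (qK R).map (Pi.π P i) ≫ (e i).inv,
    ⟨_, ⟨Iso.refl _⟩, fun n => ?_, fun Y f hY => ?_⟩, fun Y f => ?_, fun Y f hf => ?_⟩
  · exact ExtendsPure.of_isLimit (fun i => hP i n) _ (piXIsLimit P n)
  · exact qK_pi_eq_zero fun i => hP' i _ hY
  · obtain ⟨g, hg⟩ := exists_qK_pi_lift P fun i => f i ≫ (e i).hom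
    exact ⟨g, fun i => by rw [← Category.assoc, hg, Category.assoc, (e i).hom_inv_id,
      Category.comp_id]⟩
  · exact qK_pi_eq_zero fun i => by rw [← cancel_mono (e i).inv, Category.assoc, hf, zero_comp]

variable (R) in
/-- The index set of the cotest objects: a presentation matrix, the degree of the module, and a
shift. -/
structure CotestIndex where
  /-- the number of relations -/
  rel : ℕ
  /-- the number of generators -/
  gen : ℕ
  /-- the presentation matrix -/
  mat : Fin rel → Fin gen → R
  /-- the degree of the finitely presented module -/
  deg : ℤ
  /-- the shift of the character complex -/
  sh : ℤ

/-- The objects of the homotopy category which are used to build pure injective resolutions: the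
shifted character complexes of finitely presented modules. -/
def cotest (i : CotestIndex R) : K R :=
  ((qK R).obj (dualCpx
    ((CochainComplex.singleFunctor (ModuleCat.{u} R) i.deg).obj (fpMod i.mat))))⟦i.sh⟧

lemma Kinj.cotest (i : CotestIndex R) : Kinj R (cotest i) :=
  (Kinj.dualCpx _).shift _

/-- All morphisms from `M` to the cotest objects factor through `v`. -/
def CotestSurjective {M I : K R} (v : M ⟶ I) : Prop :=
  ∀ (i : CotestIndex R) (x : M ⟶ cotest i),
    ∃ y : I ⟶ cotest i, v ≫ y = x

lemma exists_Kinj_cotestSurjective (M : K R) :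
    ∃ (I : K R) (v : M ⟶ I), Kinj R I ∧ CotestSurjective v := by
  let ι := Σ i : CotestIndex R, (M ⟶ cotest i)
  obtain ⟨S, p, hS, hlift, -⟩ := Kinj.exists_product
    (fun i : ι => cotest i.1) (fun i => .cotest _)
  obtain ⟨v, hv⟩ := hlift M fun i => i.2
  exact ⟨S, v, hS, fun i x => ⟨p ⟨i, x⟩, hv _⟩⟩

/-- I' is the fibre of the product of all morphisms from I to cotest objects killed by v. -/
lemma exists_Kinj_kill {M I : K R} (v : M ⟶ I) (hI : Kinj R I) :
    ∃ (I' : K R) (s : I' ⟶ I) (v' : M ⟶ I'), Kinj R I' ∧ v' ≫ s = v ∧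
      ∀ (i : CotestIndex R) (y : I ⟶ cotest i),
        v ≫ y = 0 → s ≫ y = 0 := by
  let ι := Σ i : CotestIndex R, { y : I ⟶ cotest i // v ≫ y = 0 }
  obtain ⟨S, p, hS, hlift, hext⟩ := Kinj.exists_product
    (fun i : ι => cotest i.1) (fun i => .cotest _)
  obtain ⟨g, hg⟩ := hlift I fun i => i.2.1
  have hvg : v ≫ g = 0 := hext _ _ fun i => by
    rw [Category.assoc, hg]
    exact i.2.2
  obtain ⟨I', s, t, hT⟩ := distinguished_cocone_triangle₁ g
  obtain ⟨v', hv'⟩ : ∃ v' : M ⟶ I', v = v' ≫ s := Triangle.coyoneda_exact₂ _ hT v hvg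
  have hsg : s ≫ g = 0 := comp_distTriang_mor_zero₁₂ _ hT
  refine ⟨I', s, v', Kinj.distTriang₁ hT hI hS, hv'.symm, fun i y hy => ?_⟩
  have h : g ≫ p ⟨i, y, hy⟩ = y := hg _
  rw [← h, ← Category.assoc, hsg, zero_comp]

/-- A morphism whose composition with every morphism to a cotest object is zero. -/
def IsGhost {X Y : K R} (f : X ⟶ Y) : Prop :=
  ∀ (i : CotestIndex R) (y : Y ⟶ cotest i), f ≫ y = 0

lemma CotestSurjective.shift {M I : K R} {v : M ⟶ I} (hv : CotestSurjective v) 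
    (i : CotestIndex R) (x : M⟦(1 : ℤ)⟧ ⟶ cotest i) :
    ∃ y : I⟦(1 : ℤ)⟧ ⟶ cotest i, v⟦(1 : ℤ)⟧' ≫ y = x := by
  obtain ⟨k, n, a, m, j⟩ := i
  let e : (cotest ⟨k, n, a, m, j - 1⟩)⟦(1 : ℤ)⟧ ≅ cotest ⟨k, n, a, m, j⟩ :=
    ((shiftFunctorAdd' (K R) (j - 1) 1 j (by lia)).app _).symm
  obtain ⟨t, ht⟩ := (shiftFunctor (K R) (1 : ℤ)).map_surjective (x ≫ e.inv)
  obtain ⟨y, rfl⟩ := hv _ t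
  exact ⟨y⟦(1 : ℤ)⟧' ≫ e.hom, by
    rw [← Category.assoc, ← Functor.map_comp, ht, Category.assoc, e.inv_hom_id, Category.comp_id]⟩

/-- For y from C to a cotest object, s kills f ≫ y, so c ≫ y factors through M[1].
Cotest-surjectivity extends that factor over I'[1], and d' followed by v'[1] is zero. -/
lemma isGhost_of_kill {M I I' C C' : K R} {v : M ⟶ I} {v' : M ⟶ I'} {s : I' ⟶ I}
    (hv : CotestSurjective v') 
    (hs : ∀ (i : CotestIndex R) (y : I ⟶ cotest i),
        v ≫ y = 0 → s ≫ y = 0)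
    {f : I ⟶ C} {d : C ⟶ M⟦(1 : ℤ)⟧} (hT : Triangle.mk v f d ∈ distTriang _)
    {f' : I' ⟶ C'} {d' : C' ⟶ M⟦(1 : ℤ)⟧} (hT' : Triangle.mk v' f' d' ∈ distTriang _)
    {c : C' ⟶ C} (hc : f' ≫ c = s ≫ f) : IsGhost c := by
  intro i y
  have hvi : v ≫ f = 0 := comp_distTriang_mor_zero₁₂ _ hT
  have hdv : d' ≫ v'⟦(1 : ℤ)⟧' = 0 := comp_distTriang_mor_zero₃₁ _ hT'
  have h : f' ≫ c ≫ y = 0 := by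
    rw [← Category.assoc, hc, Category.assoc]
    exact hs _ _ (by rw [← Category.assoc, hvi, zero_comp])
  obtain ⟨z, hz⟩ : ∃ z : M⟦(1 : ℤ)⟧ ⟶ cotest i, c ≫ y = d' ≫ z :=
    Triangle.yoneda_exact₃ _ hT' _ h
  obtain ⟨t, rfl⟩ := hv.shift _ z
  rw [hz, ← Category.assoc, hdv, zero_comp]

lemma homCpxMap_id_id (B C : Cpx R) : homCpxMap (𝟙 B) (𝟙 C) = 𝟙 (homCpx B C) := by
  ext n : 1
  refine hom_hom_ext fun j k h => ?_
  rw [homCpxMap_homEval]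
  simp

/-- Morphisms Y → F* and F → Y* both correspond to morphisms F ⊗ Y → E. A ghost is thus invisible to
Hom(F, -) on character complexes, and E being a cogenerator gives the claim for F ⊗ -. -/
lemma tensorKills_of_isGhost {X Y : Cpx R} {g : X ⟶ Y} (hg : IsGhost ((qK R).map g)) {k n : ℕ}
    (a : Fin k → Fin n → R) : TensorKills (fpMod a) g := by
  refine tensorKills_of_homKills ((homKills_iff _ _).2 fun m f => ?_)
  obtain ⟨f, rfl⟩ := (qK R).map_surjective f
  obtain ⟨h, rfl⟩ := (tensorHomEquiv _ _ _).surjective f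
  let F : Cpx R := (CochainComplex.singleFunctor (ModuleCat.{u} R) m).obj (fpMod a)
  let i : CotestIndex R := ⟨k, n, a, m, 0⟩
  let e : (qK R).obj (dualCpx F) ⟶ cotest i :=
    (shiftFunctorZero (K R) ℤ).inv.app ((qK R).obj (dualCpx F))
  have : IsIso e := inferInstanceAs (IsIso
    ((shiftFunctorZero (K R) ℤ).inv.app ((qK R).obj (dualCpx F))))
  have h₁ : (qK R).map g ≫ (qK R).map (tensorHomEquiv Y F (cogenCpx R) ((β_ Y F).hom ≫ h)) = 0 := by
    rw [← cancel_mono e, Category.assoc, zero_comp]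
    exact hg i _
  have h₂ : (qK R).map ((g ⊗ₘ 𝟙 F) ≫ ((β_ Y F).hom ≫ h) ≫ 𝟙 _) = 0 := by
    rw [← quotient_map_tensorHomEquiv_eq_zero_iff, tensorHomEquiv_naturality, homCpxMap_id_id,
      Category.comp_id, Functor.map_comp]
    exact h₁
  have h₃ : (qK R).map ((𝟙 F ⊗ₘ g) ≫ h ≫ 𝟙 _) = 0 := by
    rw [← cancel_epi ((qK R).map (β_ X F).hom), comp_zero, ← h₂, ← Functor.map_comp]
    simp
  rw [← Functor.map_comp]
  rw [← quotient_map_tensorHomEquiv_eq_zero_iff, tensorHomEquiv_naturality, Category.id_comp] at h₃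
  exact h₃

lemma comp_eq_zero_of_isGhost {X₃ X₂ X₁ X₀ : K R} {f₃ : X₃ ⟶ X₂} {f₂ : X₂ ⟶ X₁} {f₁ : X₁ ⟶ X₀}
    (h₃ : IsGhost f₃) (h₂ : IsGhost f₂) (h₁ : IsGhost f₁) {T : K R} (hT : IsTest T)
    (x : T ⟶ X₃) : x ≫ f₃ ≫ f₂ ≫ f₁ = 0 := by
  obtain ⟨X₃, rfl⟩ := HomotopyCategory.quotient_obj_surjective X₃
  obtain ⟨X₂, rfl⟩ := HomotopyCategory.quotient_obj_surjective X₂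
  obtain ⟨X₁, rfl⟩ := HomotopyCategory.quotient_obj_surjective X₁
  obtain ⟨X₀, rfl⟩ := HomotopyCategory.quotient_obj_surjective X₀
  obtain ⟨f₃, rfl⟩ := (qK R).map_surjective f₃
  obtain ⟨f₂, rfl⟩ := (qK R).map_surjective f₂
  obtain ⟨f₁, rfl⟩ := (qK R).map_surjective f₁
  obtain ⟨k, n, a, m, ⟨e⟩⟩ := hT
  have := (homKills_iff _ _).1 (homKills_fpMod_of_tensorKills (tensorKills_of_isGhost h₃)
    (tensorKills_of_isGhost h₂) (tensorKills_of_isGhost h₁) a) m (e.inv ≫ x)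
  rw [Functor.map_comp, Functor.map_comp, Category.assoc] at this
  rw [← cancel_epi e.inv, comp_zero]
  exact this

/-- After three killings the induced map of cones C₃ → C₀ is a composite of three ghosts, hence zero
on test objects. So the image of I' in I comes from M on test objects, and v' is injective on them.
-/
lemma exists_Kinj_extension {M I : K R} (v : M ⟶ I) (hI : Kinj R I) (hv : CotestSurjective v) :
    ∃ (I' : K R) (s : I' ⟶ I) (v' : M ⟶ I'), Kinj R I' ∧ v' ≫ s = v ∧
      ∀ T, IsTest T → (∀ x : T ⟶ I', ∃ y : T ⟶ M, x ≫ s = y ≫ v) ∧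
        ∀ y : T ⟶ M, y ≫ v' = 0 → y = 0 := by
  have hsurj {I' : K R} {s : I' ⟶ I} {v' : M ⟶ I'} (h : v' ≫ s = v) : CotestSurjective v' :=
    fun i x => by
      obtain ⟨y, rfl⟩ := hv i x
      exact ⟨s ≫ y, by rw [← h, Category.assoc]⟩
  obtain ⟨I₁, s₁, v₁, hI₁, hs₁, hk₁⟩ := exists_Kinj_kill v hI
  obtain ⟨I₂, s₂, v₂, hI₂, hs₂, hk₂⟩ := exists_Kinj_kill v₁ hI₁
  obtain ⟨I₃, s₃, v₃, hI₃, hs₃, hk₃⟩ := exists_Kinj_kill v₂ hI₂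
  have hs₂' : v₂ ≫ s₂ ≫ s₁ = v := by rw [← hs₁, ← hs₂, Category.assoc]
  have hs₃' : v₃ ≫ s₃ ≫ s₂ ≫ s₁ = v := by rw [← hs₂', ← hs₃, Category.assoc]
  obtain ⟨C₀, f₀, d₀, hT₀⟩ := distinguished_cocone_triangle v
  obtain ⟨C₁, f₁, d₁, hT₁⟩ := distinguished_cocone_triangle v₁
  obtain ⟨C₂, f₂, d₂, hT₂⟩ := distinguished_cocone_triangle v₂
  obtain ⟨C₃, f₃, d₃, hT₃⟩ := distinguished_cocone_triangle v₃
  have exists_c {I I' C C' : K R} {v : M ⟶ I} {v' : M ⟶ I'} {s : I' ⟶ I} {f : I ⟶ C}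
      {d : C ⟶ M⟦(1 : ℤ)⟧} {f' : I' ⟶ C'} {d' : C' ⟶ M⟦(1 : ℤ)⟧} (h : v' ≫ s = v)
      (hT : Triangle.mk v f d ∈ distTriang _) (hT' : Triangle.mk v' f' d' ∈ distTriang _) :
      ∃ c : C' ⟶ C, f' ≫ c = s ≫ f ∧ d' = c ≫ d := by
    obtain ⟨c, hc, hc'⟩ := complete_distinguished_triangle_morphism _ _ hT' hT (𝟙 M) s (by
      change v' ≫ s = 𝟙 M ≫ v
      rw [h, Category.id_comp])
    replace hc' : d' ≫ (shiftFunctor (K R) (1 : ℤ)).map (𝟙 M) = c ≫ d := hc'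
    rw [CategoryTheory.Functor.map_id] at hc'
    exact ⟨c, hc, (Category.comp_id _).symm.trans hc'⟩
  obtain ⟨c₁, hc₁, hd₁⟩ := exists_c hs₁ hT₀ hT₁
  obtain ⟨c₂, hc₂, hd₂⟩ := exists_c hs₂ hT₁ hT₂
  obtain ⟨c₃, hc₃, hd₃⟩ := exists_c hs₃ hT₂ hT₃
  have hc {T : K R} (hT : IsTest T) (x : T ⟶ C₃) : x ≫ c₃ ≫ c₂ ≫ c₁ = 0 :=
    comp_eq_zero_of_isGhost (isGhost_of_kill (hsurj hs₃') hk₃ hT₂ hT₃ hc₃)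
      (isGhost_of_kill (hsurj hs₂') hk₂ hT₁ hT₂ hc₂) (isGhost_of_kill (hsurj hs₁) hk₁ hT₀ hT₁ hc₁)
      hT x
  refine ⟨I₃, s₃ ≫ s₂ ≫ s₁, v₃, hI₃, hs₃', fun T hT => ⟨fun x => ?_, fun y hy => ?_⟩⟩
  · refine Triangle.coyoneda_exact₂ _ hT₀ (x ≫ s₃ ≫ s₂ ≫ s₁) ?_
    have := hc hT (x ≫ f₃)
    rw [Category.assoc, ← Category.assoc f₃, hc₃, Category.assoc, ← Category.assoc f₂, hc₂,
      Category.assoc, hc₁] at this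
    change (x ≫ s₃ ≫ s₂ ≫ s₁) ≫ f₀ = 0
    simpa only [Category.assoc] using this
  · have hy' : y⟦(1 : ℤ)⟧' ≫ v₃⟦(1 : ℤ)⟧' = 0 := by rw [← Functor.map_comp, hy, Functor.map_zero]
    obtain ⟨t, ht⟩ : ∃ t : T⟦(1 : ℤ)⟧ ⟶ C₃, y⟦(1 : ℤ)⟧' = t ≫ d₃ :=
      Triangle.coyoneda_exact₁ _ hT₃ _ hy'
    have h0 := hc (hT.shift 1) t
    apply (shiftFunctor (K R) (1 : ℤ)).map_injective
    rw [ht, hd₃, hd₂, hd₁, Functor.map_zero]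
    have := congrArg (· ≫ d₀) h0
    simpa using this

/-- Every object of the homotopy category is approximated by a complex of pure injective modules,
which is obtained as a homotopy limit. -/
lemma exists_Kinj_test_bijective (M : K R) :
    ∃ (I : K R) (v : M ⟶ I), Kinj R I ∧
      ∀ T, IsTest T → Function.Bijective (fun y : T ⟶ M => y ≫ v) := by
  obtain ⟨I₀, v₀, hI₀, hv₀⟩ := exists_Kinj_cotestSurjective M
  choose F s' v' hF hs' hstep using
    fun (p : { p : Σ I : K R, (M ⟶ I) // Kinj R p.1 ∧ CotestSurjective p.2 }) =>
      exists_Kinj_extension p.1.2 p.2.1 p.2.2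
  let stage (k : ℕ) : { p : Σ I : K R, (M ⟶ I) // Kinj R p.1 ∧ CotestSurjective p.2 } :=
    Nat.rec ⟨⟨I₀, v₀⟩, hI₀, hv₀⟩ (fun _ p => ⟨⟨F p, v' p⟩, hF p, fun i x => by
      obtain ⟨y, rfl⟩ := p.2.2 i x
      exact ⟨s' p ≫ y, by rw [← Category.assoc, hs']⟩⟩) k
  let X (k : ℕ) : K R := (stage k).1.1
  let u (k : ℕ) : M ⟶ X k := (stage k).1.2
  let s (k : ℕ) : X (k + 1) ⟶ X k := s' (stage k)
  have hus (k : ℕ) : u (k + 1) ≫ s k = u k := hs' (stage k)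
  have hfac (k : ℕ) {T : K R} (hT : IsTest T) (x : T ⟶ X (k + 1)) :
      ∃ y : T ⟶ M, x ≫ s k = y ≫ u k := (hstep (stage k) T hT).1 x
  have hinj (k : ℕ) {T : K R} (hT : IsTest T) (y : T ⟶ M) (hy : y ≫ u (k + 1) = 0) : y = 0 :=
    (hstep (stage k) T hT).2 y hy
  obtain ⟨S, p', hS, hlift, hext⟩ :=
    Kinj.exists_product (fun k : ULift.{u} ℕ => X k.down) (fun k => (stage k.down).2.1)
  let p (k : ℕ) : S ⟶ X k := p' ⟨k⟩
  have hlift (Y : K R) (f : ∀ k, Y ⟶ X k) : ∃ g : Y ⟶ S, ∀ k, g ≫ p k = f k := by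
    obtain ⟨g, hg⟩ := hlift Y fun k => f k.down
    exact ⟨g, fun k => hg ⟨k⟩⟩
  have hext {Y : K R} {f g : Y ⟶ S} (hf : ∀ k, f ≫ p k = g ≫ p k) : f = g := by
    rw [← sub_eq_zero]
    exact hext _ _ fun k => by rw [Preadditive.sub_comp, sub_eq_zero]; exact hf k.down
  -- The map "identity minus shift", whose fibre is the homotopy limit.
  obtain ⟨D, hD⟩ := hlift S fun k => p k - p (k + 1) ≫ s k
  obtain ⟨w, hw⟩ := hlift M u
  have hDsurj {T : K R} (hT : IsTest T) (t : T ⟶ S) : ∃ t' : T ⟶ S, t' ≫ D = t := by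
    choose m hm using fun k => hfac k hT (t ≫ p (k + 1))
    -- This solves t'ₖ - sₖ(t'ₖ₊₁) = tₖ, as sₖ(tₖ₊₁) = uₖ(mₖ) and the u's are compatible: the
    -- partial sums telescope. It is the vanishing of lim¹ on test objects.
    obtain ⟨t', ht'⟩ := hlift T fun k => t ≫ p k - (∑ j ∈ Finset.range k, m j) ≫ u k
    refine ⟨t', hext fun k => ?_⟩
    rw [Category.assoc, hD, Preadditive.comp_sub, ht', ← Category.assoc, ht',
      Preadditive.sub_comp, hm, Category.assoc, hus, Finset.sum_range_succ, Preadditive.add_comp]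
    abel
  obtain ⟨I, π, δ, hI⟩ := distinguished_cocone_triangle₁ D
  have hπD : π ≫ D = 0 := comp_distTriang_mor_zero₁₂ _ hI
  have hDδ : D ≫ δ = 0 := comp_distTriang_mor_zero₂₃ _ hI
  have hps (k : ℕ) : π ≫ p (k + 1) ≫ s k = π ≫ p k := by
    have := congrArg (· ≫ p k) hπD
    simp only [Category.assoc, hD, zero_comp, Preadditive.comp_sub] at this
    exact (sub_eq_zero.1 this).symm
  have hπ {T : K R} (hT : IsTest T) (z : T ⟶ I) (hz : z ≫ π = 0) : z = 0 := by
    have hz' : z⟦(1 : ℤ)⟧' ≫ π⟦(1 : ℤ)⟧' = 0 := by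
      rw [← Functor.map_comp, hz, Functor.map_zero]
    obtain ⟨t, ht⟩ : ∃ t : T⟦(1 : ℤ)⟧ ⟶ S, z⟦(1 : ℤ)⟧' = t ≫ δ :=
      Triangle.coyoneda_exact₁ _ hI _ hz'
    obtain ⟨t, rfl⟩ := hDsurj (hT.shift 1) t
    apply (shiftFunctor (K R) (1 : ℤ)).map_injective
    rw [ht, Category.assoc, hDδ, comp_zero, Functor.map_zero]
  have hwD : w ≫ D = 0 := hext fun k => by
    rw [Category.assoc, hD, Preadditive.comp_sub, hw, ← Category.assoc, hw, hus, sub_self,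
      zero_comp]
  obtain ⟨v, hv⟩ : ∃ v : M ⟶ I, w = v ≫ π := Triangle.coyoneda_exact₂ _ hI w hwD
  have hvu (k : ℕ) : v ≫ π ≫ p k = u k := by rw [← Category.assoc, ← hv, hw]
  refine ⟨I, v, Kinj.distTriang₁ hI hS hS, fun T hT => ⟨fun x x' hx => ?_, fun x => ?_⟩⟩
  · refine sub_eq_zero.1 (hinj 0 hT (x - x') ?_)
    have := congrArg (· ≫ π ≫ p 1) hx
    simp only [Category.assoc, hvu] at this
    rw [Preadditive.sub_comp, sub_eq_zero]
    exact this
  · choose m hm using fun k => hfac k hT (x ≫ π ≫ p (k + 1))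
    simp only [Category.assoc, hps] at hm
    -- Only the u (k + 1) are known to be injective on test objects, so m 0 may differ and the
    -- common value is m 1.
    have hmm (k : ℕ) : m (k + 1) = m 1 := by
      induction k with
      | zero => rfl
      | succ k ih =>
        rw [← ih, ← sub_eq_zero]
        refine hinj k hT _ ?_
        rw [Preadditive.sub_comp, ← hm, sub_eq_zero, ← hus (k + 1), ← Category.assoc, ← hm,
          Category.assoc, Category.assoc, hps]
    have hm1 (k : ℕ) : m 1 ≫ u k = x ≫ π ≫ p k := by
      rw [← hus k, ← Category.assoc, ← hmm k, ← hm, Category.assoc, Category.assoc, hps]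
    refine ⟨m 1, sub_eq_zero.1 (hπ hT _ (hext fun k => ?_))⟩
    rw [zero_comp, Preadditive.sub_comp, Preadditive.sub_comp, sub_eq_zero, Category.assoc,
      Category.assoc, Category.assoc, hvu, hm1]

theorem nonempty_pureInjectiveResolution (N : Cpx R) : Nonempty (PureInjectiveResolution N) := by
  obtain ⟨X, v, ⟨I, ⟨e⟩, hI, hI'⟩, hv⟩ := exists_Kinj_test_bijective ((qK R).obj N)
  obtain ⟨f, hf⟩ := (qK R).map_surjective (v ≫ e.hom)
  refine ⟨I, f, fun i => (hI i).isPureInjective, isPureQuasiIso_of_test_bijective f ?_,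
    (isKPureInjective_iff I).2 hI'⟩
  intro A hA
  rw [hf]
  have := (e.homToEquiv (Z := A)).bijective.comp (hv A hA)
  convert this using 1
  ext y
  simp

end

/-! ### D_pur(R) as a symmetric monoidal localization of C(R) -/

section

variable (R) in
/-- The morphisms of complexes which become invertible in the pure derived category. -/
def pureW : MorphismProperty (Cpx R) := (Kpac R).trW.inverseImage (qK R)

lemma pureW_iff {X Y : Cpx R} (f : X ⟶ Y) : pureW R f ↔ (Kpac R).trW ((qK R).map f) := Iff.rfl

lemma pureW_of_isPureQuasiIso {X Y : Cpx R} {f : X ⟶ Y} (hf : IsPureQuasiIso f) : pureW R f :=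
  ObjectProperty.trW.mk (Kpac R) (HomotopyCategory.mappingCone_triangleh_distinguished f) hf

instance : (pureW R).IsMultiplicative :=
  inferInstanceAs ((Kpac R).trW.inverseImage (qK R)).IsMultiplicative

instance : (pureW R).RespectsIso :=
  inferInstanceAs ((Kpac R).trW.inverseImage (qK R)).RespectsIso

instance : (Q R).IsLocalization (pureW R) := by
  refine Functor.IsLocalization.comp (qK R) (Qh R)
    (HomologicalComplex.homotopyEquivalences _ _) (Kpac R).trW (pureW R) ?_ ?_ ?_
  · intro X Y f hf
    exact Localization.inverts (Qh R) (Kpac R).trW _ hf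
  · intro X Y f hf
    have : IsIso ((qK R).map f) :=
      Localization.inverts (qK R) (HomologicalComplex.homotopyEquivalences _ _) f hf
    exact ObjectProperty.trW_of_isIso _ _
  · intro X Y f hf
    obtain ⟨X, rfl⟩ := HomotopyCategory.quotient_obj_surjective X
    obtain ⟨Y, rfl⟩ := HomotopyCategory.quotient_obj_surjective Y
    obtain ⟨f, rfl⟩ := (qK R).map_surjective f
    exact MorphismProperty.map_mem_map _ _ _ hf

lemma Q_obj_surjective : Function.Surjective (Q R).obj := fun X => by
  obtain ⟨Y, rfl⟩ := (Localization.Construction.objEquiv (Kpac R).trW).surjective X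
  obtain ⟨Y, rfl⟩ := HomotopyCategory.quotient_obj_surjective Y
  exact ⟨Y, rfl⟩

lemma tensorHomEquiv_whiskerRight {A A' B C : Cpx R} (a : A' ⟶ A) (f : A ⊗ B ⟶ C) :
    tensorHomEquiv A' B C (a ▷ B ≫ f) = a ≫ tensorHomEquiv A B C f := by
  have := tensorHomEquiv_naturality a (𝟙 B) (𝟙 C) f
  rwa [homCpxMap_id_id, Category.comp_id, Category.comp_id, MonoidalCategory.tensorHom_id] at this

/-- For I right orthogonal to K_pac, precomposition with f ▷ Y into I is, by adjunction,
precomposition with f into Hom(Y, I), which is right orthogonal too. -/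
lemma pureW_whiskerRight {X₁ X₂ : Cpx R} (f : X₁ ⟶ X₂) (hf : pureW R f) (Y : Cpx R) :
    pureW R (f ▷ Y) := by
  rw [pureW_iff, trW_Kpac_iff]
  intro I hI
  obtain ⟨I, rfl⟩ := HomotopyCategory.quotient_obj_surjective I
  obtain ⟨hi, hs⟩ := (trW_Kpac_iff _).1 hf _ (rightOrthogonal_homCpx Y hI)
  constructor
  · intro a b hab
    obtain ⟨a, rfl⟩ := (qK R).map_surjective a
    obtain ⟨b, rfl⟩ := (qK R).map_surjective b
    refine (quotient_map_tensorHomEquiv_eq_iff _ _).1 (hi ?_)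
    dsimp only at hab ⊢
    rw [← Functor.map_comp, ← Functor.map_comp] at hab ⊢
    have := (quotient_map_tensorHomEquiv_eq_iff _ _).2 hab
    rwa [tensorHomEquiv_whiskerRight, tensorHomEquiv_whiskerRight] at this
  · intro c
    obtain ⟨c, rfl⟩ := (qK R).map_surjective c
    obtain ⟨d, hd⟩ := hs ((qK R).map (tensorHomEquiv _ _ _ c))
    obtain ⟨d, rfl⟩ := (qK R).map_surjective d
    obtain ⟨d, rfl⟩ := (tensorHomEquiv X₂ Y I).surjective d
    refine ⟨(qK R).map d, ?_⟩
    dsimp only at hd ⊢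
    rw [← Functor.map_comp] at hd ⊢
    refine (quotient_map_tensorHomEquiv_eq_iff _ _).1 ?_
    rwa [tensorHomEquiv_whiskerRight]

instance : (pureW R).IsMonoidal where
  whiskerRight f hf Y := pureW_whiskerRight f hf Y
  whiskerLeft X Y₁ Y₂ g hg := by
    refine ((pureW R).arrow_mk_iso_iff ?_).1 (pureW_whiskerRight g hg X)
    exact Arrow.isoMk (β_ _ _) (β_ _ _) (BraidedCategory.braiding_naturality_left g X).symm

variable (R) in
/-- The pure derived category, with the tensor product inherited from the category of complexes. -/
abbrev LocDpur : Type (u + 1) := LocalizedMonoidal (Q R) (pureW R) (Iso.refl _)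

instance : MonoidalCategory (Dpur R) := inferInstanceAs (MonoidalCategory (LocDpur R))

instance : SymmetricCategory (Dpur R) := inferInstanceAs (SymmetricCategory (LocDpur R))

instance : (Q R).Monoidal :=
  inferInstanceAs (Localization.Monoidal.toMonoidalCategory (Q R) (pureW R) (Iso.refl _)).Monoidal

lemma Q_μ_koszulBraiding (A B : Cpx R) :
    Functor.LaxMonoidal.μ (Q R) A B ≫ (Q R).map (koszulBraiding A B) =
      (β_ ((Q R).obj A) ((Q R).obj B)).hom ≫ Functor.LaxMonoidal.μ (Q R) B A :=
  (Functor.LaxBraided.braided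
    (F := Localization.Monoidal.toMonoidalCategory (Q R) (pureW R) (Iso.refl _)) A B)

lemma isIso_Q_map {X Y : Cpx R} {f : X ⟶ Y} (hf : IsPureQuasiIso f) :
    IsIso ((Q R).map f) :=
  Localization.inverts (Q R) (pureW R) f (pureW_of_isPureQuasiIso hf)

lemma Q_map_surjective (X : Cpx R) {I : Cpx R} (hI : IsKPureInjective I) :
    Function.Surjective ((Q R).map : (X ⟶ I) → _) := fun f => by
  obtain ⟨f, rfl⟩ := (ObjectProperty.rightOrthogonal.map_bijective_of_isTriangulated
    ((isKPureInjective_iff I).1 hI) (Qh R) ((qK R).obj X)).2 f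
  obtain ⟨f, rfl⟩ := (qK R).map_surjective f
  exact ⟨f, rfl⟩

lemma Q_map_eq_iff {X I : Cpx R} (hI : IsKPureInjective I) (f g : X ⟶ I) :
    (Q R).map f = (Q R).map g ↔ (qK R).map f = (qK R).map g :=
  (ObjectProperty.rightOrthogonal.map_bijective_of_isTriangulated
    ((isKPureInjective_iff I).1 hI) (Qh R) ((qK R).obj X)).1.eq_iff

lemma IsKPureInjective.homCpx {I : Cpx R} (hI : IsKPureInjective I) (A : Cpx R) :
    IsKPureInjective (homCpx A I) :=
  (isKPureInjective_iff _).2 (rightOrthogonal_homCpx A ((isKPureInjective_iff I).1 hI))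

end

/-! ### Closed structures from universal evaluations, in any symmetric monoidal category -/

section

section Closed

open MonoidalClosed

variable {D : Type*} [Category D] [MonoidalCategory D]

/-- A morphism `E ⊗ B ⟶ C` is an evaluation if it exhibits `E` as an internal Hom from `B` to
`C`. -/
def IsEvaluation {B C E : D} (ev : E ⊗ B ⟶ C) : Prop :=
  ∀ A : D, Function.Bijective (fun g : A ⟶ E => g ▷ B ≫ ev)

section Symmetric

variable [SymmetricCategory D]

/-- The bijection `(B ⊗ A ⟶ C) ≃ (A ⟶ E)` attached to an evaluation `E ⊗ B ⟶ C`. -/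
def IsEvaluation.homEquiv {B C E : D} {ev : E ⊗ B ⟶ C} (h : IsEvaluation ev) (A : D) :
    (B ⊗ A ⟶ C) ≃ (A ⟶ E) :=
  ((Equiv.ofBijective _ (h A)).trans
    (Iso.homCongr (β_ A B) (Iso.refl C))).symm

lemma IsEvaluation.homEquiv_symm_apply {B C E : D} {ev : E ⊗ B ⟶ C} (h : IsEvaluation ev) {A : D}
    (g : A ⟶ E) : (h.homEquiv A).symm g = (β_ A B).inv ≫ g ▷ B ≫ ev := by
  simp [homEquiv, Iso.homCongr]

lemma IsEvaluation.homEquiv_naturality {B C E : D} {ev : E ⊗ B ⟶ C} (h : IsEvaluation ev)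
    {A A' : D} (a : A' ⟶ A) (f : B ⊗ A ⟶ C) :
    h.homEquiv A' (B ◁ a ≫ f) = a ≫ h.homEquiv A f := by
  obtain ⟨g, rfl⟩ := (h.homEquiv A).symm.surjective f
  rw [Equiv.apply_symm_apply, ← Equiv.eq_symm_apply, homEquiv_symm_apply, homEquiv_symm_apply,
    BraidedCategory.braiding_inv_naturality_right_assoc, comp_whiskerRight, Category.assoc]

lemma IsEvaluation.homEquiv_whiskerRight_comp {B C E : D} {ev : E ⊗ B ⟶ C} (h : IsEvaluation ev)
    {A : D} (f : B ⊗ A ⟶ C) : h.homEquiv A f ▷ B ≫ ev = (β_ A B).hom ≫ f := by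
  rw [← Iso.inv_comp_eq, ← h.homEquiv_symm_apply, Equiv.symm_apply_apply]

/-- An object `B` is closed if all internal Homs from `B` exist. -/
@[reducible]
def closedOfEvaluation {B : D} {E : D → D} {ev : ∀ C, E C ⊗ B ⟶ C}
    (h : ∀ C, IsEvaluation (ev C)) : Closed B where
  rightAdj := Adjunction.rightAdjointOfEquiv (F := tensorLeft B) (fun A C => (h C).homEquiv A)
    (fun _ _ _ a f => (h _).homEquiv_naturality a f)
  adj := Adjunction.adjunctionOfEquivRight _ _

/-- Internal Homs are unique up to isomorphism. -/
def IsEvaluation.iso {B C E : D} [Closed B] {ev : E ⊗ B ⟶ C} (h : IsEvaluation ev) :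
    (ihom B).obj C ≅ E where
  hom := h.homEquiv _ ((ihom.ev B).app C)
  inv := curry ((β_ B E).hom ≫ ev)
  hom_inv_id := by
    refine uncurry_injective ?_
    rw [uncurry_natural_left, uncurry_curry,
      BraidedCategory.braiding_naturality_right_assoc, h.homEquiv_whiskerRight_comp,
      SymmetricCategory.symmetry_assoc, uncurry_id_eq_ev]
  inv_hom_id := by
    refine (h _).1 ?_
    dsimp only
    rw [comp_whiskerRight, Category.assoc, h.homEquiv_whiskerRight_comp,
      BraidedCategory.braiding_naturality_left_assoc, whiskerLeft_curry_ihom_ev_app,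
      SymmetricCategory.symmetry_assoc, id_whiskerRight, Category.id_comp]

lemma IsEvaluation.iso_hom_whiskerRight_comp {B C E : D} [Closed B] {ev : E ⊗ B ⟶ C}
    (h : IsEvaluation ev) :
    h.iso.hom ▷ B ≫ ev = (β_ ((ihom B).obj C) B).hom ≫ (ihom.ev B).app C :=
  h.homEquiv_whiskerRight_comp _

/-- Both sides are compared after evaluation, where the hypothesis on e is the only input specific
to E and E'. -/
lemma IsEvaluation.iso_naturality {B C E B' C' E' : D} [Closed B] [Closed B'] {ev : E ⊗ B ⟶ C}
    (h : IsEvaluation ev) {ev' : E' ⊗ B' ⟶ C'} (h' : IsEvaluation ev')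
    (b : B' ⟶ B) (c : C ⟶ C') (e : E ⟶ E') (he : e ▷ B' ≫ ev' = E ◁ b ≫ ev ≫ c) :
    ((pre b).app C ≫ (ihom B').map c) ≫ h'.iso.hom = h.iso.hom ≫ e := by
  refine (h' _).1 ?_
  dsimp only
  simp only [comp_whiskerRight, Category.assoc]
  rw [he, h'.iso_hom_whiskerRight_comp, ← whisker_exchange_assoc,
    reassoc_of% h.iso_hom_whiskerRight_comp, BraidedCategory.braiding_naturality_left_assoc,
    BraidedCategory.braiding_naturality_left_assoc,
    BraidedCategory.braiding_naturality_right_assoc, ihom.ev_naturality,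
    id_tensor_pre_app_comp_ev_assoc]

end Symmetric

section Tensor

/-- The action of the internal Hom on morphisms. -/
abbrev ihomMap [MonoidalClosed D] {B B' C C' : D} (b : B' ⟶ B) (c : C ⟶ C') :
    (internalHom.obj (op B)).obj C ⟶ (internalHom.obj (op B')).obj C' :=
  (internalHom.map b.op).app C ≫ (internalHom.obj (op B')).map c

lemma ihomMap_id_id [MonoidalClosed D] (B C : D) : ihomMap (𝟙 B) (𝟙 C) = 𝟙 _ := by
  change (pre (𝟙 B)).app C ≫ (ihom B).map (𝟙 C) = 𝟙 ((ihom B).obj C)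
  rw [pre_id, CategoryTheory.Functor.map_id, NatTrans.id_app, Category.comp_id]

variable [SymmetricCategory D] [MonoidalClosed D]

/-- The adjunction `Hom (A ⊗ B, C) ≃ Hom (A, Hom (B, C))`. -/
def tensorIhomEquiv (A B C : D) : (A ⊗ B ⟶ C) ≃ (A ⟶ (internalHom.obj (op B)).obj C) :=
  (Iso.homCongr (β_ A B) (Iso.refl C)).trans ((ihom.adjunction B).homEquiv A C)

lemma tensorIhomEquiv_apply {A B C : D} (f : A ⊗ B ⟶ C) :
    tensorIhomEquiv A B C f = curry ((β_ B A).hom ≫ f) := by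
  change curry ((β_ A B).inv ≫ f ≫ 𝟙 C) = _
  rw [Category.comp_id, SymmetricCategory.braiding_swap_eq_inv_braiding]

lemma tensorIhomEquiv_symm_apply {A B C : D} (f : A ⟶ (ihom B).obj C) :
    (tensorIhomEquiv A B C).symm f = (β_ A B).hom ≫ B ◁ f ≫ (ihom.ev B).app C := by
  refine (Equiv.symm_apply_eq _).2 ((tensorIhomEquiv_apply _).trans ?_).symm
  rw [SymmetricCategory.symmetry_assoc, ← uncurry_eq, curry_uncurry]

lemma tensorIhomEquiv_naturality {A A' B B' C C' : D} (a : A' ⟶ A) (b : B' ⟶ B) (c : C ⟶ C')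
    (f : A ⊗ B ⟶ C) :
    tensorIhomEquiv A' B' C' ((a ⊗ₘ b) ≫ f ≫ c) = a ≫ tensorIhomEquiv A B C f ≫ ihomMap b c := by
  rw [tensorIhomEquiv_apply, tensorIhomEquiv_apply]
  change _ = a ≫ curry _ ≫ (pre b).app C ≫ (ihom B').map c
  rw [curry_pre_app_assoc, ← curry_natural_right, ← curry_natural_left,
    ← BraidedCategory.braiding_naturality_assoc, MonoidalCategory.tensorHom_def']
  simp only [Category.assoc]

/-- The bijection `Hom (X, Hom (A ⊗ B, C)) ≃ Hom (X, Hom (A, Hom (B, C)))`. -/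
def homIhomTensorEquiv (X A B C : D) :
    (X ⟶ (internalHom.obj (op (A ⊗ B))).obj C) ≃
      (X ⟶ (internalHom.obj (op A)).obj ((internalHom.obj (op B)).obj C)) :=
  (tensorIhomEquiv X (A ⊗ B) C).symm.trans <|
    (Iso.homCongr (α_ X A B).symm (Iso.refl C)).trans <|
      (tensorIhomEquiv (X ⊗ A) B C).trans (tensorIhomEquiv X A _)

lemma homIhomTensorEquiv_tensorIhomEquiv {X A B C : D} (f : X ⊗ (A ⊗ B) ⟶ C) :
    homIhomTensorEquiv X A B C (tensorIhomEquiv X (A ⊗ B) C f) =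
      tensorIhomEquiv X A _ (tensorIhomEquiv (X ⊗ A) B C ((α_ X A B).hom ≫ f)) := by
  simp [homIhomTensorEquiv, Iso.homCongr]

/-- Naturality in X gives `ihomTensorIso` by the Yoneda argument; naturality in A, B, C is then that
of the isomorphism. -/
lemma homIhomTensorEquiv_naturality {X X' A A' B B' C C' : D} (x : X' ⟶ X) (a : A' ⟶ A)
    (b : B' ⟶ B) (c : C ⟶ C') (f : X ⟶ (internalHom.obj (op (A ⊗ B))).obj C) :
    homIhomTensorEquiv X' A' B' C' (x ≫ f ≫ ihomMap (a ⊗ₘ b) c) =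
      x ≫ homIhomTensorEquiv X A B C f ≫ ihomMap a (ihomMap b c) := by
  obtain ⟨f, rfl⟩ := (tensorIhomEquiv X (A ⊗ B) C).surjective f
  rw [← tensorIhomEquiv_naturality, homIhomTensorEquiv_tensorIhomEquiv,
    homIhomTensorEquiv_tensorIhomEquiv, ← tensorIhomEquiv_naturality,
    ← tensorIhomEquiv_naturality, Category.assoc, associator_naturality_assoc]

lemma comp_homIhomTensorEquiv {X X' A B C : D} (x : X' ⟶ X)
    (f : X ⟶ (internalHom.obj (op (A ⊗ B))).obj C) :
    homIhomTensorEquiv X' A B C (x ≫ f) = x ≫ homIhomTensorEquiv X A B C f := by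
  have := homIhomTensorEquiv_naturality x (𝟙 A) (𝟙 B) (𝟙 C) f
  rwa [MonoidalCategory.id_tensorHom_id, ihomMap_id_id, ihomMap_id_id, ihomMap_id_id,
    Category.comp_id, Category.comp_id] at this

/-- The internal form of the tensor-Hom adjunction. -/
def ihomTensorIso (A B C : D) : (internalHom.obj (op (A ⊗ B))).obj C ≅
    (internalHom.obj (op A)).obj ((internalHom.obj (op B)).obj C) where
  hom := homIhomTensorEquiv _ A B C (𝟙 _)
  inv := (homIhomTensorEquiv _ A B C).symm (𝟙 _)
  hom_inv_id := by
    apply (homIhomTensorEquiv _ A B C).injective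
    rw [comp_homIhomTensorEquiv, Equiv.apply_symm_apply, Category.comp_id]
  inv_hom_id := by
    rw [← comp_homIhomTensorEquiv, Category.comp_id, Equiv.apply_symm_apply]

lemma comp_ihomTensorIso_hom {X A B C : D} (f : X ⟶ (internalHom.obj (op (A ⊗ B))).obj C) :
    f ≫ (ihomTensorIso A B C).hom = homIhomTensorEquiv X A B C f := by
  rw [ihomTensorIso, ← comp_homIhomTensorEquiv, Category.comp_id]

lemma ihomTensorIso_hom_naturality {A A' B B' C C' : D} (a : A' ⟶ A) (b : B' ⟶ B) (c : C ⟶ C') :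
    ihomMap (a ⊗ₘ b) c ≫ (ihomTensorIso A' B' C').hom =
      (ihomTensorIso A B C).hom ≫ ihomMap a (ihomMap b c) := by
  have := homIhomTensorEquiv_naturality (𝟙 _) a b c (𝟙 _)
  rwa [Category.id_comp, Category.id_comp, Category.id_comp, ← comp_ihomTensorIso_hom] at this

variable (S : Type*) [CommRing S] [Preadditive D] [Linear S D] [MonoidalPreadditive D]
  [MonoidalLinear S D]

/-- The adjunction `Hom (A ⊗ B, C) ≃ Hom (A, Hom (B, C))` is linear. -/
def tensorIhomLinearEquiv (A B C : D) :
    (A ⊗ B ⟶ C) ≃ₗ[S] (A ⟶ (internalHom.obj (op B)).obj C) :=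
  -- Linearity is checked on the inverse, which is explicit: whiskering followed by evaluation.
  LinearEquiv.symm
    { (tensorIhomEquiv A B C).symm with
      map_add' := fun f g => by
        have key (f g : A ⟶ (ihom B).obj C) :
            (β_ A B).hom ≫ B ◁ (f + g) ≫ (ihom.ev B).app C =
              (β_ A B).hom ≫ B ◁ f ≫ (ihom.ev B).app C +
                (β_ A B).hom ≫ B ◁ g ≫ (ihom.ev B).app C := by
          rw [MonoidalPreadditive.whiskerLeft_add, Preadditive.add_comp, Preadditive.comp_add]
        exact (tensorIhomEquiv_symm_apply (f + g)).trans ((key f g).trans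
          (congrArg₂ (· + ·) (tensorIhomEquiv_symm_apply f) (tensorIhomEquiv_symm_apply g)).symm)
      map_smul' := fun r f => by
        have key (f : A ⟶ (ihom B).obj C) :
            (β_ A B).hom ≫ B ◁ (r • f) ≫ (ihom.ev B).app C =
              r • ((β_ A B).hom ≫ B ◁ f ≫ (ihom.ev B).app C) := by
          rw [MonoidalLinear.whiskerLeft_smul, Linear.smul_comp, Linear.comp_smul]
        exact (tensorIhomEquiv_symm_apply (r • f)).trans ((key f).trans
          (congrArg (r • ·) (tensorIhomEquiv_symm_apply f)).symm) }

end Tensor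

end Closed

end

/-! ### The pure derived Hom as internal Hom of D_pur(R), and linearity of the tensor product -/

section

section Evaluation

/-- The evaluation morphism of complexes. -/
def cpxEval (B C : Cpx R) : homCpx B C ⊗ B ⟶ C := (tensorHomEquiv (homCpx B C) B C).symm (𝟙 _)

lemma tensorHomEquiv_cpxEval {A B C : Cpx R} (g : A ⟶ homCpx B C) :
    tensorHomEquiv A B C (g ▷ B ≫ cpxEval B C) = g := by
  rw [tensorHomEquiv_whiskerRight, cpxEval, Equiv.apply_symm_apply, Category.comp_id]

lemma homCpxMap_whiskerRight_cpxEval {B B' C C' : Cpx R} (b : B' ⟶ B) (c : C ⟶ C') :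
    homCpxMap b c ▷ B' ≫ cpxEval B' C' = homCpx B C ◁ b ≫ cpxEval B C ≫ c := by
  apply (tensorHomEquiv _ _ _).injective
  rw [tensorHomEquiv_cpxEval, ← MonoidalCategory.id_tensorHom, tensorHomEquiv_naturality, cpxEval,
    Equiv.apply_symm_apply, Category.id_comp, Category.id_comp]

/-- The evaluation morphism in the pure derived category. -/
def derivedEval (B C : Cpx R) : (Q R).obj (homCpx B C) ⊗ (Q R).obj B ⟶ (Q R).obj C :=
  Functor.LaxMonoidal.μ (Q R) _ _ ≫ (Q R).map (cpxEval B C)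

lemma map_whiskerRight_derivedEval {A B C : Cpx R} (g : A ⟶ homCpx B C) :
    (Q R).map g ▷ (Q R).obj B ≫ derivedEval B C =
      Functor.LaxMonoidal.μ (Q R) A B ≫ (Q R).map (g ▷ B ≫ cpxEval B C) := by
  rw [derivedEval, Functor.LaxMonoidal.μ_natural_left_assoc, ← Functor.map_comp]

/-- I and Hom(B, I) are both right orthogonal, so morphisms into them in D_pur(R) are homotopy
classes, and the assertion is the adjunction in K(R). Nothing is required of B: resolving the first
variable only changes the answer by an isomorphism. -/
lemma isEvaluation_derivedEval (B : Cpx R) {I : Cpx R} (hI : IsKPureInjective I) :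
    IsEvaluation (derivedEval B I) := fun A => by
  obtain ⟨A, rfl⟩ := Q_obj_surjective A
  constructor
  · intro f g hfg
    obtain ⟨f, rfl⟩ := Q_map_surjective A (hI.homCpx B) f
    obtain ⟨g, rfl⟩ := Q_map_surjective A (hI.homCpx B) g
    dsimp only at hfg
    rw [map_whiskerRight_derivedEval, map_whiskerRight_derivedEval, cancel_epi,
      Q_map_eq_iff hI, ← quotient_map_tensorHomEquiv_eq_iff, tensorHomEquiv_cpxEval,
      tensorHomEquiv_cpxEval] at hfg
    exact (Q_map_eq_iff (hI.homCpx B) _ _).2 hfg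
  · intro h
    obtain ⟨h', hh'⟩ := Q_map_surjective (A ⊗ B) hI (Functor.OplaxMonoidal.δ (Q R) A B ≫ h)
    refine ⟨(Q R).map (tensorHomEquiv A B I h'), ?_⟩
    dsimp only
    have : tensorHomEquiv A B I h' ▷ B ≫ cpxEval B I = h' :=
      (tensorHomEquiv A B I).injective (tensorHomEquiv_cpxEval _)
    rw [map_whiskerRight_derivedEval, this, hh', Functor.Monoidal.μ_δ_assoc]

lemma derivedEval_naturality {B B' C C' : Cpx R} (b : B' ⟶ B) (c : C ⟶ C') :
    (Q R).map (homCpxMap b c) ▷ (Q R).obj B' ≫ derivedEval B' C' =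
      (Q R).obj (homCpx B C) ◁ (Q R).map b ≫ derivedEval B C ≫ (Q R).map c := by
  rw [map_whiskerRight_derivedEval, homCpxMap_whiskerRight_cpxEval, derivedEval,
    Functor.map_comp, Functor.map_comp, Category.assoc,
    Functor.LaxMonoidal.μ_natural_right_assoc]

variable {M N : Cpx R} (p : PureProjectiveResolution M) (i : PureInjectiveResolution N)

instance : IsIso ((Q R).map p.π) := isIso_Q_map p.isPureQuasiIso

instance : IsIso ((Q R).map i.ι) := isIso_Q_map i.isPureQuasiIso

/-- The evaluation morphism `Hom (P_M, I_N) ⊗ M ⟶ N` attached to resolutions of `M` and `N`. -/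
def resolutionEval :
    (Q R).obj (homCpx p.cpx i.cpx) ⊗ (Q R).obj M ⟶ (Q R).obj N :=
  _ ◁ inv ((Q R).map p.π) ≫ derivedEval p.cpx i.cpx ≫ inv ((Q R).map i.ι)

lemma resolutionEval_comp_map_ι :
    resolutionEval p i ≫ (Q R).map i.ι =
      _ ◁ inv ((Q R).map p.π) ≫ derivedEval p.cpx i.cpx := by
  simp [resolutionEval]

/-- The two augmentations are invertible in D_pur(R), and conjugating by isomorphisms preserves
universality. -/
lemma isEvaluation_resolutionEval : IsEvaluation (resolutionEval p i) := fun A => by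
  have h := isEvaluation_derivedEval p.cpx i.isKPureInjective A
  have key (g : A ⟶ (Q R).obj (homCpx p.cpx i.cpx)) :
      g ▷ (Q R).obj M ≫ resolutionEval p i = A ◁ inv ((Q R).map p.π) ≫
        (g ▷ (Q R).obj p.cpx ≫ derivedEval p.cpx i.cpx) ≫ inv ((Q R).map i.ι) := by
    rw [resolutionEval, ← whisker_exchange_assoc, Category.assoc]
  constructor
  · intro f g hfg
    dsimp only at hfg
    rw [key, key, cancel_epi, cancel_mono] at hfg
    exact h.1 hfg
  · intro f
    obtain ⟨g, hg⟩ := h.2 (A ◁ (Q R).map p.π ≫ f ≫ (Q R).map i.ι)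
    refine ⟨g, (key g).trans ?_⟩
    dsimp only at hg
    rw [hg]
    simp

lemma resolutionEval_naturality {M' N' : Cpx R} {p : PureProjectiveResolution M}
    {i : PureInjectiveResolution N} {p' : PureProjectiveResolution M'}
    {i' : PureInjectiveResolution N'}
    (f : (Q R).obj M' ⟶ (Q R).obj M) (g : (Q R).obj N ⟶ (Q R).obj N')
    (f' : p'.cpx ⟶ p.cpx) (g' : i.cpx ⟶ i'.cpx)
    (hf : (Q R).map f' ≫ (Q R).map p.π = (Q R).map p'.π ≫ f)
    (hg : (Q R).map i.ι ≫ (Q R).map g' = g ≫ (Q R).map i'.ι) :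
    (Q R).map (homCpxMap f' g') ▷ (Q R).obj M' ≫ resolutionEval p' i' =
      _ ◁ f ≫ resolutionEval p i ≫ g := by
  have hf' : inv ((Q R).map p'.π) ≫ (Q R).map f' = f ≫ inv ((Q R).map p.π) := by
    rw [IsIso.inv_comp_eq, ← reassoc_of% hf, IsIso.hom_inv_id, Category.comp_id]
  rw [← cancel_mono ((Q R).map i'.ι)]
  simp only [Category.assoc]
  rw [← hg, resolutionEval_comp_map_ι, reassoc_of% resolutionEval_comp_map_ι,
    ← whisker_exchange_assoc, derivedEval_naturality, ← MonoidalCategory.whiskerLeft_comp_assoc,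
    hf', MonoidalCategory.whiskerLeft_comp_assoc]

end Evaluation


lemma exists_isEvaluation (B C : Dpur R) :
    ∃ (E : Dpur R) (ev : E ⊗ B ⟶ C), IsEvaluation ev := by
  obtain ⟨M, rfl⟩ := Q_obj_surjective B
  obtain ⟨N, rfl⟩ := Q_obj_surjective C
  obtain ⟨p⟩ := nonempty_pureProjectiveResolution M
  obtain ⟨i⟩ := nonempty_pureInjectiveResolution N
  exact ⟨_, _, isEvaluation_resolutionEval p i⟩

instance : MonoidalClosed (Dpur R) where
  closed B := closedOfEvaluation (B := B)
    (fun C => (exists_isEvaluation B C).choose_spec.choose_spec)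

section Linear

lemma whiskerLeft_add_cpx (A : Cpx R) {B C : Cpx R} (f g : B ⟶ C) :
    A ◁ (f + g) = A ◁ f + A ◁ g := by
  ext n : 1
  refine tensor_hom_ext fun i j h => ?_
  simp [tensorι_whiskerLeft]

lemma whiskerLeft_smul_cpx (A : Cpx R) {B C : Cpx R} (r : R) (f : B ⟶ C) :
    A ◁ (r • f) = r • (A ◁ f) := by
  ext n : 1
  refine tensor_hom_ext fun i j h => ?_
  simp [tensorι_whiskerLeft]

instance : (Qh R).Linear R := Localization.functor_linear R (Qh R) (Kpac R).trW

instance : (Q R).Additive := inferInstanceAs (qK R ⋙ Qh R).Additive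

instance : (Q R).Linear R := inferInstanceAs ((qK R ⋙ Qh R).Linear R)

lemma whiskerLeft_Q_map (A : Cpx R) {B C : Cpx R} (f : B ⟶ C) :
    (Q R).obj A ◁ (Q R).map f = Functor.LaxMonoidal.μ (Q R) A B ≫ (Q R).map (A ◁ f) ≫
      Functor.OplaxMonoidal.δ (Q R) A C := by
  rw [← Functor.LaxMonoidal.μ_natural_right_assoc, Functor.Monoidal.μ_δ, Category.comp_id]

instance (A : Dpur R) : (tensorLeft A).Additive := by
  obtain ⟨A, rfl⟩ := Q_obj_surjective A
  -- Additivity may be tested on K(R), where every morphism comes from one of complexes.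
  rw [Localization.functor_additive_iff (Qh R) (Kpac R).trW]
  refine ⟨fun {X Y f g} => ?_⟩
  obtain ⟨X, rfl⟩ := HomotopyCategory.quotient_obj_surjective X
  obtain ⟨Y, rfl⟩ := HomotopyCategory.quotient_obj_surjective Y
  obtain ⟨f, rfl⟩ := (qK R).map_surjective f
  obtain ⟨g, rfl⟩ := (qK R).map_surjective g
  rw [← Functor.map_add]
  change (Q R).obj A ◁ (Q R).map (f + g) = (Q R).obj A ◁ (Q R).map f + (Q R).obj A ◁ (Q R).map g
  rw [whiskerLeft_Q_map, whiskerLeft_Q_map, whiskerLeft_Q_map, whiskerLeft_add_cpx,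
    Functor.map_add, Preadditive.add_comp, Preadditive.comp_add]

instance (A : Dpur R) : (tensorLeft A).Linear R := by
  obtain ⟨A, rfl⟩ := Q_obj_surjective A
  have : Localization.Lifting (Qh R) (Kpac R).trW (Qh R ⋙ tensorLeft ((Q R).obj A))
      (tensorLeft ((Q R).obj A)) := ⟨Iso.refl _⟩
  rw [← Localization.functor_linear_iff (Qh R) (Kpac R).trW R
    (Qh R ⋙ tensorLeft ((Q R).obj A))]
  refine ⟨fun {X Y} f r => ?_⟩
  obtain ⟨X, rfl⟩ := HomotopyCategory.quotient_obj_surjective X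
  obtain ⟨Y, rfl⟩ := HomotopyCategory.quotient_obj_surjective Y
  obtain ⟨f, rfl⟩ := (qK R).map_surjective f
  rw [← Functor.map_smul]
  change (Q R).obj A ◁ (Q R).map (r • f) = r • ((Q R).obj A ◁ (Q R).map f)
  rw [whiskerLeft_Q_map, whiskerLeft_Q_map, whiskerLeft_smul_cpx,
    Functor.map_smul, Linear.smul_comp, Linear.comp_smul]

lemma whiskerRight_eq_braiding {D : Type*} [Category D] [MonoidalCategory D] [BraidedCategory D]
    (A : D) {B C : D} (f : B ⟶ C) : f ▷ A = (β_ B A).hom ≫ A ◁ f ≫ (β_ C A).inv := by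
  simp

instance : MonoidalPreadditive (Dpur R) where
  whiskerLeft_zero {A _ _} := (tensorLeft A).map_zero _ _
  whiskerLeft_add {A _ _} f g := (tensorLeft A).map_add
  zero_whiskerRight {A _ _} := by
    rw [whiskerRight_eq_braiding]
    exact (congrArg (fun z => _ ≫ z ≫ _) ((tensorLeft A).map_zero _ _)).trans (by simp)
  add_whiskerRight {A _ _} f g := by
    rw [whiskerRight_eq_braiding, whiskerRight_eq_braiding, whiskerRight_eq_braiding]
    exact (congrArg (fun z => _ ≫ z ≫ _) ((tensorLeft A).map_add)).trans (by simp)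

instance : MonoidalLinear R (Dpur R) where
  whiskerLeft_smul A _ _ r f := (tensorLeft A).map_smul r f
  smul_whiskerRight r _ _ f A := by
    rw [whiskerRight_eq_braiding, whiskerRight_eq_braiding]
    exact (congrArg (fun z => _ ≫ z ≫ _) ((tensorLeft A).map_smul r f)).trans (by simp)

end Linear

/-- The internal Hom of the pure derived category is the pure derived Hom functor. -/
def pureDerivedHom (P : ∀ M : Cpx R, PureProjectiveResolution M)
    (I : ∀ N : Cpx R, PureInjectiveResolution N) : PureDerivedHom P I where
  functor := MonoidalClosed.internalHom
  iso M N := (isEvaluation_resolutionEval (P M) (I N)).iso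
  iso_naturality f g f' g' hf hg :=
    (isEvaluation_resolutionEval _ _).iso_naturality (isEvaluation_resolutionEval _ _) f g _
      (resolutionEval_naturality f g f' g' hf hg)

end

end PureDerived

end

/-! ### The theorem -/

open PureDerived in
theorem mainTheorem3 (R : Type u) [CommRing R] :
    (∀ M : Cpx R, Nonempty (PureProjectiveResolution M)) ∧
    (∀ N : Cpx R, Nonempty (PureInjectiveResolution N)) ∧
    ∃ (_ : MonoidalCategory (Dpur R)) (_ : SymmetricCategory (Dpur R)) (_ : (Q R).Monoidal),
      (∀ A B : Cpx R, Functor.LaxMonoidal.μ (Q R) A B ≫ (Q R).map (koszulBraiding A B) =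
        (β_ ((Q R).obj A) ((Q R).obj B)).hom ≫ Functor.LaxMonoidal.μ (Q R) B A) ∧
      ∀ (P : ∀ M : Cpx R, PureProjectiveResolution M)
        (I : ∀ N : Cpx R, PureInjectiveResolution N),
        ∃ (H : PureDerivedHom P I)
          (φ : ∀ A B C : Dpur R, H.obj (A ⊗ B) C ≅ H.obj A (H.obj B C))
          (ψ : ∀ A B C : Dpur R, (A ⊗ B ⟶ C) ≃ₗ[R] (A ⟶ H.obj B C))
          (_ : MonoidalClosed (Dpur R))
          (e : MonoidalClosed.internalHom ≅ H.functor),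
          (∀ {A A' B B' C C' : Dpur R} (a : A' ⟶ A) (b : B' ⟶ B) (c : C ⟶ C'),
            H.map (a ⊗ₘ b) c ≫ (φ A' B' C').hom = (φ A B C).hom ≫ H.map a (H.map b c)) ∧
          (∀ {A A' B B' C C' : Dpur R} (a : A' ⟶ A) (b : B' ⟶ B) (c : C ⟶ C') (f : A ⊗ B ⟶ C),
            ψ A' B' C' ((a ⊗ₘ b) ≫ f ≫ c) = a ≫ ψ A B C f ≫ H.map b c) ∧
          (∀ {X A B C : Dpur R} (f : X ⊗ (A ⊗ B) ⟶ C),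
            ψ X (A ⊗ B) C f ≫ (φ A B C).hom =
              ψ X A (H.obj B C) (ψ (X ⊗ A) B C ((α_ X A B).hom ≫ f))) ∧
          (∀ {A B C : Dpur R} (f : A ⊗ B ⟶ C),
            ψ A B C f =
              MonoidalClosed.curry ((β_ B A).hom ≫ f) ≫ (e.hom.app (op B)).app C) := by
  refine ⟨nonempty_pureProjectiveResolution, nonempty_pureInjectiveResolution, inferInstance,
    inferInstance, inferInstance, Q_μ_koszulBraiding, fun P I => ⟨pureDerivedHom P I,
      -- The identity serves as comparison, since the functor underlying `pureDerivedHom` is the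
      -- internal Hom itself; the resolutions enter only through the identification of its values.
      ihomTensorIso, tensorIhomLinearEquiv R, inferInstance, Iso.refl _, ?_, ?_, ?_, ?_⟩⟩
  · exact ihomTensorIso_hom_naturality
  · exact tensorIhomEquiv_naturality
  · intro X A B C f
    exact (comp_ihomTensorIso_hom _).trans (homIhomTensorEquiv_tensorIhomEquiv f)
  · intro A B C f
    exact (tensorIhomEquiv_apply f).trans (Category.comp_id _).symm
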